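/- Let $b\ge 2$ and $h\ge 0$ be integers, and let $T_h$ be the complete tree of height $h$ with branching factor $b$ (the root and every other non-leaf vertex has $b$ children, and the leaves are the vertices at distance $h$ from the root); let $n=n(b,h)$ be its number of vertices. A boundary condition $\Gamma$ is a subset of the leaves, and $\Omega_\Gamma$ is the set of independent sets $\sigma$ of $T_h$ whose set of leaves is exactly $\Gamma$. For $\omega>0$ put $\lambda=\omega(1+\omega)^b$. The (heat-bath) Glauber dynamics for the hard-core model with activity $\lambda$ and boundary condition $\Gamma$ is the Markov chain on $\Omega_\Gamma$ that in each step chooses one of the $n$ vertices $v$ uniformly at random; if $v$ is a leaf nothing changes; otherwise, if all neighbours of $v$ are unoccupied, $v$ becomes occupied with probability $\lambda/(1+\lambda)$ and unoccupied with probability $1/(1+\lambda)$, and if some neighbour of $v$ is occupied, $v$ is unoccupied. If $1=\gamma_1\ge\gamma_2\ge\dots\ge\gamma_{|\Omega_\Gamma|}$ are the eigenvalues, with multiplicity, of its transition matrix, the relaxation time is $T_{\mathrm{rel}}=T_{\mathrm{rel}}(b,h,\omega,\Gamma)=1/(1-\gamma)$ with $\gamma=\max\{\gamma_2,|\gamma_{|\Omega_\Gamma|}|\}$.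 Boundary conditions with $|\Omega_\Gamma|=1$ are excluded (they exist only for $h\le 1$). 1. There are constants $c,C>0$ and a function $f(b)=O((\ln\ln b)^2/\ln b)=o_b(1)$ such that for all $b\ge2$, all $0<\omega\le \ln b/b$, all $h$ and all boundary conditions $\Gamma$, $$c\,n\ \le\ T_{\mathrm{rel}}\ \le\ C\,n^{1+f(b)}.$$ 2. Let $D>0$, and for $0<\delta\le D$ let $\omega=(1+\delta)\ln b/b$. (a) There are a constant $C>0$ and a function $f(b)=O((\ln\ln b)^2/\ln b)=o_b(1)$, depending only on $D$, such that for all $b\ge 2$, all $0<\delta\le D$, all $h$ and all boundary conditions $\Gamma$, $$T_{\mathrm{rel}}\ \le\ C\,n^{1+\delta+f(b)}.$$ (b) There is a function $g(b)=O(\ln\ln b/\ln b)=o_b(1)$, depending only on $D$, such that for all $b\ge2$ and all $0<\delta\le D$ there are boundary conditions $\Gamma_h$ of $T_h$, $h=1,2,3,\dots$, with $|\Omega_{\Gamma_h}|\ge 2$, and a constant $c>0$ (depending on $b$ and $\delta$, not on $h$) such that for all $h\ge 1$, with the boundary condition $\Gamma_h$, $$T_{\mathrm{rel}}\ \ge\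 c\,n^{1+\delta/2-g(b)}.$$ -/

import Mathlib

open Filter Asymptotics

namespace HardCoreTree

/-- The vertices of the complete tree of height `h` with branching factor `b`: for height `0` a
single vertex; for height `h + 1` a root (`none`) together with `b` copies of the tree of
height `h` (`some (i, v)` is the vertex `v` of the `i`-th copy). -/
def Vertex (b : ℕ) : ℕ → Type
  | 0 => Unit
  | h + 1 => Option (Fin b × Vertex b h)

instance instDecidableEqVertex (b : ℕ) : (h : ℕ) → DecidableEq (Vertex b h)
  | 0 => inferInstanceAs (DecidableEq Unit)
  | h + 1 =>
    haveI := instDecidableEqVertex b h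
    inferInstanceAs (DecidableEq (Option (Fin b × Vertex b h)))

instance instFintypeVertex (b : ℕ) : (h : ℕ) → Fintype (Vertex b h)
  | 0 => inferInstanceAs (Fintype Unit)
  | h + 1 =>
    haveI := instFintypeVertex b h
    inferInstanceAs (Fintype (Option (Fin b × Vertex b h)))

/-- The root of the tree. -/
def root (b : ℕ) : (h : ℕ) → Vertex b h
  | 0 => ()
  | _ + 1 => none

/-- The leaves are the vertices at distance `h` from the root. -/
def IsLeaf (b : ℕ) : (h : ℕ) → Vertex b h → Prop
  | 0, _ => True
  | _ + 1, none => False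
  | h + 1, some (_, v) => IsLeaf b h v

/-- Adjacency: the root is joined to the roots of the `b` subtrees, and inside each of the
subtrees the adjacency is that of the tree of smaller height. -/
def Adj (b : ℕ) : (h : ℕ) → Vertex b h → Vertex b h → Prop
  | 0, _, _ => False
  | _ + 1, none, none => False
  | h + 1, none, some (_, w) => w = root b h
  | h + 1, some (_, v), none => v = root b h
  | h + 1, some (i, v), some (j, w) => i = j ∧ Adj b h v w

theorem adj_symm (b : ℕ) : ∀ (h : ℕ) (v w : Vertex b h), Adj b h v w → Adj b h w v
  | 0, _, _, hvw => hvw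
  | _ + 1, none, none, hvw => hvw
  | _ + 1, none, some (_, _), hvw => hvw
  | _ + 1, some (_, _), none, hvw => hvw
  | h + 1, some (_, v), some (_, w), hvw => ⟨hvw.1.symm, adj_symm b h v w hvw.2⟩

theorem adj_irrefl (b : ℕ) : ∀ (h : ℕ) (v : Vertex b h), ¬ Adj b h v v
  | 0, _, hv => hv
  | _ + 1, none, hv => hv
  | h + 1, some (_, v), hv => adj_irrefl b h v hv.2

/-- The complete tree `T_h` with branching factor `b`, as a simple graph. -/
def tree (b h : ℕ) : SimpleGraph (Vertex b h) where
  Adj := Adj b h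
  symm := ⟨adj_symm b h⟩
  loopless := ⟨adj_irrefl b h⟩

/-- The number `n` of vertices of the tree. -/
def numVertices (b h : ℕ) : ℕ := Fintype.card (Vertex b h)

/-- A boundary condition: the set of those leaves that are occupied. -/
abbrev Boundary (b h : ℕ) : Type := Set {v : Vertex b h // IsLeaf b h v}

/-- The state space `Ω_Γ`: independent sets of the tree that agree with `Γ` on the leaves. -/
abbrev Config {b h : ℕ} (Γ : Boundary b h) : Type :=
  {σ : Finset (Vertex b h) // (tree b h).IsIndepSet (σ : Set (Vertex b h)) ∧
    ∀ v : {v : Vertex b h // IsLeaf b h v}, v.1 ∈ σ ↔ v ∈ Γ}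

noncomputable instance instFintypeConfig {b h : ℕ} (Γ : Boundary b h) : Fintype (Config Γ) :=
  Fintype.ofFinite _

open Classical in
/-- The probability that the heat-bath update at the vertex `v`, with activity `lam`, takes `σ`
to `τ`. The leaves are frozen by the boundary condition; any other vertex becomes occupied with
probability `lam / (1 + lam)` if all its neighbours are unoccupied, and becomes unoccupied
otherwise. -/
noncomputable def siteUpdate {b h : ℕ} (lam : ℝ) (v : Vertex b h)
    (σ τ : Finset (Vertex b h)) : ℝ :=
  if IsLeaf b h v then (if τ = σ then 1 else 0)
  else if ∃ w ∈ σ, (tree b h).Adj v w then (if τ = σ.erase v then 1 else 0)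
  else (if τ = insert v σ then lam / (1 + lam) else 0) +
    (if τ = σ.erase v then 1 / (1 + lam) else 0)

/-- The transition matrix of the Glauber dynamics on `Ω_Γ`: a vertex of the tree is chosen
uniformly at random and updated. -/
noncomputable def glauber {b h : ℕ} (lam : ℝ) (Γ : Boundary b h) :
    Matrix (Config Γ) (Config Γ) ℝ :=
  Matrix.of fun σ τ => (∑ v : Vertex b h, siteUpdate lam v σ.1 τ.1) / (numVertices b h : ℝ)

/-- The second largest eigenvalue in absolute value, `max {γ₂, |γ_N|}`, of a stochastic matrix
with real eigenvalues `1 = γ₁ ≥ γ₂ ≥ … ≥ γ_N`, counted with multiplicity: one copy of the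
eigenvalue `1` is removed, and the maximum of the absolute values of the others is taken. -/
noncomputable def secondEigenvalue {S : Type*} [Fintype S] [DecidableEq S]
    (P : Matrix S S ℝ) : ℝ :=
  (((P.charpoly.roots.erase 1).map (fun x : ℝ => ‖x‖₊)).sup : NNReal)

/-- The spectral gap `1 - γ`. -/
noncomputable def spectralGap {S : Type*} [Fintype S] [DecidableEq S]
    (P : Matrix S S ℝ) : ℝ := 1 - secondEigenvalue P

/-- The activity `λ = ω (1 + ω) ^ b`. -/
noncomputable def activity (b : ℕ) (ω : ℝ) : ℝ := ω * (1 + ω) ^ b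

/-- The relaxation time of the Glauber dynamics with activity `ω (1 + ω) ^ b` on `T_h` with
boundary condition `Γ`: the inverse of the spectral gap. -/
noncomputable def relaxationTime {b h : ℕ} (ω : ℝ) (Γ : Boundary b h) : ℝ :=
  (spectralGap (glauber (activity b ω) Γ))⁻¹

end HardCoreTree

/-!
The relaxation time is governed by two functional-analytic facts about the reversible transition
matrix: a Poincaré inequality bounds the gap from below (`le_spectralGap`, which also needs that
heat-bath updates are positive semidefinite), and every test function bounds it from above
(`spectralGap_mul_wVar_le`). Variances and energies are unnormalized sums over all sets of vertices,
with a weight that vanishes off the state space, so that they factorize along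
`T_{h+1}` = root + `b` copies of `T_h`.

*Upper bounds.* Let `K ≥ 1` be a constant in the Poincaré inequality for trees of height `h`, in
continuous time and uniformly over the boundary conditions, and add one level. Given the state of the root, the
subtrees are independent, so their Poincaré inequalities tensorize (`wVar_pi_le`). The root itself
adds the variance of the conditional mean of `f` given the state of the root. The difference
`E[f | occupied] - E[f | unoccupied]` is split at `E[f | unoccupied, no child occupied]`: the first
part is paid for by the updates of the root, at the cost of a factor `1 + lam`, and the second by
the variance of `f` given that the root is unoccupied (`star_poincare`). Hence
`2 * (1 + lam) * K` works for height `h + 1` (`weight_poincare`), and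
`T_rel ≤ n * (2 * (1 + lam)) ^ h`. For `ω ≤ (1 + δ) * log b / b` one has
`lam ≤ (1 + δ) * log b * b ^ δ`, while `n ≥ b ^ h`; this is the claimed power of `n`. The lower bound
`T_rel ≥ n` comes from the occupation of a single vertex (`glauber_gap_le`).

*Slow mixing.* The occupation ratio at a vertex is `lam * ∏ 1 / (1 + r_i)` over the ratios `r_i` at
its children, with fixed point `ω`. Mixing two kinds of subtrees, with ratios on either side of `ω`,
below a new root gives again two ratios on either side of `ω`, and the excess of their
quotient over `1` shrinks by a factor `ω / (1 + ω)` (`encloses_step_ratio`). This yields boundary conditions under which the tree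
looks like the broadcasting process with parameter `ω` above a fixed height `h₀`
(`exists_balanced`). There the occupation of the root can be reconstructed from the level `h₀`: a
vertex is declared occupied if none of its children is. An unoccupied vertex is wrongly declared
occupied with probability about `b ^ (-(1 + δ))`. The test function is the declared value of the
root. A vertex of level `h₀` matters for it only if, along its path to the root, no sibling of a
vertex of the path is declared occupied; this has probability about `b ^ (-(1 + δ))` below an
unoccupied vertex and about `1` below an occupied one, which itself costs a factor `ω`. The best
paths alternate between the two states and lose `b ^ (-(2 + δ))` in two levels, so that the energy of
the test function decays like `b ^ (-δ / 2)` per level (`reconstructionBounds_of_balanced`,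
`gap_le_of_balanced`), up to powers of `log b` that go into the exponent `g`.
-/

namespace HardCoreTree

/-! ### Spectral gap of reversible stochastic matrices -/

/-- The variance of `f` under the (not necessarily normalized) weight `w`, multiplied by the square
of the total mass of `w`; this form stays meaningful when `w` vanishes identically. -/
def wVar {X : Type*} [Fintype X] (w f : X → ℝ) : ℝ :=
  (∑ x, w x) * ∑ x, w x * f x ^ 2 - (∑ x, w x * f x) ^ 2

/-- A matrix that is reversible with respect to the positive weight `π` has real eigenvalues `e k`
and a `π`-orthonormal basis of eigenfunctions `φ k`: it is similar to the symmetric matrix with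
entries `√(π i) P i j / √(π j)`. -/
theorem exists_reversible_eigenbasis {S : Type*} [Fintype S] [DecidableEq S] (P : Matrix S S ℝ)
    (π : S → ℝ) (hπ : ∀ i, 0 < π i) (hrev : ∀ i j, π i * P i j = π j * P j i) :
    ∃ (e : S → ℝ) (φ : S → S → ℝ),
      P.charpoly.roots = Finset.univ.val.map e ∧
      (∀ k, P.mulVec (φ k) = e k • φ k) ∧
      (∀ k l, ∑ i, π i * φ k i * φ l i = if k = l then 1 else 0) ∧
      (∀ f g : S → ℝ, ∑ i, π i * f i * g i =
        ∑ k, (∑ i, π i * φ k i * f i) * (∑ i, π i * φ k i * g i)) := by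
  set s : S → ℝ := fun i => √(π i) with hs
  have hs0 : ∀ i, s i ≠ 0 := fun i => (Real.sqrt_pos.2 (hπ i)).ne'
  have hss : ∀ i, s i * s i = π i := fun i => Real.mul_self_sqrt (hπ i).le
  set A : Matrix S S ℝ := Matrix.diagonal s * (P * Matrix.diagonal (fun i => (s i)⁻¹)) with hAdef
  have hAij : ∀ i j, A i j = s i * (P i j * (s j)⁻¹) := by
    intro i j
    simp [hAdef, Matrix.diagonal_mul, Matrix.mul_diagonal]
  have hA : A.IsHermitian := by
    ext i j
    simp only [Matrix.conjTranspose_apply, star_trivial, hAij]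
    have h := hrev i j
    rw [← hss i, ← hss j] at h
    have hi := hs0 i
    have hj := hs0 j
    field_simp
    linarith
  have hchar : A.charpoly = P.charpoly := by
    rw [hAdef, Matrix.charpoly_mul_comm, Matrix.mul_assoc, Matrix.diagonal_mul_diagonal]
    have : (fun i => (s i)⁻¹ * s i) = fun _ => (1 : ℝ) := by
      funext i
      exact inv_mul_cancel₀ (hs0 i)
    rw [this, Matrix.diagonal_one, Matrix.mul_one]
  set v := hA.eigenvectorBasis with hv
  have hinner : ∀ x y : EuclideanSpace ℝ S, inner ℝ x y = ∑ i, x i * y i := by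
    intro x y
    simp [PiLp.inner_apply, mul_comm]
  refine ⟨hA.eigenvalues, fun k i => v k i / s i, ?_, ?_, ?_, ?_⟩
  · rw [← hchar, hA.roots_charpoly_eq_eigenvalues]
    rfl
  · intro k
    have h := hA.mulVec_eigenvectorBasis k
    funext i
    have hi := congrFun h i
    simp only [Matrix.mulVec, dotProduct, hAij, Pi.smul_apply, smul_eq_mul] at hi ⊢
    rw [← mul_div_assoc, eq_div_iff (hs0 i), ← hv] at *
    rw [← hi, Finset.sum_mul]
    refine Finset.sum_congr rfl fun j _ => ?_
    ring
  · intro k l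
    have h := orthonormal_iff_ite.1 v.orthonormal k l
    rw [hinner] at h
    rw [← h]
    refine Finset.sum_congr rfl fun i _ => ?_
    have := hs0 i
    rw [← hss i]
    field_simp
  · intro f g
    have h := v.sum_inner_mul_inner (WithLp.toLp 2 fun i => s i * f i)
      (WithLp.toLp 2 fun i => s i * g i)
    simp only [hinner] at h
    have h1 : ∑ i, π i * f i * g i = ∑ i, s i * f i * (s i * g i) :=
      Finset.sum_congr rfl fun i _ => by rw [← hss i]; ring
    rw [h1, ← h]
    refine Finset.sum_congr rfl fun k _ => ?_
    congr 1
    · refine Finset.sum_congr rfl fun i _ => ?_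
      have := hs0 i
      rw [← hss i]
      field_simp
    · refine Finset.sum_congr rfl fun i _ => ?_
      have := hs0 i
      rw [← hss i]
      field_simp

/-- The Dirichlet form `⟨f, (1 - P) f⟩` with respect to the weight `π`. -/
def dirichlet {S : Type*} [Fintype S] (P : Matrix S S ℝ) (π f : S → ℝ) : ℝ :=
  ∑ i, π i * f i * (f i - P.mulVec f i)

/-- Under a Poincaré inequality the eigenvalue `1` of a reversible stochastic matrix is simple, and
all the other eigenfunctions have mean zero. -/
theorem exists_eigenbasis_of_poincare {S : Type*} [Fintype S] [DecidableEq S] [Nonempty S]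
    (P : Matrix S S ℝ) (π : S → ℝ) (hπ : ∀ i, 0 < π i)
    (hrev : ∀ i j, π i * P i j = π j * P j i) (hone : ∀ i, ∑ j, P i j = 1)
    (κ : ℝ) (hκ : 0 < κ) (hpoin : ∀ f, κ * wVar π f ≤ (∑ i, π i) * dirichlet P π f) :
    ∃ (e : S → ℝ) (φ : S → S → ℝ) (k₀ : S),
      P.charpoly.roots.erase 1 = (Finset.univ.erase k₀).val.map e ∧
      (∀ k, P.mulVec (φ k) = e k • φ k) ∧
      (∀ k l, ∑ i, π i * φ k i * φ l i = if k = l then 1 else 0) ∧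
      (∀ f g : S → ℝ, ∑ i, π i * f i * g i =
        ∑ k, (∑ i, π i * φ k i * f i) * (∑ i, π i * φ k i * g i)) ∧
      e k₀ = 1 ∧ ∀ k, k ≠ k₀ → ∑ i, π i * φ k i = 0 := by
  obtain ⟨e, φ, hroots, heig, horth, hpars⟩ := exists_reversible_eigenbasis P π hπ hrev
  have hZ : 0 < ∑ i, π i := Finset.sum_pos (fun i _ => hπ i) Finset.univ_nonempty
  -- pairing the eigenvalue equation with the constant function `1`
  have hmean : ∀ k, e k = 1 ∨ ∑ i, π i * φ k i = 0 := by
    intro k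
    have h1 : ∑ i, π i * P.mulVec (φ k) i = ∑ i, π i * φ k i := by
      simp only [Matrix.mulVec, dotProduct, Finset.mul_sum]
      rw [Finset.sum_comm]
      refine Finset.sum_congr rfl fun j _ => ?_
      calc ∑ i, π i * (P i j * φ k j) = ∑ i, π j * φ k j * P j i :=
            Finset.sum_congr rfl fun i _ => by rw [← mul_assoc, hrev i j]; ring
        _ = π j * φ k j := by rw [← Finset.mul_sum, hone, mul_one]
    rw [heig] at h1
    have h2 : (e k - 1) * ∑ i, π i * φ k i = 0 := by
      have h3 : ∑ i, π i * (e k • φ k) i = e k * ∑ i, π i * φ k i := by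
        rw [Finset.mul_sum]
        refine Finset.sum_congr rfl fun i _ => ?_
        simp only [Pi.smul_apply, smul_eq_mul]
        ring
      linarith
    rcases mul_eq_zero.1 h2 with h | h
    · left; linarith
    · right; exact h
  have hdir : ∀ k, dirichlet P π (φ k) = 1 - e k := by
    intro k
    have h := horth k k
    rw [if_pos rfl] at h
    calc dirichlet P π (φ k) = ∑ i, (1 - e k) * (π i * φ k i * φ k i) := by
          refine Finset.sum_congr rfl fun i _ => ?_
          rw [heig]
          simp only [Pi.smul_apply, smul_eq_mul]
          ring
      _ = 1 - e k := by rw [← Finset.mul_sum, h, mul_one]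
  have hvar : ∀ k, wVar π (φ k) = (∑ i, π i) - (∑ i, π i * φ k i) ^ 2 := by
    intro k
    have h := horth k k
    rw [if_pos rfl] at h
    rw [wVar]
    have : ∑ i, π i * φ k i ^ 2 = 1 := by
      rw [← h]
      exact Finset.sum_congr rfl fun i _ => by ring
    rw [this, mul_one]
  have hpars1 : ∑ i, π i = ∑ k, (∑ i, π i * φ k i) ^ 2 := by
    have h := hpars (fun _ => 1) (fun _ => 1)
    simp only [mul_one] at h
    rw [h]
    exact Finset.sum_congr rfl fun k _ => by ring
  obtain ⟨k₀, hk₀⟩ : ∃ k₀, ∑ i, π i * φ k₀ i ≠ 0 := by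
    by_contra hcon
    push Not at hcon
    rw [hpars1] at hZ
    simp [hcon] at hZ
  have he₀ : e k₀ = 1 := (hmean k₀).resolve_right hk₀
  -- an eigenfunction for the eigenvalue `1` takes up all of the constant function
  have hfull : ∀ k, e k = 1 → (∑ i, π i) ≤ (∑ i, π i * φ k i) ^ 2 := by
    intro k hk
    have h := hpoin (φ k)
    rw [hdir, hk, sub_self, mul_zero, hvar] at h
    nlinarith
  have hsum2 : ∀ k, k ≠ k₀ →
      (∑ i, π i * φ k i) ^ 2 + (∑ i, π i * φ k₀ i) ^ 2 ≤ ∑ i, π i := by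
    intro k hk
    rw [hpars1, ← Finset.sum_pair (f := fun l => (∑ i, π i * φ l i) ^ 2) hk]
    exact Finset.sum_le_sum_of_subset_of_nonneg (Finset.subset_univ _) fun _ _ _ => sq_nonneg _
  have hzero : ∀ k, k ≠ k₀ → ∑ i, π i * φ k i = 0 := by
    intro k hk
    have h1 := hfull k₀ he₀
    have h2 := hsum2 k hk
    have h3 : (∑ i, π i * φ k i) ^ 2 ≤ 0 := by linarith
    exact pow_eq_zero_iff two_ne_zero |>.1 (le_antisymm h3 (sq_nonneg _))
  refine ⟨e, φ, k₀, ?_, heig, horth, hpars, he₀, hzero⟩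
  rw [hroots, Finset.erase_val, ← he₀]
  exact (Multiset.map_erase_of_mem e _ (Finset.mem_univ k₀)).symm

/-- For a reversible, positive semidefinite stochastic matrix, a Poincaré inequality bounds the
spectral gap from below. -/
theorem le_spectralGap {S : Type*} [Fintype S] [DecidableEq S] [Nonempty S]
    (P : Matrix S S ℝ) (π : S → ℝ) (hπ : ∀ i, 0 < π i)
    (hrev : ∀ i j, π i * P i j = π j * P j i) (hone : ∀ i, ∑ j, P i j = 1)
    (hpsd : ∀ f, 0 ≤ ∑ i, π i * f i * P.mulVec f i)
    (κ : ℝ) (hκ : 0 < κ) (hκ1 : κ ≤ 1)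
    (hpoin : ∀ f, κ * wVar π f ≤ (∑ i, π i) * dirichlet P π f) :
    κ ≤ spectralGap P := by
  obtain ⟨e, φ, k₀, hroots, heig, horth, -, -, hzero⟩ :=
    exists_eigenbasis_of_poincare P π hπ hrev hone κ hκ hpoin
  have hZ : 0 < ∑ i, π i := Finset.sum_pos (fun i _ => hπ i) Finset.univ_nonempty
  have hself : ∀ k, ∑ i, π i * φ k i ^ 2 = 1 := fun k => by
    have h := horth k k
    rw [if_pos rfl] at h
    rw [← h]
    exact Finset.sum_congr rfl fun i _ => by ring
  have hPe : ∀ k, ∑ i, π i * φ k i * P.mulVec (φ k) i = e k := by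
    intro k
    calc ∑ i, π i * φ k i * P.mulVec (φ k) i = ∑ i, e k * (π i * φ k i ^ 2) := by
          refine Finset.sum_congr rfl fun i _ => ?_
          rw [heig]
          simp only [Pi.smul_apply, smul_eq_mul]
          ring
      _ = e k := by rw [← Finset.mul_sum, hself, mul_one]
  have hle : ∀ k, k ≠ k₀ → e k ≤ 1 - κ := by
    intro k hk
    have h := hpoin (φ k)
    have hd : dirichlet P π (φ k) = 1 - e k := by
      rw [← hPe k, ← hself k, ← Finset.sum_sub_distrib]
      exact Finset.sum_congr rfl fun i _ => by ring
    rw [wVar, hself, hzero k hk, hd] at h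
    have : (∑ i, π i) * κ ≤ (∑ i, π i) * (1 - e k) := by linarith
    have := le_of_mul_le_mul_left this hZ
    linarith
  have hnn : (0 : ℝ) ≤ 1 - κ := by linarith
  have hsup : ((P.charpoly.roots.erase 1).map (fun x : ℝ => ‖x‖₊)).sup ≤ 
      Real.toNNReal (1 - κ) := by
    rw [hroots, Multiset.sup_le]
    intro b hb
    simp only [Multiset.mem_map, Finset.mem_val, Finset.mem_erase] at hb
    obtain ⟨_, ⟨k, hk, rfl⟩, rfl⟩ := hb
    rw [← NNReal.coe_le_coe, coe_nnnorm, Real.coe_toNNReal _ hnn, Real.norm_eq_abs,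
      abs_of_nonneg]
    · exact hle k hk.1
    · rw [← hPe]
      exact hpsd _
  have : secondEigenvalue P ≤ 1 - κ := by
    rw [secondEigenvalue, ← Real.coe_toNNReal _ hnn]
    exact_mod_cast hsup
  rw [spectralGap]
  linarith

/-- A test function bounds the spectral gap from above. The Poincaré inequality only serves to make
the eigenvalue `1` simple. -/
theorem spectralGap_mul_wVar_le {S : Type*} [Fintype S] [DecidableEq S] [Nonempty S]
    (P : Matrix S S ℝ) (π : S → ℝ) (hπ : ∀ i, 0 < π i)
    (hrev : ∀ i j, π i * P i j = π j * P j i) (hone : ∀ i, ∑ j, P i j = 1)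
    (κ : ℝ) (hκ : 0 < κ) (hpoin : ∀ f, κ * wVar π f ≤ (∑ i, π i) * dirichlet P π f)
    (f : S → ℝ) :
    spectralGap P * wVar π f ≤ (∑ i, π i) * dirichlet P π f := by
  obtain ⟨e, φ, k₀, hroots, heig, horth, hpars, he₀, hzero⟩ :=
    exists_eigenbasis_of_poincare P π hπ hrev hone κ hκ hpoin
  have hle : ∀ k, k ≠ k₀ → e k ≤ secondEigenvalue P := by
    intro k hk
    have h : ‖e k‖₊ ≤ ((P.charpoly.roots.erase 1).map (fun x : ℝ => ‖x‖₊)).sup := by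
      apply Multiset.le_sup
      rw [hroots]
      exact Multiset.mem_map_of_mem _ (Multiset.mem_map_of_mem _
        (Finset.mem_erase.2 ⟨hk, Finset.mem_univ k⟩))
    calc e k ≤ ‖e k‖ := Real.le_norm_self _
      _ ≤ secondEigenvalue P := by
        rw [secondEigenvalue, ← coe_nnnorm]
        exact_mod_cast h
  set a : S → ℝ := fun k => ∑ i, π i * φ k i * f i with ha
  have hsq : ∑ i, π i * f i ^ 2 = ∑ k, a k ^ 2 := by
    have h := hpars f f
    simp only [← pow_two] at h
    rw [← h]
    exact Finset.sum_congr rfl fun i _ => by ring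
  have hPf : ∑ i, π i * f i * P.mulVec f i = ∑ k, e k * a k ^ 2 := by
    rw [hpars f (P.mulVec f)]
    refine Finset.sum_congr rfl fun k _ => ?_
    have : ∑ i, π i * φ k i * P.mulVec f i = e k * a k := by
      calc ∑ i, π i * φ k i * P.mulVec f i = ∑ i, π i * P.mulVec (φ k) i * f i := by
            simp only [Matrix.mulVec, dotProduct, Finset.mul_sum, Finset.sum_mul]
            rw [Finset.sum_comm]
            refine Finset.sum_congr rfl fun i _ => Finset.sum_congr rfl fun j _ => ?_
            calc π j * φ k j * (P j i * f i) = (π j * P j i) * φ k j * f i := by ring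
              _ = _ := by rw [hrev j i]; ring
        _ = e k * a k := by
            rw [ha, heig, Finset.mul_sum]
            refine Finset.sum_congr rfl fun i _ => ?_
            simp only [Pi.smul_apply, smul_eq_mul]
            ring
    rw [this]
    ring
  have hdir : dirichlet P π f = ∑ k, (1 - e k) * a k ^ 2 := by
    have : dirichlet P π f = ∑ i, π i * f i ^ 2 - ∑ i, π i * f i * P.mulVec f i := by
      rw [dirichlet, ← Finset.sum_sub_distrib]
      exact Finset.sum_congr rfl fun i _ => by ring
    rw [this, hsq, hPf, ← Finset.sum_sub_distrib]
    exact Finset.sum_congr rfl fun i _ => by ring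
  have hone' : ∀ g : S → ℝ, ∑ i, π i * g i = (∑ i, π i * φ k₀ i) * ∑ i, π i * φ k₀ i * g i := by
    intro g
    have h := hpars (fun _ => 1) g
    simp only [mul_one] at h
    rw [h]
    refine Finset.sum_eq_single k₀ (fun k _ hk => ?_) (by simp)
    rw [hzero k hk, zero_mul]
  have hZ1 : ∑ i, π i = (∑ i, π i * φ k₀ i) ^ 2 := by
    have h := hone' fun _ => 1
    simp only [mul_one] at h
    rw [h]
    ring
  have hvar : wVar π f = (∑ i, π i) * ∑ k ∈ Finset.univ.erase k₀, a k ^ 2 := by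
    rw [wVar, hsq, hone' f, mul_pow, ← hZ1,
      ← Finset.add_sum_erase _ (fun k => a k ^ 2) (Finset.mem_univ k₀)]
    ring
  have hZ : 0 ≤ ∑ i, π i := Finset.sum_nonneg fun i _ => (hπ i).le
  rw [hvar, hdir, ← Finset.add_sum_erase _ (fun k => (1 - e k) * a k ^ 2) (Finset.mem_univ k₀), he₀,
    sub_self, zero_mul, zero_add, mul_left_comm, Finset.mul_sum]
  refine mul_le_mul_of_nonneg_left (Finset.sum_le_sum fun k hk => ?_) hZ
  refine mul_le_mul_of_nonneg_right ?_ (sq_nonneg _)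
  have := hle k (Finset.ne_of_mem_erase hk)
  rw [spectralGap]
  linarith

/-! ### Variances under product weights and for a star -/

theorem two_mul_wVar {X : Type*} [Fintype X] (w f : X → ℝ) :
    2 * wVar w f = ∑ x, ∑ y, w x * w y * (f x - f y) ^ 2 := by
  have h : ∀ x y, w x * w y * (f x - f y) ^ 2 =
      (w x * f x ^ 2) * w y + w x * (w y * f y ^ 2) - 2 * ((w x * f x) * (w y * f y)) := by
    intro x y
    ring
  simp only [h, Finset.sum_sub_distrib, Finset.sum_add_distrib, ← Finset.mul_sum, ← Finset.sum_mul]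
  rw [wVar]
  ring

theorem sq_sum_mul_le {X : Type*} [Fintype X] (w f : X → ℝ) (hw : ∀ x, 0 ≤ w x) :
    (∑ x, w x * f x) ^ 2 ≤ (∑ x, w x) * ∑ x, w x * f x ^ 2 :=
  Finset.sum_sq_le_sum_mul_sum_of_sq_le_mul _ (fun x _ => hw x)
    (fun x _ => mul_nonneg (hw x) (sq_nonneg _)) (fun x _ => le_of_eq (by ring))

/-- The variance is convex in the function, being a positive semidefinite quadratic form. -/
theorem wVar_sum_mul_le {X Y : Type*} [Fintype X] [Fintype Y] (w : X → ℝ) (v : Y → ℝ)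
    (hw : ∀ x, 0 ≤ w x) (hv : ∀ y, 0 ≤ v y) (f : X → Y → ℝ) :
    wVar w (fun x => ∑ y, v y * f x y) ≤ (∑ y, v y) * ∑ y, v y * wVar w fun x => f x y := by
  suffices h : 2 * wVar w (fun x => ∑ y, v y * f x y) ≤
      (∑ y, v y) * ∑ y, v y * (2 * wVar w fun x => f x y) by
    have h2 : ∑ y, v y * (2 * wVar w fun x => f x y) = 2 * ∑ y, v y * wVar w fun x => f x y := by
      rw [Finset.mul_sum]
      exact Finset.sum_congr rfl fun y _ => by ring
    rw [h2] at h
    linarith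
  calc 2 * wVar w (fun x => ∑ y, v y * f x y)
      = ∑ x, ∑ x', w x * w x' * (∑ y, v y * (f x y - f x' y)) ^ 2 := by
        rw [two_mul_wVar]
        simp only [mul_sub, Finset.sum_sub_distrib]
    _ ≤ ∑ x, ∑ x', w x * w x' * ((∑ y, v y) * ∑ y, v y * (f x y - f x' y) ^ 2) :=
        Finset.sum_le_sum fun x _ => Finset.sum_le_sum fun x' _ =>
          mul_le_mul_of_nonneg_left (sq_sum_mul_le v _ hv) (mul_nonneg (hw x) (hw x'))
    _ = (∑ y, v y) * ∑ y, v y * (2 * wVar w fun x => f x y) := by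
        simp only [two_mul_wVar, Finset.mul_sum]
        rw [Finset.sum_comm' (t' := Finset.univ) (s' := fun _ => Finset.univ) (by simp)]
        rw [Finset.sum_congr rfl fun x _ => Finset.sum_comm]
        rw [Finset.sum_comm]
        refine Finset.sum_congr rfl fun y _ => ?_
        rw [Finset.sum_comm]
        refine Finset.sum_congr rfl fun x _ => Finset.sum_congr rfl fun x' _ => ?_
        simp only [Finset.sum_mul, Finset.mul_sum]
        refine Finset.sum_congr rfl fun y' _ => ?_
        ring

/-- Variances are subadditive over the two factors of a product weight (Efron–Stein). -/
theorem wVar_prod_le {X Y : Type*} [Fintype X] [Fintype Y] (w : X → ℝ) (v : Y → ℝ)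
    (hw : ∀ x, 0 ≤ w x) (hv : ∀ y, 0 ≤ v y) (f : X × Y → ℝ) :
    wVar (fun p : X × Y => w p.1 * v p.2) f ≤
      (∑ x, w x) * ∑ x, w x * wVar v (fun y => f (x, y)) +
        (∑ y, v y) * ∑ y, v y * wVar w (fun x => f (x, y)) := by
  have key : wVar (fun p : X × Y => w p.1 * v p.2) f =
      (∑ x, w x) * ∑ x, w x * wVar v (fun y => f (x, y)) +
        wVar w (fun x => ∑ y, v y * f (x, y)) := by
    simp only [wVar, Fintype.sum_prod_type]
    have h1 : ∑ x, ∑ y, w x * v y = (∑ x, w x) * ∑ y, v y := by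
      rw [Finset.sum_mul_sum]
    have h2 : ∀ g : X × Y → ℝ, ∑ x, ∑ y, w x * v y * g (x, y) = ∑ x, w x * ∑ y, v y * g (x, y) := by
      intro g
      refine Finset.sum_congr rfl fun x _ => ?_
      rw [Finset.mul_sum]
      exact Finset.sum_congr rfl fun y _ => by ring
    rw [h1, h2 f, h2 fun p => f p ^ 2]
    simp only [mul_sub, Finset.sum_sub_distrib]
    have h3 : ∑ x, w x * ((∑ y, v y) * ∑ y, v y * f (x, y) ^ 2) =
        (∑ y, v y) * ∑ x, w x * ∑ y, v y * f (x, y) ^ 2 := by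
      rw [Finset.mul_sum]
      exact Finset.sum_congr rfl fun y _ => by ring
    rw [h3]
    ring
  rw [key]
  gcongr
  exact wVar_sum_mul_le w v hw hv fun x y => f (x, y)

theorem sum_pi_prod {X : Type*} [Fintype X] {n : ℕ} (w : Fin n → X → ℝ) :
    ∑ s : Fin n → X, ∏ i, w i (s i) = ∏ i, ∑ x, w i x := by
  rw [Finset.prod_univ_sum, Fintype.piFinset_univ]

theorem wVar_comp_equiv {X Y : Type*} [Fintype X] [Fintype Y] (φ : X ≃ Y) (w f : Y → ℝ) :
    wVar (fun x => w (φ x)) (fun x => f (φ x)) = wVar w f := by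
  simp only [wVar]
  rw [φ.sum_comp w, φ.sum_comp fun y => w y * f y ^ 2, φ.sum_comp fun y => w y * f y]

/-- A Poincaré inequality passes from the factors to a product weight with the same constant. The
energy of `g` under the weight `w i` is `∑ x, w i x * e i x g`. -/
theorem wVar_pi_le {X : Type*} [Fintype X] (K : ℝ) : ∀ (n : ℕ) (w : Fin n → X → ℝ)
    (_ : ∀ i x, 0 ≤ w i x) (e : Fin n → X → (X → ℝ) → ℝ)
    (_ : ∀ i g, wVar (w i) g ≤ K * ((∑ x, w i x) * ∑ x, w i x * e i x g))
    (f : (Fin n → X) → ℝ),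
    wVar (fun s => ∏ i, w i (s i)) f ≤
      K * ((∑ s : Fin n → X, ∏ i, w i (s i)) *
        ∑ s : Fin n → X, (∏ i, w i (s i)) *
          ∑ i, e i (s i) fun t => f (Function.update s i t)) := by
  intro n
  induction n with
  | zero =>
    intro w _ e _ f
    simp [wVar]
  | succ n ih =>
    intro w hw e hP f
    let φ : X × (Fin n → X) ≃ (Fin (n + 1) → X) := Fin.consEquiv fun _ => X
    have hφ : ∀ x s, φ (x, s) = Fin.cons x s := fun _ _ => rfl
    set u : (Fin n → X) → ℝ := fun s => ∏ i, w i.succ (s i) with hu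
    have hu0 : ∀ s, 0 ≤ u s := fun s => Finset.prod_nonneg fun i _ => hw _ _
    have hw' : ∀ p : X × (Fin n → X), ∏ i, w i (φ p i) = w 0 p.1 * u p.2 := by
      rintro ⟨x, s⟩
      rw [hφ, Fin.prod_univ_succ]
      simp [hu]
    have hZ : ∑ s : Fin (n + 1) → X, ∏ i, w i (s i) = (∑ x, w 0 x) * ∑ s, u s := by
      rw [← φ.sum_comp, Finset.sum_mul_sum, Fintype.sum_prod_type]
      exact Finset.sum_congr rfl fun x _ => Finset.sum_congr rfl fun s _ => hw' _
    have hE : ∑ s : Fin (n + 1) → X, (∏ i, w i (s i)) *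
          ∑ i, e i (s i) (fun t => f (Function.update s i t)) =
        ∑ s, u s * ∑ x, w 0 x * e 0 x (fun t => f (Fin.cons t s)) +
        ∑ x, w 0 x * ∑ s, u s * ∑ i, e i.succ (s i)
          (fun t => f (Fin.cons x (Function.update s i t))) := by
      rw [← φ.sum_comp, Fintype.sum_prod_type]
      have : ∀ x s, (∏ i, w i (φ (x, s) i)) * ∑ i, e i (φ (x, s) i)
            (fun t => f (Function.update (φ (x, s)) i t)) =
          u s * (w 0 x * e 0 x (fun t => f (Fin.cons t s))) + w 0 x * (u s * ∑ i, e i.succ (s i)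
            (fun t => f (Fin.cons x (Function.update s i t)))) := by
        intro x s
        rw [hw', hφ, Fin.sum_univ_succ]
        simp only [Fin.cons_zero, Fin.cons_succ, Fin.update_cons_zero, Fin.cons_update]
        ring
      simp only [this, Finset.sum_add_distrib, ← Finset.mul_sum]
      rw [Finset.sum_comm]
      simp only [← Finset.mul_sum]
    have hV : wVar (fun s : Fin (n + 1) → X => ∏ i, w i (s i)) f =
        wVar (fun p : X × (Fin n → X) => w 0 p.1 * u p.2) fun p => f (Fin.cons p.1 p.2) := by
      rw [← wVar_comp_equiv φ]
      congr 1
      funext p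
      exact hw' p
    rw [hV, hZ, hE]
    refine (wVar_prod_le (w 0) u (hw 0) hu0 _).trans ?_
    have h1 : ∀ x, wVar u (fun s => f (Fin.cons x s)) ≤
        K * ((∑ s, u s) * ∑ s, u s * ∑ i, e i.succ (s i)
          (fun t => f (Fin.cons x (Function.update s i t)))) := fun x =>
      ih (fun i => w i.succ) (fun i => hw i.succ) (fun i => e i.succ) (fun i => hP i.succ)
        fun s => f (Fin.cons x s)
    have h2 : ∀ s, wVar (w 0) (fun x => f (Fin.cons x s)) ≤
        K * ((∑ x, w 0 x) * ∑ x, w 0 x * e 0 x (fun t => f (Fin.cons t s))) := fun s =>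
      hP 0 fun x => f (Fin.cons x s)
    calc (∑ x, w 0 x) * ∑ x, w 0 x * wVar u (fun s => f (Fin.cons x s)) +
          (∑ s, u s) * ∑ s, u s * wVar (w 0) (fun x => f (Fin.cons x s))
        ≤ (∑ x, w 0 x) * ∑ x, w 0 x * (K * ((∑ s, u s) * ∑ s, u s * ∑ i, e i.succ (s i)
            (fun t => f (Fin.cons x (Function.update s i t))))) +
          (∑ s, u s) * ∑ s, u s * (K * ((∑ x, w 0 x) * ∑ x, w 0 x *
            e 0 x (fun t => f (Fin.cons t s)))) := by
          refine add_le_add (mul_le_mul_of_nonneg_left (Finset.sum_le_sum fun x _ =>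
            mul_le_mul_of_nonneg_left (h1 x) (hw 0 x)) (Finset.sum_nonneg fun x _ => hw 0 x))
            (mul_le_mul_of_nonneg_left (Finset.sum_le_sum fun s _ =>
            mul_le_mul_of_nonneg_left (h2 s) (hu0 s)) (Finset.sum_nonneg fun s _ => hu0 s))
      _ = _ := by
          have e1 : ∀ (F : X → ℝ), ∑ x, w 0 x * (K * ((∑ s, u s) * F x)) =
              K * ((∑ s, u s) * ∑ x, w 0 x * F x) := by
            intro F
            simp only [Finset.mul_sum (s := (Finset.univ : Finset X))]
            exact Finset.sum_congr rfl fun x _ => by ring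
          have e2 : ∀ (F : (Fin n → X) → ℝ), ∑ s, u s * (K * ((∑ x, w 0 x) * F s)) =
              K * ((∑ x, w 0 x) * ∑ s, u s * F s) := by
            intro F
            simp only [Finset.mul_sum (s := (Finset.univ : Finset (Fin n → X)))]
            exact Finset.sum_congr rfl fun x _ => by ring
          rw [e1, e2]
          ring

/-- The Poincaré inequality for a star. Its centre is unoccupied with weight `W` or occupied with
weight `lam * W₀` on the states of the branches, where `W₀ ≤ W` is `W` restricted to the states
that leave the centre unblocked; `f₀` and `f₁` are the test function in the two cases. The
difference of the two conditional means of the test function is split at the mean of `f₀` under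
`W₀`: the first part is controlled by the updates of the centre, the second by the variance
of `f₀`. -/
theorem star_poincare {Y : Type*} [Fintype Y] (W W₀ f₀ f₁ : Y → ℝ) (hW₀ : ∀ y, 0 ≤ W₀ y)
    (hW : ∀ y, W₀ y ≤ W y) (lam : ℝ) (hlam : 0 < lam) (K E₀ E₁ : ℝ) (hK : 1 ≤ K)
    (hE₀ : 0 ≤ E₀) (hE₁ : 0 ≤ E₁)
    (h₀ : wVar W f₀ ≤ K * ((∑ y, W y) * E₀)) (h₁ : wVar W₀ f₁ ≤ K * ((∑ y, W₀ y) * E₁)) :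
    ((∑ y, W y) + lam * ∑ y, W₀ y) * ((∑ y, W y * f₀ y ^ 2) + lam * ∑ y, W₀ y * f₁ y ^ 2) -
        ((∑ y, W y * f₀ y) + lam * ∑ y, W₀ y * f₁ y) ^ 2 ≤
      2 * (1 + lam) * K * (((∑ y, W y) + lam * ∑ y, W₀ y) *
        (E₀ + lam * E₁ + lam / (1 + lam) * ∑ y, W₀ y * (f₁ y - f₀ y) ^ 2)) := by
  have hWn : ∀ y, 0 ≤ W y := fun y => (hW₀ y).trans (hW y)
  set Z := ∑ y, W y with hZdef
  set A := ∑ y, W₀ y with hAdef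
  set R := ∑ y, W₀ y * (f₁ y - f₀ y) ^ 2 with hR
  have hR0 : 0 ≤ R := Finset.sum_nonneg fun y _ => mul_nonneg (hW₀ y) (sq_nonneg _)
  have hA0 : 0 ≤ A := Finset.sum_nonneg fun y _ => hW₀ y
  have hAZ : A ≤ Z := Finset.sum_le_sum fun y _ => hW y
  rcases hA0.eq_or_lt with hA | hA
  · have hz : ∀ y, W₀ y = 0 := fun y =>
      (Finset.sum_eq_zero_iff_of_nonneg fun y _ => hW₀ y).1 hA.symm y (Finset.mem_univ y)
    have hR' : R = 0 := by simp [hR, hz]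
    rw [hR', ← hA]
    simp only [hz, zero_mul, Finset.sum_const_zero, mul_zero, add_zero]
    have hZ : 0 ≤ Z := hA0.trans hAZ
    have hpos : 0 ≤ K * (Z * E₀) := by positivity
    have hE1 : 0 ≤ K * (Z * (lam * E₁)) := by positivity
    rw [wVar] at h₀
    have : K * (Z * E₀) ≤ 2 * (1 + lam) * K * (Z * (E₀ + lam * E₁)) := by
      have e : 2 * (1 + lam) * K * (Z * (E₀ + lam * E₁)) =
        K * (Z * E₀) + (1 + 2 * lam) * (K * (Z * E₀)) +
          2 * (1 + lam) * (K * (Z * (lam * E₁))) := by ring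
      rw [e]
      have : 0 ≤ (1 + 2 * lam) * (K * (Z * E₀)) := by positivity
      have : 0 ≤ 2 * (1 + lam) * (K * (Z * (lam * E₁))) := by positivity
      linarith
    linarith
  · have hZ : 0 < Z := hA.trans_le hAZ
    set S₀ := ∑ y, W y * f₀ y with hS₀
    set Q₀ := ∑ y, W y * f₀ y ^ 2 with hQ₀
    set S₁ := ∑ y, W₀ y * f₁ y with hS₁
    set Q₁ := ∑ y, W₀ y * f₁ y ^ 2 with hQ₁
    set T := ∑ y, W₀ y * f₀ y with hT
    set m₀ := S₀ / Z with hm₀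
    set m₁ := S₁ / A with hm₁
    set a := T / A with ha
    have hS₀' : S₀ = Z * m₀ := by rw [hm₀]; field_simp
    have hS₁' : S₁ = A * m₁ := by rw [hm₁]; field_simp
    have hT' : T = A * a := by rw [ha]; field_simp
    -- the two parts of the difference of the means
    have hroot : A * (m₁ - a) ^ 2 ≤ R := by
      have h := sq_sum_mul_le W₀ (fun y => f₁ y - f₀ y) hW₀
      have h2 : ∑ y, W₀ y * (f₁ y - f₀ y) = A * (m₁ - a) := by
        simp only [mul_sub, Finset.sum_sub_distrib]
        rw [← hS₁', ← hT']
      rw [h2] at h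
      have h3 : A * (A * (m₁ - a) ^ 2) ≤ A * R := by
        calc A * (A * (m₁ - a) ^ 2) = (A * (m₁ - a)) ^ 2 := by ring
          _ ≤ _ := h
      exact le_of_mul_le_mul_left h3 hA
    have hcond : Z * (A * (a - m₀) ^ 2) ≤ wVar W f₀ := by
      have h := sq_sum_mul_le W₀ (fun y => f₀ y - m₀) hW₀
      have h2 : ∑ y, W₀ y * (f₀ y - m₀) = A * (a - m₀) := by
        simp only [mul_sub, Finset.sum_sub_distrib]
        rw [← hT', ← Finset.sum_mul]
      rw [h2] at h
      have h3 : A * (a - m₀) ^ 2 ≤ ∑ y, W₀ y * (f₀ y - m₀) ^ 2 := by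
        have h3 : A * (A * (a - m₀) ^ 2) ≤ A * ∑ y, W₀ y * (f₀ y - m₀) ^ 2 := by
          calc A * (A * (a - m₀) ^ 2) = (A * (a - m₀)) ^ 2 := by ring
            _ ≤ _ := h
        exact le_of_mul_le_mul_left h3 hA
      have h4 : ∑ y, W₀ y * (f₀ y - m₀) ^ 2 ≤ ∑ y, W y * (f₀ y - m₀) ^ 2 :=
        Finset.sum_le_sum fun y _ => mul_le_mul_of_nonneg_right (hW y) (sq_nonneg _)
      have h5 : ∑ y, W y * (f₀ y - m₀) ^ 2 = Q₀ - 2 * m₀ * S₀ + m₀ ^ 2 * Z := by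
        rw [hQ₀, hS₀, hZdef, Finset.mul_sum, Finset.mul_sum, ← Finset.sum_sub_distrib,
          ← Finset.sum_add_distrib]
        exact Finset.sum_congr rfl fun y _ => by ring
      calc Z * (A * (a - m₀) ^ 2) ≤ Z * (Q₀ - 2 * m₀ * S₀ + m₀ ^ 2 * Z) :=
            mul_le_mul_of_nonneg_left (by linarith) hZ.le
        _ = wVar W f₀ := by
            rw [wVar, ← hZdef, ← hQ₀, ← hS₀, hS₀']
            ring
    have h₀' : Q₀ ≤ K * E₀ + Z * m₀ ^ 2 := by
      have : Z * Q₀ ≤ Z * (K * E₀ + Z * m₀ ^ 2) := by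
        rw [wVar, ← hZdef, ← hQ₀, ← hS₀, hS₀'] at h₀
        linarith
      exact le_of_mul_le_mul_left this hZ
    have h₁' : Q₁ ≤ K * E₁ + A * m₁ ^ 2 := by
      have : A * Q₁ ≤ A * (K * E₁ + A * m₁ ^ 2) := by
        rw [wVar, ← hAdef, ← hQ₁, ← hS₁, hS₁'] at h₁
        linarith
      exact le_of_mul_le_mul_left this hA
    have hcond' : A * (a - m₀) ^ 2 ≤ K * E₀ := by
      have : Z * (A * (a - m₀) ^ 2) ≤ Z * (K * E₀) := by linarith
      exact le_of_mul_le_mul_left this hZ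
    have hsplit : A * (m₁ - m₀) ^ 2 ≤ 2 * R + 2 * (K * E₀) := by
      have : (m₁ - m₀) ^ 2 ≤ 2 * (m₁ - a) ^ 2 + 2 * (a - m₀) ^ 2 := by
        nlinarith [sq_nonneg (m₁ - a - (a - m₀))]
      have := mul_le_mul_of_nonneg_left this hA.le
      linarith
    calc (Z + lam * A) * (Q₀ + lam * Q₁) - (S₀ + lam * S₁) ^ 2
        ≤ (Z + lam * A) * ((K * E₀ + Z * m₀ ^ 2) + lam * (K * E₁ + A * m₁ ^ 2)) -
            (S₀ + lam * S₁) ^ 2 := by gcongr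
      _ = (Z + lam * A) * (K * E₀ + lam * (K * E₁)) + lam * Z * (A * (m₁ - m₀) ^ 2) := by
          rw [hS₀', hS₁']
          ring
      _ ≤ (Z + lam * A) * (K * E₀ + lam * (K * E₁)) + lam * Z * (2 * R + 2 * (K * E₀)) := by
          gcongr
      _ ≤ (Z + lam * A) * (K * E₀ + lam * (K * E₁)) +
            lam * (Z + lam * A) * (2 * (K * R) + 2 * (K * E₀)) := by
          have h1 : Z ≤ Z + lam * A := by
            have := mul_pos hlam hA
            linarith
          have h2 : R ≤ K * R := le_mul_of_one_le_left hR0 hK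
          have : 0 ≤ K * E₀ := by positivity
          gcongr
      _ = 2 * (1 + lam) * K * ((Z + lam * A) * (E₀ + lam * E₁ + lam / (1 + lam) * R)) -
            (Z + lam * A) * K * (E₀ + (1 + 2 * lam) * (lam * E₁)) := by
          have : (1 + lam) ≠ 0 := by positivity
          field_simp
          ring
      _ ≤ _ := by
          have : 0 ≤ (Z + lam * A) * K * (E₀ + (1 + 2 * lam) * (lam * E₁)) := by positivity
          linarith

/-! ### Recursive structure of configurations, weights and energies -/

section Structure

variable {b h : ℕ}

/-- The vertex of `T_{h+1}` that corresponds to the vertex `v` of the `i`-th subtree. -/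
def below (i : Fin b) (v : Vertex b h) : Vertex b (h + 1) := some (i, v)

theorem vertex_succ_cases (u : Vertex b (h + 1)) :
    u = root b (h + 1) ∨ ∃ (i : Fin b) (v : Vertex b h), u = below i v :=
  match u with
  | none => Or.inl rfl
  | some (i, v) => Or.inr ⟨i, v, rfl⟩

theorem below_ne_root (i : Fin b) (v : Vertex b h) : below i v ≠ root b (h + 1) :=
  Option.some_ne_none _

theorem below_inj {i j : Fin b} {v w : Vertex b h} : below i v = below j w ↔ i = j ∧ v = w := by
  constructor
  · intro e
    exact Prod.mk.inj (Option.some.inj e)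
  · rintro ⟨rfl, rfl⟩
    rfl

theorem not_isLeaf_root : ¬ IsLeaf b (h + 1) (root b (h + 1)) := fun e => e

theorem isLeaf_below (i : Fin b) (v : Vertex b h) :
    IsLeaf b (h + 1) (below i v) ↔ IsLeaf b h v := Iff.rfl

theorem sum_vertex_succ (F : Vertex b (h + 1) → ℝ) :
    ∑ v, F v = F (root b (h + 1)) + ∑ i : Fin b, ∑ v : Vertex b h, F (below i v) := by
  have h1 := Fintype.sum_option (α := Fin b × Vertex b h) F
  rw [Fintype.sum_prod_type] at h1
  exact h1

theorem numVertices_zero (b : ℕ) : numVertices b 0 = 1 := rfl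

theorem numVertices_succ (b h : ℕ) : numVertices b (h + 1) = b * numVertices b h + 1 := by
  have h1 : numVertices b (h + 1) = Fintype.card (Option (Fin b × Vertex b h)) := rfl
  rw [h1, Fintype.card_option, Fintype.card_prod, Fintype.card_fin]
  rfl

/-- The set of vertices of `T_{h+1}` made of the sets `s i` in the `b` subtrees and, if `x` holds,
of the root. -/
def glue (x : Bool) (s : Fin b → Finset (Vertex b h)) : Finset (Vertex b (h + 1)) :=
  Finset.univ.filter fun u : Vertex b (h + 1) =>
    (match u with
      | none => x
      | some (i, v) => decide (v ∈ s i) : Bool) = true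

@[simp]
theorem root_mem_glue (x : Bool) (s : Fin b → Finset (Vertex b h)) :
    root b (h + 1) ∈ glue x s ↔ x = true := by
  rw [glue, Finset.mem_filter]
  exact and_iff_right (Finset.mem_univ _)

@[simp]
theorem below_mem_glue (x : Bool) (s : Fin b → Finset (Vertex b h)) (i : Fin b) (v : Vertex b h) :
    below i v ∈ glue x s ↔ v ∈ s i := by
  rw [glue, Finset.mem_filter]
  exact (and_iff_right (Finset.mem_univ _)).trans decide_eq_true_iff

/-- The part of a set of vertices that lies in the `i`-th subtree. -/
def branch (σ : Finset (Vertex b (h + 1))) (i : Fin b) : Finset (Vertex b h) :=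
  Finset.univ.filter fun v => below i v ∈ σ

@[simp]
theorem mem_branch (σ : Finset (Vertex b (h + 1))) (i : Fin b) (v : Vertex b h) :
    v ∈ branch σ i ↔ below i v ∈ σ := by
  simp [branch]

@[simp]
theorem branch_glue (x : Bool) (s : Fin b → Finset (Vertex b h)) : branch (glue x s) = s := by
  funext i
  ext v
  simp

theorem finset_vertex_succ_ext {σ τ : Finset (Vertex b (h + 1))}
    (h0 : root b (h + 1) ∈ σ ↔ root b (h + 1) ∈ τ)
    (h1 : ∀ (i : Fin b) (v : Vertex b h), below i v ∈ σ ↔ below i v ∈ τ) : σ = τ := by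
  ext u
  rcases vertex_succ_cases u with rfl | ⟨i, v, rfl⟩
  · exact h0
  · exact h1 i v

/-- Sets of vertices of `T_{h+1}` as pairs of a state of the root and of states of the subtrees. -/
def glueEquiv (b h : ℕ) : Bool × (Fin b → Finset (Vertex b h)) ≃ Finset (Vertex b (h + 1)) where
  toFun p := glue p.1 p.2
  invFun σ := (decide (root b (h + 1) ∈ σ), branch σ)
  left_inv p := by
    rcases p with ⟨x, s⟩
    simp
  right_inv σ := finset_vertex_succ_ext (by simp) (by simp)

theorem sum_glue (F : Finset (Vertex b (h + 1)) → ℝ) :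
    ∑ σ, F σ = ∑ s : Fin b → Finset (Vertex b h), F (glue false s) +
      ∑ s : Fin b → Finset (Vertex b h), F (glue true s) := by
  rw [← (glueEquiv b h).sum_comp, Fintype.sum_prod_type, Fintype.sum_bool, add_comm]
  rfl

theorem erase_root_glue (x : Bool) (s : Fin b → Finset (Vertex b h)) :
    (glue x s).erase (root b (h + 1)) = glue false s := by
  refine finset_vertex_succ_ext ?_ ?_
  · simp
  · intro i v
    simp [below_ne_root]

theorem erase_below_glue (x : Bool) (s : Fin b → Finset (Vertex b h)) (i : Fin b)
    (v : Vertex b h) :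
    (glue x s).erase (below i v) = glue x (Function.update s i ((s i).erase v)) := by
  refine finset_vertex_succ_ext ?_ ?_
  · simp [(below_ne_root i v).symm]
  · intro j w
    rw [Finset.mem_erase, below_mem_glue, below_mem_glue, ne_eq, below_inj]
    by_cases hj : j = i
    · subst hj
      simp
    · simp [hj]

/-- The boundary condition induced on the `i`-th subtree. -/
def childBoundary (Γ : Boundary b (h + 1)) (i : Fin b) : Boundary b h :=
  {v | (⟨some (i, v.1), v.2⟩ : {v : Vertex b (h + 1) // IsLeaf b (h + 1) v}) ∈ Γ}

/-- The boundary condition on `T_{h+1}` with given restrictions to the subtrees. -/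
def glueBoundary (G : Fin b → Boundary b h) : Boundary b (h + 1) :=
  {u | match u with
    | ⟨none, _⟩ => False
    | ⟨some (i, v), hv⟩ => (⟨v, hv⟩ : {v : Vertex b h // IsLeaf b h v}) ∈ G i}

@[simp]
theorem childBoundary_glueBoundary (G : Fin b → Boundary b h) (i : Fin b) :
    childBoundary (glueBoundary G) i = G i := rfl

/-- `σ` is an independent set that agrees with `Γ` on the leaves; this is the predicate that defines
`Config Γ`. -/
def IsConfig (Γ : Boundary b h) (σ : Finset (Vertex b h)) : Prop :=
  (tree b h).IsIndepSet (σ : Set (Vertex b h)) ∧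
    ∀ v : {v : Vertex b h // IsLeaf b h v}, v.1 ∈ σ ↔ v ∈ Γ

theorem isConfig_iff (Γ : Boundary b h) (σ : Finset (Vertex b h)) :
    IsConfig Γ σ ↔ (∀ v ∈ σ, ∀ w ∈ σ, ¬ Adj b h v w) ∧ ∀ v hv, v ∈ σ ↔ ⟨v, hv⟩ ∈ Γ := by
  constructor
  · rintro ⟨h1, h2⟩
    refine ⟨fun v hv w hw ha => ?_, fun v hv => h2 ⟨v, hv⟩⟩
    exact h1 (Finset.mem_coe.2 hv) (Finset.mem_coe.2 hw)
      (fun e => adj_irrefl b h v (by rw [← e] at ha; exact ha)) ha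
  · rintro ⟨h1, h2⟩
    exact ⟨fun v hv w hw _ => h1 v (Finset.mem_coe.1 hv) w (Finset.mem_coe.1 hw),
      fun v => h2 v.1 v.2⟩

theorem isConfig_glue (Γ : Boundary b (h + 1)) (x : Bool) (s : Fin b → Finset (Vertex b h)) :
    IsConfig Γ (glue x s) ↔
      (∀ i, IsConfig (childBoundary Γ i) (s i)) ∧ (x = true → ∀ i, root b h ∉ s i) := by
  simp only [isConfig_iff]
  constructor
  · rintro ⟨h1, h2⟩
    refine ⟨fun i => ⟨fun v hv w hw ha => ?_, fun v hv => ?_⟩, fun hx i hi => ?_⟩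
    · exact h1 (below i v) (by simpa using hv) (below i w) (by simpa using hw) ⟨rfl, ha⟩
    · rw [← below_mem_glue x s i v]
      exact h2 (below i v) hv
    · exact h1 (root b (h + 1)) (by simpa using hx) (below i (root b h)) (by simpa using hi) rfl
  · rintro ⟨h1, h2⟩
    refine ⟨fun v hv w hw ha => ?_, fun v hv => ?_⟩
    · rcases vertex_succ_cases v with rfl | ⟨i, v, rfl⟩ <;>
        rcases vertex_succ_cases w with rfl | ⟨j, w, rfl⟩
      · exact ha
      · have ha' : w = root b h := ha
        subst ha'
        exact h2 (by simpa using hv) j (by simpa using hw)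
      · have ha' : v = root b h := ha
        subst ha'
        exact h2 (by simpa using hw) i (by simpa using hv)
      · obtain ⟨hij, ha'⟩ : i = j ∧ Adj b h v w := ha
        subst hij
        exact (h1 i).1 v (by simpa using hv) w (by simpa using hw) ha'
    · rcases vertex_succ_cases v with rfl | ⟨i, v, rfl⟩
      · exact (not_isLeaf_root hv).elim
      · rw [below_mem_glue]
        exact (h1 i).2 v hv

theorem card_glue (x : Bool) (s : Fin b → Finset (Vertex b h)) :
    (glue x s).card = (if x = true then 1 else 0) + ∑ i, (s i).card := by
  have h1 : ((glue x s).card : ℝ) = ((if x = true then 1 else 0) + ∑ i, (s i).card : ℕ) := by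
    have key : ∀ {h : ℕ} (σ : Finset (Vertex b h)),
        (σ.card : ℝ) = ∑ v, if v ∈ σ then (1 : ℝ) else 0 := by
      intro h σ
      simp
    rw [key, sum_vertex_succ]
    push_cast
    simp only [root_mem_glue, below_mem_glue, key]
  exact_mod_cast h1

open Classical in
/-- The weight `lam ^ |σ|` of a configuration `σ` under the boundary condition `Γ`, and `0` for the
sets that are not configurations. -/
noncomputable def weight (lam : ℝ) (Γ : Boundary b h) (σ : Finset (Vertex b h)) : ℝ :=
  if IsConfig Γ σ then lam ^ σ.card else 0

/-- The weight restricted to the configurations with unoccupied root. -/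
noncomputable def weight₀ (lam : ℝ) (Γ : Boundary b h) (σ : Finset (Vertex b h)) : ℝ :=
  if root b h ∈ σ then 0 else weight lam Γ σ

theorem weight_nonneg {lam : ℝ} (hlam : 0 < lam) (Γ : Boundary b h) (σ : Finset (Vertex b h)) :
    0 ≤ weight lam Γ σ := by
  rw [weight]
  split_ifs <;> positivity

theorem weight₀_nonneg {lam : ℝ} (hlam : 0 < lam) (Γ : Boundary b h) (σ : Finset (Vertex b h)) :
    0 ≤ weight₀ lam Γ σ := by
  rw [weight₀]
  split_ifs
  · exact le_rfl
  · exact weight_nonneg hlam Γ σ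

theorem weight₀_le {lam : ℝ} (hlam : 0 < lam) (Γ : Boundary b h) (σ : Finset (Vertex b h)) :
    weight₀ lam Γ σ ≤ weight lam Γ σ := by
  rw [weight₀]
  split_ifs
  · exact weight_nonneg hlam Γ σ
  · exact le_rfl

theorem weight_glue_false (lam : ℝ) (Γ : Boundary b (h + 1)) (s : Fin b → Finset (Vertex b h)) :
    weight lam Γ (glue false s) = ∏ i, weight lam (childBoundary Γ i) (s i) := by
  classical
  by_cases hc : ∀ i, IsConfig (childBoundary Γ i) (s i)
  · have h1 : IsConfig Γ (glue false s) := (isConfig_glue Γ false s).2 ⟨hc, by simp⟩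
    simp only [weight, if_pos h1, if_pos (hc _), card_glue]
    rw [Finset.prod_pow_eq_pow_sum]
    simp
  · have h1 : ¬ IsConfig Γ (glue false s) := fun h => hc ((isConfig_glue Γ false s).1 h).1
    push Not at hc
    obtain ⟨i, hi⟩ := hc
    rw [weight, if_neg h1, Finset.prod_eq_zero (Finset.mem_univ i)]
    rw [weight, if_neg hi]

theorem weight_glue_true (lam : ℝ) (Γ : Boundary b (h + 1)) (s : Fin b → Finset (Vertex b h)) :
    weight lam Γ (glue true s) = lam * ∏ i, weight₀ lam (childBoundary Γ i) (s i) := by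
  classical
  by_cases hr : ∀ i, root b h ∉ s i
  · have h1 : IsConfig Γ (glue true s) ↔ IsConfig Γ (glue false s) := by
      rw [isConfig_glue, isConfig_glue]
      simp [hr]
    have h2 : ∏ i, weight₀ lam (childBoundary Γ i) (s i) = weight lam Γ (glue false s) := by
      rw [weight_glue_false]
      exact Finset.prod_congr rfl fun i _ => by rw [weight₀, if_neg (hr i)]
    rw [h2, weight, weight, h1, card_glue, card_glue]
    split_ifs <;> simp_all [pow_add]
  · have h1 : ¬ IsConfig Γ (glue true s) := fun h => hr (((isConfig_glue Γ true s).1 h).2 rfl)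
    push Not at hr
    obtain ⟨i, hi⟩ := hr
    rw [weight, if_neg h1, Finset.prod_eq_zero (Finset.mem_univ i), mul_zero]
    rw [weight₀, if_pos hi]

theorem weight₀_glue_false (lam : ℝ) (Γ : Boundary b (h + 1)) (s : Fin b → Finset (Vertex b h)) :
    weight₀ lam Γ (glue false s) = ∏ i, weight lam (childBoundary Γ i) (s i) := by
  have : root b (h + 1) ∉ glue false s := fun hh => by
    have := (root_mem_glue false s).1 hh
    simp at this
  rw [weight₀, if_neg this, weight_glue_false]

theorem weight₀_glue_true (lam : ℝ) (Γ : Boundary b (h + 1)) (s : Fin b → Finset (Vertex b h)) :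
    weight₀ lam Γ (glue true s) = 0 := by
  have : root b (h + 1) ∈ glue true s := (root_mem_glue true s).2 rfl
  rw [weight₀, if_pos this]

open Classical in
/-- The energy of `f` under a weight `w` is `∑ σ, w σ * energyDensity lam σ f`. Every update between
`σ` and `σ.erase v`, with `v ∈ σ`, is accounted for at `σ`. -/
noncomputable def energyDensity (lam : ℝ) (σ : Finset (Vertex b h))
    (f : Finset (Vertex b h) → ℝ) : ℝ :=
  (1 / (1 + lam)) * ∑ v, if v ∈ σ ∧ ¬ IsLeaf b h v then (f σ - f (σ.erase v)) ^ 2 else 0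

theorem energyDensity_nonneg {lam : ℝ} (hlam : 0 < lam) (σ : Finset (Vertex b h))
    (f : Finset (Vertex b h) → ℝ) : 0 ≤ energyDensity lam σ f := by
  rw [energyDensity]
  refine mul_nonneg (by positivity) (Finset.sum_nonneg fun v _ => ?_)
  split_ifs <;> positivity

theorem energyDensity_glue (lam : ℝ) (x : Bool) (s : Fin b → Finset (Vertex b h))
    (f : Finset (Vertex b (h + 1)) → ℝ) :
    energyDensity lam (glue x s) f =
      (if x = true then (1 / (1 + lam)) * (f (glue true s) - f (glue false s)) ^ 2 else 0) +
        ∑ i, energyDensity lam (s i) fun t => f (glue x (Function.update s i t)) := by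
  classical
  rw [energyDensity, sum_vertex_succ, mul_add]
  congr 1
  · simp only [root_mem_glue, erase_root_glue]
    cases x <;> simp [not_isLeaf_root]
  · rw [Finset.mul_sum]
    refine Finset.sum_congr rfl fun i _ => ?_
    rw [energyDensity]
    congr 1
    refine Finset.sum_congr rfl fun v _ => ?_
    simp only [below_mem_glue, isLeaf_below, erase_below_glue, Function.update_eq_self]

end Structure

/-! ### Poincaré inequality for the tree -/

section Poincare

variable {b h : ℕ}

theorem sum_weight_mul (lam : ℝ) (Γ : Boundary b (h + 1)) (F : Finset (Vertex b (h + 1)) → ℝ) :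
    ∑ σ, weight lam Γ σ * F σ =
      ∑ s : Fin b → Finset (Vertex b h),
        (∏ i, weight lam (childBoundary Γ i) (s i)) * F (glue false s) +
      lam * ∑ s : Fin b → Finset (Vertex b h),
        (∏ i, weight₀ lam (childBoundary Γ i) (s i)) * F (glue true s) := by
  rw [sum_glue, Finset.mul_sum]
  simp only [weight_glue_false, weight_glue_true, mul_assoc]

theorem sum_weight₀_mul (lam : ℝ) (Γ : Boundary b (h + 1)) (F : Finset (Vertex b (h + 1)) → ℝ) :
    ∑ σ, weight₀ lam Γ σ * F σ =
      ∑ s : Fin b → Finset (Vertex b h),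
        (∏ i, weight lam (childBoundary Γ i) (s i)) * F (glue false s) := by
  rw [sum_glue]
  simp only [weight₀_glue_false, weight₀_glue_true, zero_mul, Finset.sum_const_zero, add_zero]

theorem sum_weight (lam : ℝ) (Γ : Boundary b (h + 1)) :
    ∑ σ, weight lam Γ σ =
      ∑ s : Fin b → Finset (Vertex b h), ∏ i, weight lam (childBoundary Γ i) (s i) +
      lam * ∑ s : Fin b → Finset (Vertex b h), ∏ i, weight₀ lam (childBoundary Γ i) (s i) := by
  simpa using sum_weight_mul lam Γ fun _ => 1

theorem sum_weight₀ (lam : ℝ) (Γ : Boundary b (h + 1)) :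
    ∑ σ, weight₀ lam Γ σ =
      ∑ s : Fin b → Finset (Vertex b h), ∏ i, weight lam (childBoundary Γ i) (s i) := by
  simpa using sum_weight₀_mul lam Γ fun _ => 1

theorem isConfig_zero_unique (Γ : Boundary b 0) {σ τ : Finset (Vertex b 0)} (hσ : IsConfig Γ σ)
    (hτ : IsConfig Γ τ) : σ = τ := by
  ext v
  exact (hσ.2 ⟨v, trivial⟩).trans (hτ.2 ⟨v, trivial⟩).symm

theorem wVar_eq_zero {X : Type*} [Fintype X] (w f : X → ℝ)
    (hw : ∀ x y, w x ≠ 0 → w y ≠ 0 → x = y) : wVar w f = 0 := by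
  have h1 : 2 * wVar w f = 0 := by
    rw [two_mul_wVar]
    refine Finset.sum_eq_zero fun x _ => Finset.sum_eq_zero fun y _ => ?_
    by_cases hx : w x = 0
    · simp [hx]
    by_cases hy : w y = 0
    · simp [hy]
    simp [hw x y hx hy]
  linarith

theorem isConfig_of_weight_ne_zero {lam : ℝ} {Γ : Boundary b h} {σ : Finset (Vertex b h)}
    (hσ : weight lam Γ σ ≠ 0) : IsConfig Γ σ := by
  by_contra hc
  exact hσ (by rw [weight, if_neg hc])

theorem weight_ne_zero_of_weight₀ {lam : ℝ} {Γ : Boundary b h} {σ : Finset (Vertex b h)}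
    (hσ : weight₀ lam Γ σ ≠ 0) : weight lam Γ σ ≠ 0 := by
  rw [weight₀] at hσ
  split_ifs at hσ with h1
  · exact (hσ rfl).elim
  · exact hσ

/-- The Poincaré inequality for the hard-core measure on a tree of height `h`, with constant
`(2 * (1 + lam)) ^ h`, for every boundary condition. The induction also needs the measure
conditioned on the root being unoccupied, which governs the subtrees below an occupied vertex. -/
theorem weight_poincare {lam : ℝ} (hlam : 0 < lam) : ∀ (h : ℕ) (Γ : Boundary b h),
    (∀ f, wVar (weight lam Γ) f ≤ (2 * (1 + lam)) ^ h *
      ((∑ σ, weight lam Γ σ) * ∑ σ, weight lam Γ σ * energyDensity lam σ f)) ∧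
    (∀ f, wVar (weight₀ lam Γ) f ≤ (2 * (1 + lam)) ^ h *
      ((∑ σ, weight₀ lam Γ σ) * ∑ σ, weight₀ lam Γ σ * energyDensity lam σ f)) := by
  intro h
  induction h with
  | zero =>
    intro Γ
    refine ⟨fun f => ?_, fun f => ?_⟩
    · rw [wVar_eq_zero _ _ fun x y hx hy => isConfig_zero_unique Γ
        (isConfig_of_weight_ne_zero hx) (isConfig_of_weight_ne_zero hy)]
      exact mul_nonneg (by positivity) (mul_nonneg
        (Finset.sum_nonneg fun σ _ => weight_nonneg hlam Γ σ)
        (Finset.sum_nonneg fun σ _ => mul_nonneg (weight_nonneg hlam Γ σ)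
          (energyDensity_nonneg hlam σ f)))
    · rw [wVar_eq_zero _ _ fun x y hx hy => isConfig_zero_unique Γ
        (isConfig_of_weight_ne_zero (weight_ne_zero_of_weight₀ hx))
        (isConfig_of_weight_ne_zero (weight_ne_zero_of_weight₀ hy))]
      exact mul_nonneg (by positivity) (mul_nonneg
        (Finset.sum_nonneg fun σ _ => weight₀_nonneg hlam Γ σ)
        (Finset.sum_nonneg fun σ _ => mul_nonneg (weight₀_nonneg hlam Γ σ)
          (energyDensity_nonneg hlam σ f)))
  | succ h ih =>
    intro Γ
    have hM : (1 : ℝ) ≤ (2 * (1 + lam)) ^ h := one_le_pow₀ (by linarith)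
    set W : (Fin b → Finset (Vertex b h)) → ℝ :=
      fun s => ∏ i, weight lam (childBoundary Γ i) (s i) with hW
    set W₀ : (Fin b → Finset (Vertex b h)) → ℝ :=
      fun s => ∏ i, weight₀ lam (childBoundary Γ i) (s i) with hW₀
    have hWn : ∀ s, 0 ≤ W s := fun s => Finset.prod_nonneg fun i _ => weight_nonneg hlam _ _
    have hW₀n : ∀ s, 0 ≤ W₀ s := fun s => Finset.prod_nonneg fun i _ => weight₀_nonneg hlam _ _
    have hle : ∀ s, W₀ s ≤ W s := fun s =>
      Finset.prod_le_prod (fun i _ => weight₀_nonneg hlam _ _) fun i _ => weight₀_le hlam _ _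
    -- the energy inside the subtrees
    set e : ((Fin b → Finset (Vertex b h)) → ℝ) → (Fin b → Finset (Vertex b h)) → ℝ :=
      fun g s => ∑ i, energyDensity lam (s i) fun t => g (Function.update s i t) with he
    have hen : ∀ g s, 0 ≤ e g s := fun g s =>
      Finset.sum_nonneg fun i _ => energyDensity_nonneg hlam _ _
    have h₀ : ∀ g, wVar W g ≤ (2 * (1 + lam)) ^ h * ((∑ s, W s) * ∑ s, W s * e g s) := fun g =>
      wVar_pi_le _ b (fun i => weight lam (childBoundary Γ i)) (fun i => weight_nonneg hlam _)
        (fun _ σ g => energyDensity lam σ g) (fun i g => (ih (childBoundary Γ i)).1 g) g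
    have h₁ : ∀ g, wVar W₀ g ≤ (2 * (1 + lam)) ^ h * ((∑ s, W₀ s) * ∑ s, W₀ s * e g s) := fun g =>
      wVar_pi_le _ b (fun i => weight₀ lam (childBoundary Γ i)) (fun i => weight₀_nonneg hlam _)
        (fun _ σ g => energyDensity lam σ g) (fun i g => (ih (childBoundary Γ i)).2 g) g
    refine ⟨fun f => ?_, fun f => ?_⟩
    · have hstar := star_poincare W W₀ (fun s => f (glue false s)) (fun s => f (glue true s))
        hW₀n hle lam hlam ((2 * (1 + lam)) ^ h) (∑ s, W s * e (fun s => f (glue false s)) s)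
        (∑ s, W₀ s * e (fun s => f (glue true s)) s) hM
        (Finset.sum_nonneg fun s _ => mul_nonneg (hWn s) (hen (fun s => f (glue false s)) s))
        (Finset.sum_nonneg fun s _ => mul_nonneg (hW₀n s) (hen (fun s => f (glue true s)) s))
        (h₀ fun s => f (glue false s)) (h₁ fun s => f (glue true s))
      have hE : ∑ σ, weight lam Γ σ * energyDensity lam σ f =
          (∑ s, W s * e (fun s => f (glue false s)) s) +
            lam * (∑ s, W₀ s * e (fun s => f (glue true s)) s) +
            lam / (1 + lam) * ∑ s, W₀ s * (f (glue true s) - f (glue false s)) ^ 2 := by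
        rw [sum_weight_mul]
        simp only [energyDensity_glue, Bool.false_eq_true, if_false, if_true, zero_add, mul_add,
          Finset.sum_add_distrib]
        have : ∑ s, W₀ s * (1 / (1 + lam) * (f (glue true s) - f (glue false s)) ^ 2) =
            1 / (1 + lam) * ∑ s, W₀ s * (f (glue true s) - f (glue false s)) ^ 2 := by
          rw [Finset.mul_sum]
          exact Finset.sum_congr rfl fun s _ => by ring
        rw [this]
        ring
      have hZ : ∑ σ, weight lam Γ σ = (∑ s, W s) + lam * ∑ s, W₀ s := sum_weight lam Γ
      have hS : ∑ σ, weight lam Γ σ * f σ =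
          (∑ s, W s * f (glue false s)) + lam * ∑ s, W₀ s * f (glue true s) := sum_weight_mul lam Γ f
      have hQ : ∑ σ, weight lam Γ σ * f σ ^ 2 =
          (∑ s, W s * f (glue false s) ^ 2) + lam * ∑ s, W₀ s * f (glue true s) ^ 2 :=
        sum_weight_mul lam Γ fun σ => f σ ^ 2
      rw [wVar, hE, hZ, hS, hQ, pow_succ' (2 * (1 + lam)) h]
      exact hstar
    · have hE : ∑ σ, weight₀ lam Γ σ * energyDensity lam σ f =
          ∑ s, W s * e (fun s => f (glue false s)) s := by
        rw [sum_weight₀_mul]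
        simp only [energyDensity_glue, Bool.false_eq_true, if_false, zero_add]
        rfl
      have hV : wVar (weight₀ lam Γ) f = wVar W fun s => f (glue false s) := by
        have hS := sum_weight₀_mul lam Γ f
        have hQ := sum_weight₀_mul lam Γ fun σ => f σ ^ 2
        rw [wVar, sum_weight₀, hS, hQ, wVar]
      rw [hE, hV, sum_weight₀]
      refine (h₀ fun s => f (glue false s)).trans ?_
      have hpow : (2 * (1 + lam)) ^ h ≤ (2 * (1 + lam)) ^ (h + 1) :=
        pow_le_pow_right₀ (by linarith) (Nat.le_succ h)
      have hn : 0 ≤ (∑ s, W s) * ∑ s, W s * e (fun s => f (glue false s)) s :=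
        mul_nonneg (Finset.sum_nonneg fun s _ => hWn s)
          (Finset.sum_nonneg fun s _ => mul_nonneg (hWn s) (hen (fun s => f (glue false s)) s))
      exact mul_le_mul_of_nonneg_right hpow hn

end Poincare

/-! ### The Glauber dynamics in terms of weights and energies -/

section Dynamics

variable {b h : ℕ}

open Classical in
/-- The conditional expectation of `f` under the heat-bath update at `v` started in `σ`. -/
noncomputable def siteAverage (lam : ℝ) (v : Vertex b h) (f : Finset (Vertex b h) → ℝ)
    (σ : Finset (Vertex b h)) : ℝ :=
  if IsLeaf b h v then f σ
  else if ∃ w ∈ σ, (tree b h).Adj v w then f (σ.erase v)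
  else lam / (1 + lam) * f (insert v σ) + 1 / (1 + lam) * f (σ.erase v)

theorem IsConfig.erase {Γ : Boundary b h} {σ : Finset (Vertex b h)} (hσ : IsConfig Γ σ)
    {v : Vertex b h} (hv : ¬ IsLeaf b h v) : IsConfig Γ (σ.erase v) := by
  rw [isConfig_iff] at hσ ⊢
  refine ⟨fun x hx y hy => hσ.1 x (Finset.mem_of_mem_erase hx) y (Finset.mem_of_mem_erase hy),
    fun x hx => ?_⟩
  rw [← hσ.2 x hx, Finset.mem_erase]
  exact and_iff_right fun e => hv (e ▸ hx)

theorem IsConfig.insert {Γ : Boundary b h} {σ : Finset (Vertex b h)} (hσ : IsConfig Γ σ)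
    {v : Vertex b h} (hv : ¬ IsLeaf b h v) (hn : ¬ ∃ w ∈ σ, (tree b h).Adj v w) :
    IsConfig Γ (insert v σ) := by
  rw [isConfig_iff] at hσ ⊢
  refine ⟨fun x hx y hy ha => ?_, fun x hx => ?_⟩
  · rcases Finset.mem_insert.1 hx with hx' | hx' <;> rcases Finset.mem_insert.1 hy with hy' | hy'
    · subst hx' hy'
      exact adj_irrefl b h _ ha
    · subst hx'
      exact hn ⟨y, hy', ha⟩
    · subst hy'
      exact hn ⟨x, hx', adj_symm b h _ _ ha⟩
    · exact hσ.1 x hx' y hy' ha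
  · rw [← hσ.2 x hx, Finset.mem_insert]
    exact or_iff_right fun e => hv (e ▸ hx)

/-- A configuration without `v` is paired with the one where `v` is added. Either `v` is a leaf, or
it is blocked and only the first one has positive weight, or the update at `v` averages over the
two. -/
theorem pair_cases {lam : ℝ} (hlam : 0 < lam) (Γ : Boundary b h) (v : Vertex b h)
    (σ : Finset (Vertex b h)) (hσ : v ∉ σ) :
    (IsLeaf b h v ∧ ∀ f τ, siteAverage lam v f τ = f τ) ∨
    (¬ IsLeaf b h v ∧ weight lam Γ (insert v σ) = 0 ∧ ∀ f, siteAverage lam v f σ = f σ) ∨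
    (¬ IsLeaf b h v ∧ weight lam Γ (insert v σ) = lam * weight lam Γ σ ∧
      (∀ f, siteAverage lam v f σ = (f σ + lam * f (insert v σ)) / (1 + lam)) ∧
      ∀ f, siteAverage lam v f (insert v σ) = (f σ + lam * f (insert v σ)) / (1 + lam)) := by
  have hl : (1 + lam) ≠ 0 := by positivity
  by_cases hv : IsLeaf b h v
  · exact Or.inl ⟨hv, fun f τ => if_pos hv⟩
  by_cases hn : ∃ w ∈ σ, (tree b h).Adj v w
  · refine Or.inr (Or.inl ⟨hv, ?_, fun f => ?_⟩)
    · rw [weight, if_neg]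
      intro hc
      obtain ⟨w, hw, ha⟩ := hn
      exact ((isConfig_iff _ _).1 hc).1 v (Finset.mem_insert_self _ _) w
        (Finset.mem_insert_of_mem hw) ha
    · rw [siteAverage, if_neg hv, if_pos hn, Finset.erase_eq_of_notMem hσ]
  · refine Or.inr (Or.inr ⟨hv, ?_, fun f => ?_, fun f => ?_⟩)
    · have hiff : IsConfig Γ (insert v σ) ↔ IsConfig Γ σ := by
        refine ⟨fun hc => ?_, fun hc => hc.insert hv hn⟩
        have := hc.erase hv
        rwa [Finset.erase_insert hσ] at this
      rw [weight, weight, hiff, Finset.card_insert_of_notMem hσ]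
      split_ifs
      · ring
      · ring
    · rw [siteAverage, if_neg hv, if_neg hn, Finset.erase_eq_of_notMem hσ]
      field_simp
      ring
    · have hn' : ¬ ∃ w ∈ insert v σ, (tree b h).Adj v w := by
        rintro ⟨w, hw, ha⟩
        rcases Finset.mem_insert.1 hw with rfl | hw
        · exact adj_irrefl b h _ ha
        · exact hn ⟨w, hw, ha⟩
      rw [siteAverage, if_neg hv, if_neg hn', Finset.insert_idem, Finset.erase_insert hσ]
      field_simp
      ring

theorem sum_pair (v : Vertex b h) (F : Finset (Vertex b h) → ℝ) :
    ∑ σ, F σ = ∑ σ ∈ (Finset.univ.erase v).powerset, (F σ + F (insert v σ)) := by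
  have h1 := Finset.sum_powerset_insert (Finset.notMem_erase v Finset.univ) F
  rw [Finset.insert_erase (Finset.mem_univ v), Finset.powerset_univ] at h1
  rw [h1, Finset.sum_add_distrib]

theorem notMem_of_mem_powerset_erase {v : Vertex b h} {σ : Finset (Vertex b h)}
    (hσ : σ ∈ (Finset.univ.erase v).powerset) : v ∉ σ := fun hv =>
  Finset.notMem_erase v _ (Finset.mem_powerset.1 hσ hv)

theorem siteAverage_symm {lam : ℝ} (hlam : 0 < lam) (Γ : Boundary b h) (v : Vertex b h)
    (f g : Finset (Vertex b h) → ℝ) :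
    ∑ σ, weight lam Γ σ * (g σ * siteAverage lam v f σ) =
      ∑ σ, weight lam Γ σ * (f σ * siteAverage lam v g σ) := by
  rw [sum_pair v, sum_pair v]
  refine Finset.sum_congr rfl fun σ hσ => ?_
  rcases pair_cases hlam Γ v σ (notMem_of_mem_powerset_erase hσ) with
    ⟨-, h1⟩ | ⟨-, h1, h2⟩ | ⟨-, h1, h2, h3⟩
  · simp only [h1]
    ring
  · simp only [h1, h2]
    ring
  · simp only [h1, h2, h3]
    ring

theorem siteAverage_nonneg {lam : ℝ} (hlam : 0 < lam) (Γ : Boundary b h) (v : Vertex b h)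
    (f : Finset (Vertex b h) → ℝ) :
    0 ≤ ∑ σ, weight lam Γ σ * (f σ * siteAverage lam v f σ) := by
  rw [sum_pair v]
  refine Finset.sum_nonneg fun σ hσ => ?_
  have hw := weight_nonneg hlam Γ σ
  have hw' := weight_nonneg hlam Γ (insert v σ)
  rcases pair_cases hlam Γ v σ (notMem_of_mem_powerset_erase hσ) with
    ⟨-, h1⟩ | ⟨-, h1, h2⟩ | ⟨-, h1, h2, h3⟩
  · rw [h1, h1]
    have := mul_self_nonneg (f σ)
    have := mul_self_nonneg (f (insert v σ))
    positivity
  · rw [h1, h2]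
    have := mul_self_nonneg (f σ)
    simp only [zero_mul, add_zero]
    positivity
  · rw [h1, h2, h3]
    have : weight lam Γ σ * (f σ * ((f σ + lam * f (insert v σ)) / (1 + lam))) +
        lam * weight lam Γ σ * (f (insert v σ) * ((f σ + lam * f (insert v σ)) / (1 + lam))) =
        weight lam Γ σ * ((f σ + lam * f (insert v σ)) ^ 2 / (1 + lam)) := by ring
    rw [this]
    positivity

open Classical in
theorem site_energy {lam : ℝ} (hlam : 0 < lam) (Γ : Boundary b h) (v : Vertex b h)
    (f : Finset (Vertex b h) → ℝ) :
    ∑ σ, weight lam Γ σ * (f σ * (f σ - siteAverage lam v f σ)) =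
      ∑ σ, weight lam Γ σ * (1 / (1 + lam) *
        if v ∈ σ ∧ ¬ IsLeaf b h v then (f σ - f (σ.erase v)) ^ 2 else 0) := by
  rw [sum_pair v, sum_pair v]
  refine Finset.sum_congr rfl fun σ hσ => ?_
  have hv := notMem_of_mem_powerset_erase hσ
  rcases pair_cases hlam Γ v σ hv with ⟨h0, h1⟩ | ⟨h0, h1, h2⟩ | ⟨h0, h1, h2, h3⟩
  · simp [h1, h0]
  · simp [h1, h2, hv]
  · rw [h1, h2, h3, if_neg (fun e => hv e.1), if_pos ⟨Finset.mem_insert_self _ _, h0⟩,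
      Finset.erase_insert hv]
    have : (1 + lam) ≠ 0 := by positivity
    field_simp
    ring

theorem weight_config (lam : ℝ) (Γ : Boundary b h) (σ : Config Γ) :
    weight lam Γ σ.1 = lam ^ σ.1.card := if_pos σ.2

theorem weight_config_pos {lam : ℝ} (hlam : 0 < lam) (Γ : Boundary b h) (σ : Config Γ) :
    0 < weight lam Γ σ.1 := by
  rw [weight_config]
  positivity

theorem sum_config (lam : ℝ) (Γ : Boundary b h) (F : Finset (Vertex b h) → ℝ) :
    ∑ σ : Config Γ, weight lam Γ σ.1 * F σ.1 = ∑ σ, weight lam Γ σ * F σ := by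
  classical
  rw [← Finset.sum_filter_of_ne (p := IsConfig Γ) (f := fun σ => weight lam Γ σ * F σ)]
  · exact (Finset.sum_subtype (p := IsConfig Γ) (F := instFintypeConfig Γ) _ (by simp)
      (fun σ => weight lam Γ σ * F σ)).symm
  · intro σ _ hσ
    exact isConfig_of_weight_ne_zero (left_ne_zero_of_mul hσ)

theorem sum_config_ite (Γ : Boundary b h) (f : Finset (Vertex b h) → ℝ) (c : ℝ)
    {σ : Finset (Vertex b h)} (hσ : IsConfig Γ σ) :
    ∑ τ : Config Γ, (if τ.1 = σ then c else 0) * f τ.1 = c * f σ := by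
  rw [Finset.sum_eq_single (⟨σ, hσ⟩ : Config Γ)]
  · simp
  · intro τ _ hτ
    rw [if_neg (fun e => hτ (Subtype.ext e)), zero_mul]
  · simp

theorem sum_siteUpdate_mul (lam : ℝ) (Γ : Boundary b h) (v : Vertex b h)
    (f : Finset (Vertex b h) → ℝ) (σ : Config Γ) :
    ∑ τ : Config Γ, siteUpdate lam v σ.1 τ.1 * f τ.1 = siteAverage lam v f σ.1 := by
  classical
  have hσ : IsConfig Γ σ.1 := σ.2
  by_cases hv : IsLeaf b h v
  · simp only [siteUpdate, siteAverage, if_pos hv]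
    simpa using sum_config_ite Γ f 1 hσ
  by_cases hn : ∃ w ∈ σ.1, (tree b h).Adj v w
  · simp only [siteUpdate, siteAverage, if_neg hv, if_pos hn]
    simpa using sum_config_ite Γ f 1 (hσ.erase hv)
  · simp only [siteUpdate, siteAverage, if_neg hv, if_neg hn, add_mul, Finset.sum_add_distrib]
    rw [← sum_config_ite Γ f _ (hσ.insert hv hn), ← sum_config_ite Γ f _ (hσ.erase hv)]

theorem glauber_mulVec (lam : ℝ) (Γ : Boundary b h) (f : Finset (Vertex b h) → ℝ)
    (σ : Config Γ) :
    (glauber lam Γ).mulVec (fun τ => f τ.1) σ =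
      (∑ v, siteAverage lam v f σ.1) / (numVertices b h : ℝ) := by
  simp only [Matrix.mulVec, dotProduct, glauber, Matrix.of_apply]
  simp only [div_mul_eq_mul_div, ← Finset.sum_div, Finset.sum_mul]
  rw [Finset.sum_comm]
  simp only [sum_siteUpdate_mul]

theorem numVertices_pos (b h : ℕ) : 0 < numVertices b h :=
  Fintype.card_pos_iff.2 ⟨root b h⟩

theorem exists_extension {Γ : Boundary b h} (f : Config Γ → ℝ) :
    ∃ F : Finset (Vertex b h) → ℝ, f = fun σ => F σ.1 := by
  classical
  refine ⟨fun σ => if hσ : IsConfig Γ σ then f ⟨σ, hσ⟩ else 0, ?_⟩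
  funext σ
  have hσ : IsConfig Γ σ.1 := σ.2
  simp only [dif_pos hσ]

theorem glauber_form (lam : ℝ) (Γ : Boundary b h) (f g : Finset (Vertex b h) → ℝ) :
    ∑ σ : Config Γ, weight lam Γ σ.1 * g σ.1 * (glauber lam Γ).mulVec (fun τ => f τ.1) σ =
      (∑ v, ∑ σ, weight lam Γ σ * (g σ * siteAverage lam v f σ)) / (numVertices b h : ℝ) := by
  rw [Finset.sum_comm]
  simp only [← Finset.mul_sum]
  rw [← sum_config, Finset.sum_div]
  refine Finset.sum_congr rfl fun σ _ => ?_
  rw [glauber_mulVec]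
  ring

theorem glauber_rowSum (lam : ℝ) (hlam : 0 < lam) (Γ : Boundary b h) (σ : Config Γ) :
    ∑ τ, glauber lam Γ σ τ = 1 := by
  have h1 := glauber_mulVec lam Γ (fun _ => 1) σ
  simp only [Matrix.mulVec, dotProduct, mul_one] at h1
  rw [h1]
  have h2 : ∀ v : Vertex b h, siteAverage lam v (fun _ => 1) σ.1 = 1 := by
    intro v
    rw [siteAverage]
    have : (1 + lam) ≠ 0 := by positivity
    split_ifs
    · rfl
    · rfl
    · field_simp
      ring
  have hn : (numVertices b h : ℝ) ≠ 0 := by exact_mod_cast (numVertices_pos b h).ne'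
  simp only [h2, Finset.sum_const, Finset.card_univ, nsmul_eq_mul, mul_one]
  exact div_self hn

theorem glauber_reversible (lam : ℝ) (hlam : 0 < lam) (Γ : Boundary b h) (σ τ : Config Γ) :
    weight lam Γ σ.1 * glauber lam Γ σ τ = weight lam Γ τ.1 * glauber lam Γ τ σ := by
  have key : ∀ σ τ : Config Γ, ∑ ρ : Config Γ, weight lam Γ ρ.1 * (if ρ.1 = σ.1 then 1 else 0) *
      (glauber lam Γ).mulVec (fun ρ => if ρ.1 = τ.1 then 1 else 0) ρ =
      weight lam Γ σ.1 * glauber lam Γ σ τ := by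
    intro σ τ
    rw [Finset.sum_eq_single σ]
    · rw [if_pos rfl, mul_one, Matrix.mulVec, dotProduct, Finset.sum_eq_single τ]
      · simp
      · intro ρ _ hρ
        rw [if_neg (fun e => hρ (Subtype.ext e)), mul_zero]
      · simp
    · intro ρ _ hρ
      rw [if_neg (fun e => hρ (Subtype.ext e)), mul_zero, zero_mul]
    · simp
  rw [← key σ τ, ← key τ σ, glauber_form lam Γ (fun ρ => if ρ = τ.1 then 1 else 0)
    (fun ρ => if ρ = σ.1 then 1 else 0), glauber_form lam Γ (fun ρ => if ρ = σ.1 then 1 else 0)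
    (fun ρ => if ρ = τ.1 then 1 else 0)]
  congr 1
  exact Finset.sum_congr rfl fun v _ => siteAverage_symm hlam Γ v _ _

theorem glauber_dirichlet (lam : ℝ) (hlam : 0 < lam) (Γ : Boundary b h)
    (f : Finset (Vertex b h) → ℝ) :
    dirichlet (glauber lam Γ) (fun σ => weight lam Γ σ.1) (fun σ => f σ.1) =
      (∑ σ, weight lam Γ σ * energyDensity lam σ f) / (numVertices b h : ℝ) := by
  have hn : (numVertices b h : ℝ) ≠ 0 := by exact_mod_cast (numVertices_pos b h).ne'
  have h1 : ∑ σ, weight lam Γ σ * energyDensity lam σ f =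
      ∑ v, ∑ σ, weight lam Γ σ * (f σ * (f σ - siteAverage lam v f σ)) := by
    simp only [site_energy hlam]
    rw [Finset.sum_comm]
    refine Finset.sum_congr rfl fun σ _ => ?_
    rw [energyDensity, Finset.mul_sum, Finset.mul_sum]
  have h2 : dirichlet (glauber lam Γ) (fun σ => weight lam Γ σ.1) (fun σ => f σ.1) =
      ∑ σ : Config Γ, weight lam Γ σ.1 * (f σ.1 * f σ.1) -
        ∑ σ : Config Γ, weight lam Γ σ.1 * f σ.1 *
          (glauber lam Γ).mulVec (fun τ => f τ.1) σ := by
    rw [dirichlet, ← Finset.sum_sub_distrib]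
    exact Finset.sum_congr rfl fun σ _ => by ring
  rw [h1, h2, glauber_form, sum_config lam Γ fun σ => f σ * f σ, eq_div_iff hn, sub_mul,
    div_mul_cancel₀ _ hn]
  simp only [mul_sub, Finset.sum_sub_distrib, Finset.sum_const, Finset.card_univ, nsmul_eq_mul]
  rw [numVertices]
  ring

theorem wVar_config (lam : ℝ) (Γ : Boundary b h) (f : Finset (Vertex b h) → ℝ) :
    wVar (fun σ : Config Γ => weight lam Γ σ.1) (fun σ => f σ.1) = wVar (weight lam Γ) f := by
  have h1 : ∑ σ : Config Γ, weight lam Γ σ.1 = ∑ σ, weight lam Γ σ := by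
    simpa using sum_config lam Γ fun _ => 1
  rw [wVar, wVar, h1, sum_config lam Γ f, sum_config lam Γ fun σ => f σ ^ 2]

theorem sum_weight_config (lam : ℝ) (Γ : Boundary b h) :
    ∑ σ : Config Γ, weight lam Γ σ.1 = ∑ σ, weight lam Γ σ := by
  simpa using sum_config lam Γ fun _ => 1

theorem glauber_poincare (lam : ℝ) (hlam : 0 < lam) (Γ : Boundary b h) (f : Config Γ → ℝ) :
    1 / ((numVertices b h : ℝ) * (2 * (1 + lam)) ^ h) *
        wVar (fun σ : Config Γ => weight lam Γ σ.1) f ≤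
      (∑ σ : Config Γ, weight lam Γ σ.1) *
        dirichlet (glauber lam Γ) (fun σ => weight lam Γ σ.1) f := by
  obtain ⟨F, rfl⟩ := exists_extension f
  have hn : (0 : ℝ) < numVertices b h := by exact_mod_cast numVertices_pos b h
  have hM : (0 : ℝ) < (2 * (1 + lam)) ^ h := by positivity
  rw [wVar_config, glauber_dirichlet lam hlam, sum_weight_config, one_div_mul_eq_div,
    div_le_iff₀ (by positivity)]
  refine ((weight_poincare hlam h Γ).1 F).trans (le_of_eq ?_)
  field_simp

/-- The upper bound for the relaxation time, in terms of the spectral gap. -/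
theorem glauber_gap_ge (lam : ℝ) (hlam : 0 < lam) (Γ : Boundary b h) [Nonempty (Config Γ)] :
    1 / ((numVertices b h : ℝ) * (2 * (1 + lam)) ^ h) ≤ spectralGap (glauber lam Γ) := by
  have hn : (1 : ℝ) ≤ numVertices b h := by exact_mod_cast numVertices_pos b h
  have hM : (1 : ℝ) ≤ (2 * (1 + lam)) ^ h := one_le_pow₀ (by linarith)
  have hpos : (0 : ℝ) < (numVertices b h : ℝ) * (2 * (1 + lam)) ^ h := by positivity
  have hκ : 0 < 1 / ((numVertices b h : ℝ) * (2 * (1 + lam)) ^ h) := by positivity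
  have hκ1 : 1 / ((numVertices b h : ℝ) * (2 * (1 + lam)) ^ h) ≤ 1 := by
    rw [div_le_one hpos]
    exact one_le_mul_of_one_le_of_one_le hn hM
  have hpsd : ∀ f : Config Γ → ℝ,
      0 ≤ ∑ σ : Config Γ, weight lam Γ σ.1 * f σ * (glauber lam Γ).mulVec f σ := by
    intro f
    obtain ⟨F, rfl⟩ := exists_extension f
    rw [glauber_form]
    exact div_nonneg (Finset.sum_nonneg fun v _ => siteAverage_nonneg hlam Γ v F)
      (Nat.cast_nonneg _)
  exact le_spectralGap (glauber lam Γ) (fun σ => weight lam Γ σ.1) (weight_config_pos hlam Γ)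
    (glauber_reversible lam hlam Γ) (glauber_rowSum lam hlam Γ) hpsd _ hκ hκ1
    (glauber_poincare lam hlam Γ)

theorem glauber_gap_mul_wVar_le (lam : ℝ) (hlam : 0 < lam) (Γ : Boundary b h)
    [Nonempty (Config Γ)] (f : Finset (Vertex b h) → ℝ) :
    spectralGap (glauber lam Γ) * wVar (weight lam Γ) f ≤
      (∑ σ, weight lam Γ σ) *
        ((∑ σ, weight lam Γ σ * energyDensity lam σ f) / (numVertices b h : ℝ)) := by
  have hn : (0 : ℝ) < numVertices b h := by exact_mod_cast numVertices_pos b h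
  have hκ : 0 < 1 / ((numVertices b h : ℝ) * (2 * (1 + lam)) ^ h) := by positivity
  have h1 := spectralGap_mul_wVar_le (glauber lam Γ) (fun σ => weight lam Γ σ.1)
    (weight_config_pos hlam Γ)
    (glauber_reversible lam hlam Γ) (glauber_rowSum lam hlam Γ) _
    hκ (glauber_poincare lam hlam Γ) fun σ => f σ.1
  rwa [wVar_config, glauber_dirichlet lam hlam, sum_weight_config] at h1

/-- The occupation of a single vertex relaxes no faster than that vertex is updated. -/
theorem glauber_gap_le (lam : ℝ) (hlam : 0 < lam) (Γ : Boundary b h) [Nontrivial (Config Γ)] :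
    spectralGap (glauber lam Γ) ≤ 1 / (numVertices b h : ℝ) := by
  classical
  have hn : (0 : ℝ) < numVertices b h := by exact_mod_cast numVertices_pos b h
  obtain ⟨v, σ, τ, hvσ, hvτ⟩ : ∃ (v : Vertex b h) (σ τ : Config Γ), v ∈ σ.1 ∧ v ∉ τ.1 := by
    obtain ⟨σ, τ, hne⟩ := exists_pair_ne (Config Γ)
    by_contra hcon
    push Not at hcon
    exact hne (Subtype.ext (Finset.ext fun v => ⟨hcon v σ τ, hcon v τ σ⟩))
  have hv : ¬ IsLeaf b h v := fun hl => hvτ ((τ.2.2 ⟨v, hl⟩).2 ((σ.2.2 ⟨v, hl⟩).1 hvσ))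
  set f : Finset (Vertex b h) → ℝ := fun σ => if v ∈ σ then 1 else 0 with hf
  set Z := ∑ σ, weight lam Γ σ with hZ
  set A := ∑ σ, weight lam Γ σ * f σ with hA
  have hAsq : ∑ σ, weight lam Γ σ * f σ ^ 2 = A :=
    Finset.sum_congr rfl fun σ _ => by
      simp only [hf]
      split_ifs <;> simp
  have hwpos := weight_config_pos hlam Γ
  have hA0 : 0 < A := by
    refine Finset.sum_pos' (fun σ _ => mul_nonneg (weight_nonneg hlam Γ σ) ?_)
      ⟨σ.1, Finset.mem_univ _, ?_⟩
    · simp only [hf]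
      split_ifs <;> norm_num
    · simp only [hf, if_pos hvσ, mul_one]
      exact hwpos σ
  have hZA : A < Z := by
    refine Finset.sum_lt_sum (fun σ _ => ?_) ⟨τ.1, Finset.mem_univ _, ?_⟩
    · have := weight_nonneg hlam Γ σ
      simp only [hf]
      split_ifs <;> simp [this]
    · simp only [hf, if_neg hvτ, mul_zero]
      exact hwpos τ
  have hAle : A ≤ lam * (Z - A) := by
    have h1 : A = ∑ σ ∈ (Finset.univ.erase v).powerset, weight lam Γ (insert v σ) := by
      rw [hA, sum_pair v]
      refine Finset.sum_congr rfl fun σ hσ => ?_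
      simp [hf, notMem_of_mem_powerset_erase hσ]
    have h2 : Z - A = ∑ σ ∈ (Finset.univ.erase v).powerset, weight lam Γ σ := by
      rw [hZ, hA, ← Finset.sum_sub_distrib, sum_pair v]
      refine Finset.sum_congr rfl fun σ hσ => ?_
      simp [hf, notMem_of_mem_powerset_erase hσ]
    rw [h2, Finset.mul_sum, h1]
    refine Finset.sum_le_sum fun σ hσ => ?_
    have := weight_nonneg hlam Γ σ
    rcases pair_cases hlam Γ v σ (notMem_of_mem_powerset_erase hσ) with
      ⟨h0, -⟩ | ⟨-, h1, -⟩ | ⟨-, h1, -, -⟩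
    · exact (hv h0).elim
    · rw [h1]
      positivity
    · rw [h1]
  have hE : ∑ σ, weight lam Γ σ * energyDensity lam σ f ≤ 1 / (1 + lam) * A := by
    rw [hA, Finset.mul_sum]
    refine Finset.sum_le_sum fun σ _ => ?_
    have h1 : energyDensity lam σ f ≤ 1 / (1 + lam) * f σ := by
      rw [energyDensity]
      refine mul_le_mul_of_nonneg_left ?_ (by positivity)
      rw [Finset.sum_eq_single v]
      · simp only [hf, Finset.notMem_erase, if_false]
        split_ifs <;> simp_all
      · intro w _ hw
        have : (v ∈ σ.erase w) ↔ v ∈ σ := by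
          rw [Finset.mem_erase]
          exact and_iff_right hw.symm
        simp [hf, this]
      · simp
    calc weight lam Γ σ * energyDensity lam σ f ≤ weight lam Γ σ * (1 / (1 + lam) * f σ) :=
          mul_le_mul_of_nonneg_left h1 (weight_nonneg hlam Γ σ)
      _ = _ := by ring
  have hmain := glauber_gap_mul_wVar_le lam hlam Γ f
  have hV : wVar (weight lam Γ) f = A * (Z - A) := by
    rw [wVar, hAsq, ← hZ, ← hA]
    ring
  rw [hV, ← hZ] at hmain
  have hVpos : 0 < A * (Z - A) := mul_pos hA0 (by linarith)
  have hZle : Z * (1 / (1 + lam) * A) ≤ A * (Z - A) := by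
    have : Z ≤ (1 + lam) * (Z - A) := by linarith
    calc Z * (1 / (1 + lam) * A) ≤ (1 + lam) * (Z - A) * (1 / (1 + lam) * A) := by gcongr
      _ = A * (Z - A) := by field_simp
  have h3 : spectralGap (glauber lam Γ) * (A * (Z - A)) ≤
      1 / (numVertices b h : ℝ) * (A * (Z - A)) := by
    refine hmain.trans ?_
    rw [mul_div_assoc', one_div_mul_eq_div]
    refine div_le_div_of_nonneg_right ?_ hn.le
    exact (mul_le_mul_of_nonneg_left hE (hA0.le.trans hZA.le)).trans hZle
  exact le_of_mul_le_mul_right h3 hVpos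

end Dynamics

/-! ### Bounds for the relaxation time on every boundary condition -/

section Bounds

variable {b h : ℕ}

theorem activity_pos (b : ℕ) {ω : ℝ} (hω : 0 < ω) : 0 < activity b ω := by
  rw [activity]
  positivity

theorem relaxationTime_le {ω : ℝ} (hω : 0 < ω) (Γ : Boundary b h) [Nonempty (Config Γ)] :
    relaxationTime ω Γ ≤ (numVertices b h : ℝ) * (2 * (1 + activity b ω)) ^ h := by
  have hlam := activity_pos b hω
  have hn : (0 : ℝ) < numVertices b h := by exact_mod_cast numVertices_pos b h
  have h1 := glauber_gap_ge (activity b ω) hlam Γ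
  rw [relaxationTime]
  exact inv_le_of_inv_le₀ (by positivity) (by rwa [← one_div])

theorem glauber_gap_pos {ω : ℝ} (hω : 0 < ω) (Γ : Boundary b h) [Nonempty (Config Γ)] :
    0 < spectralGap (glauber (activity b ω) Γ) := by
  have hlam := activity_pos b hω
  have hn : (0 : ℝ) < numVertices b h := by exact_mod_cast numVertices_pos b h
  exact lt_of_lt_of_le (by positivity) (glauber_gap_ge (activity b ω) hlam Γ)

theorem le_relaxationTime {ω : ℝ} (hω : 0 < ω) (Γ : Boundary b h) [Nontrivial (Config Γ)] :
    (numVertices b h : ℝ) ≤ relaxationTime ω Γ := by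
  have hlam := activity_pos b hω
  have h1 := glauber_gap_le (activity b ω) hlam Γ
  have h2 := inv_anti₀ (glauber_gap_pos hω Γ) h1
  rwa [one_div, inv_inv] at h2

theorem pow_le_numVertices (b h : ℕ) : b ^ h ≤ numVertices b h := by
  induction h with
  | zero => simp [numVertices_zero]
  | succ h ih =>
    rw [numVertices_succ, pow_succ']
    exact (Nat.mul_le_mul_left b ih).trans (Nat.le_succ _)

theorem numVertices_le (hb : 2 ≤ b) (h : ℕ) : numVertices b h ≤ 2 * b ^ h := by
  suffices hs : numVertices b h + 1 ≤ 2 * b ^ h by omega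
  induction h with
  | zero => simp [numVertices_zero]
  | succ h ih =>
    have h1 : b * (numVertices b h + 1) ≤ b * (2 * b ^ h) := Nat.mul_le_mul_left b ih
    rw [numVertices_succ, pow_succ']
    nlinarith

/-- The exponent per level of the tree that turns a factor `A * (1 + log b)` into a power of `b`. -/
noncomputable def logExponent (A : ℝ) (b : ℕ) : ℝ :=
  Real.log (A * (1 + Real.log b)) / Real.log b

theorem rpow_logExponent {A : ℝ} (hA : 0 < A) (hb : 2 ≤ b) :
    (b : ℝ) ^ logExponent A b = A * (1 + Real.log b) := by
  have hb' : (1 : ℝ) < b := by exact_mod_cast hb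
  have hl : 0 < Real.log b := Real.log_pos hb'
  rw [logExponent, Real.rpow_def_of_pos (by linarith), mul_div_cancel₀ _ hl.ne', Real.exp_log]
  positivity

theorem logExponent_nonneg {A : ℝ} (hA : 1 ≤ A) (hb : 2 ≤ b) : 0 ≤ logExponent A b := by
  have hb' : (1 : ℝ) < b := by exact_mod_cast hb
  have hl : 0 < Real.log b := Real.log_pos hb'
  exact div_nonneg (Real.log_nonneg (one_le_mul_of_one_le_of_one_le hA (by linarith))) hl.le

theorem eventually_one_le_log_log : ∀ᶠ b : ℕ in atTop, 1 ≤ Real.log (Real.log (b : ℝ)) :=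
  ((Real.tendsto_log_atTop.comp Real.tendsto_log_atTop).comp
    tendsto_natCast_atTop_atTop).eventually_ge_atTop 1

theorem logExponent_isBigO {A : ℝ} (hA : 1 ≤ A) :
    logExponent A =O[atTop] fun b : ℕ => Real.log (Real.log (b : ℝ)) / Real.log (b : ℝ) := by
  refine IsBigO.of_bound (Real.log A + Real.log 2 + 1) ?_
  have h1 : ∀ᶠ b : ℕ in atTop, 1 ≤ Real.log (b : ℝ) :=
    (Real.tendsto_log_atTop.comp tendsto_natCast_atTop_atTop).eventually_ge_atTop 1
  filter_upwards [eventually_one_le_log_log, h1, eventually_ge_atTop 2] with b hbb hb hb2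
  have hA' := Real.log_nonneg hA
  have h2 : 0 < Real.log 2 := Real.log_pos (by norm_num)
  rw [Real.norm_of_nonneg (logExponent_nonneg hA hb2),
    Real.norm_of_nonneg (div_nonneg (by linarith) (by linarith)), logExponent, mul_div_assoc']
  refine div_le_div_of_nonneg_right ?_ (by linarith)
  have h3 : A * (1 + Real.log b) ≤ A * (2 * Real.log b) := by gcongr; linarith
  calc Real.log (A * (1 + Real.log b)) ≤ Real.log (A * (2 * Real.log b)) :=
        Real.log_le_log (by positivity) h3
    _ = Real.log A + (Real.log 2 + Real.log (Real.log b)) := by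
        rw [Real.log_mul (by positivity) (by positivity), Real.log_mul (by norm_num) (by positivity)]
    _ ≤ (Real.log A + Real.log 2 + 1) * Real.log (Real.log b) := by nlinarith

theorem logExponent_isBigO_sq {A : ℝ} (hA : 1 ≤ A) :
    logExponent A =O[atTop] fun b : ℕ => Real.log (Real.log (b : ℝ)) ^ 2 / Real.log (b : ℝ) := by
  refine (logExponent_isBigO hA).trans (IsBigO.of_bound 1 ?_)
  filter_upwards [eventually_one_le_log_log] with b hb
  rw [one_mul, norm_div, norm_div, norm_pow, Real.norm_of_nonneg (by linarith : (0 : ℝ) ≤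
    Real.log (Real.log (b : ℝ)))]
  refine div_le_div_of_nonneg_right ?_ (norm_nonneg _)
  nlinarith

theorem activity_le {D δ ω : ℝ} (hδ : 0 ≤ δ) (hδD : δ ≤ D) (hb : 2 ≤ b) (hω : 0 < ω)
    (hωb : ω ≤ (1 + δ) * Real.log b / b) :
    activity b ω ≤ (1 + D) * Real.log b * (b : ℝ) ^ δ := by
  have hb' : (1 : ℝ) < b := by exact_mod_cast hb
  have hb0 : (0 : ℝ) < b := by linarith
  have hl : 0 < Real.log b := Real.log_pos hb'
  have h1 : (1 + ω) ^ b ≤ (b : ℝ) ^ (1 + δ) := by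
    calc (1 + ω) ^ b ≤ Real.exp ω ^ b :=
          pow_le_pow_left₀ (by linarith) (by linarith [Real.add_one_le_exp ω]) b
      _ = Real.exp (b * ω) := by rw [← Real.exp_nat_mul]
      _ ≤ Real.exp (Real.log b * (1 + δ)) := by
          refine Real.exp_le_exp.2 ?_
          rw [le_div_iff₀ hb0] at hωb
          linarith
      _ = (b : ℝ) ^ (1 + δ) := by rw [Real.rpow_def_of_pos hb0]
  rw [activity]
  calc ω * (1 + ω) ^ b ≤ ((1 + δ) * Real.log b / b) * (b : ℝ) ^ (1 + δ) := by gcongr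
    _ = (1 + δ) * Real.log b * (b : ℝ) ^ δ := by
        rw [Real.rpow_add hb0, Real.rpow_one]
        field_simp
    _ ≤ (1 + D) * Real.log b * (b : ℝ) ^ δ := by gcongr

theorem relaxationTime_le_rpow {D δ ω : ℝ} (hδ : 0 ≤ δ) (hδD : δ ≤ D) (hb : 2 ≤ b) (hω : 0 < ω)
    (hωb : ω ≤ (1 + δ) * Real.log b / b) (Γ : Boundary b h) [Nonempty (Config Γ)] :
    relaxationTime ω Γ ≤ (numVertices b h : ℝ) ^ (1 + δ + logExponent (2 * (1 + D)) b) := by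
  have hD : 0 ≤ D := hδ.trans hδD
  have hb' : (1 : ℝ) < b := by exact_mod_cast hb
  have hb0 : (0 : ℝ) < b := by linarith
  have hl : 0 < Real.log b := Real.log_pos hb'
  have hn : (0 : ℝ) < numVertices b h := by exact_mod_cast numVertices_pos b h
  have hlam := activity_pos b hω
  set g := logExponent (2 * (1 + D)) b with hg
  have hg0 : 0 ≤ g := logExponent_nonneg (by linarith) hb
  have h1 : 2 * (1 + activity b ω) ≤ (b : ℝ) ^ (δ + g) := by
    have h2 := activity_le hδ hδD hb hω hωb
    have h3 : 1 ≤ (b : ℝ) ^ δ := Real.one_le_rpow hb'.le hδ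
    rw [Real.rpow_add hb0, hg, rpow_logExponent (by linarith) hb]
    nlinarith
  have h2 : (2 * (1 + activity b ω)) ^ h ≤ (numVertices b h : ℝ) ^ (δ + g) := by
    calc (2 * (1 + activity b ω)) ^ h ≤ ((b : ℝ) ^ (δ + g)) ^ h :=
          pow_le_pow_left₀ (by positivity) h1 h
      _ = ((b : ℝ) ^ h) ^ (δ + g) := by
          rw [← Real.rpow_natCast, ← Real.rpow_natCast, ← Real.rpow_mul hb0.le,
            ← Real.rpow_mul hb0.le, mul_comm]
      _ ≤ (numVertices b h : ℝ) ^ (δ + g) := by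
          refine Real.rpow_le_rpow (by positivity) ?_ (by positivity)
          exact_mod_cast pow_le_numVertices b h
  calc relaxationTime ω Γ ≤ (numVertices b h : ℝ) * (2 * (1 + activity b ω)) ^ h :=
        relaxationTime_le hω Γ
    _ ≤ (numVertices b h : ℝ) * (numVertices b h : ℝ) ^ (δ + g) := by gcongr
    _ = (numVertices b h : ℝ) ^ (1 + δ + g) := by
        rw [add_assoc, Real.rpow_add hn 1, Real.rpow_one]

end Bounds

/-! ### Boundary conditions with nearly constant occupation ratios -/

section Boundaries

variable {b h : ℕ}

/-- The ratio of the weights of the configurations with occupied and with unoccupied root. -/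
noncomputable def occRatio (lam : ℝ) (Γ : Boundary b h) : ℝ :=
  (∑ σ, weight lam Γ σ - ∑ σ, weight₀ lam Γ σ) / ∑ σ, weight₀ lam Γ σ

theorem sum_weight_eq_prod (lam : ℝ) (Γ : Boundary b (h + 1)) :
    ∑ σ, weight lam Γ σ = ∏ i, ∑ σ, weight lam (childBoundary Γ i) σ +
      lam * ∏ i, ∑ σ, weight₀ lam (childBoundary Γ i) σ := by
  rw [sum_weight, sum_pi_prod, sum_pi_prod]

theorem sum_weight₀_eq_prod (lam : ℝ) (Γ : Boundary b (h + 1)) :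
    ∑ σ, weight₀ lam Γ σ = ∏ i, ∑ σ, weight lam (childBoundary Γ i) σ := by
  rw [sum_weight₀, sum_pi_prod]

theorem sum_weight₀_nonneg {lam : ℝ} (hlam : 0 < lam) (Γ : Boundary b h) :
    0 ≤ ∑ σ, weight₀ lam Γ σ :=
  Finset.sum_nonneg fun σ _ => weight₀_nonneg hlam Γ σ

theorem sum_weight₀_le {lam : ℝ} (hlam : 0 < lam) (Γ : Boundary b h) :
    ∑ σ, weight₀ lam Γ σ ≤ ∑ σ, weight lam Γ σ :=
  Finset.sum_le_sum fun σ _ => weight₀_le hlam Γ σ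

theorem sum_weight_pos {lam : ℝ} (hlam : 0 < lam) : ∀ (h : ℕ) (Γ : Boundary b h),
    0 < ∑ σ, weight lam Γ σ := by
  classical
  intro h
  induction h with
  | zero =>
    intro Γ
    have hc : IsConfig Γ (Finset.univ.filter fun v =>
        (⟨v, trivial⟩ : {v : Vertex b 0 // IsLeaf b 0 v}) ∈ Γ) := by
      rw [isConfig_iff]
      refine ⟨fun v _ w _ ha => ha, fun v hv => ?_⟩
      rw [Finset.mem_filter]
      exact and_iff_right (Finset.mem_univ v)
    have hpos : 0 < weight lam Γ (Finset.univ.filter fun v =>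
        (⟨v, trivial⟩ : {v : Vertex b 0 // IsLeaf b 0 v}) ∈ Γ) := by
      rw [weight, if_pos hc]
      positivity
    exact Finset.sum_pos' (fun σ _ => weight_nonneg hlam Γ σ) ⟨_, Finset.mem_univ _, hpos⟩
  | succ h ih =>
    intro Γ
    refine lt_of_lt_of_le ?_ (sum_weight₀_le hlam Γ)
    rw [sum_weight₀_eq_prod]
    exact Finset.prod_pos fun i _ => ih _

theorem sum_weight₀_pos {lam : ℝ} (hlam : 0 < lam) (hh : 1 ≤ h) (Γ : Boundary b h) :
    0 < ∑ σ, weight₀ lam Γ σ := by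
  obtain ⟨k, rfl⟩ : ∃ k, h = k + 1 := ⟨h - 1, by omega⟩
  rw [sum_weight₀_eq_prod]
  exact Finset.prod_pos fun i _ => sum_weight_pos hlam k _

theorem sum_weight_eq_ratio {lam : ℝ} {Γ : Boundary b h} (hΓ : 0 < ∑ σ, weight₀ lam Γ σ) :
    ∑ σ, weight lam Γ σ = (∑ σ, weight₀ lam Γ σ) * (1 + occRatio lam Γ) := by
  rw [occRatio]
  field_simp
  ring

theorem occRatio_nonneg {lam : ℝ} (hlam : 0 < lam) (Γ : Boundary b h) : 0 ≤ occRatio lam Γ :=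
  div_nonneg (sub_nonneg.2 (sum_weight₀_le hlam Γ)) (sum_weight₀_nonneg hlam Γ)

theorem occRatio_succ {lam : ℝ} (hlam : 0 < lam) (Γ : Boundary b (h + 1)) :
    occRatio lam Γ = lam * ∏ i, ((∑ σ, weight₀ lam (childBoundary Γ i) σ) /
      ∑ σ, weight lam (childBoundary Γ i) σ) := by
  have hpos : 0 < ∏ i, ∑ σ, weight lam (childBoundary Γ i) σ :=
    Finset.prod_pos fun i _ => sum_weight_pos hlam h _
  rw [occRatio, sum_weight_eq_prod, sum_weight₀_eq_prod, Finset.prod_div_distrib]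
  field_simp
  ring

theorem occRatio_succ_eq {lam : ℝ} (hlam : 0 < lam) (hh : 1 ≤ h) (Γ : Boundary b (h + 1)) :
    occRatio lam Γ = lam * ∏ i, (1 + occRatio lam (childBoundary Γ i))⁻¹ := by
  rw [occRatio_succ hlam]
  congr 1
  refine Finset.prod_congr rfl fun i _ => ?_
  have h1 := sum_weight₀_pos hlam hh (childBoundary Γ i)
  have h2 := occRatio_nonneg hlam (childBoundary Γ i)
  rw [sum_weight_eq_ratio h1]
  have : 1 + occRatio lam (childBoundary Γ i) ≠ 0 := by positivity
  field_simp

theorem weight₀_empty (lam : ℝ) (σ : Finset (Vertex b 0)) :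
    weight₀ lam (∅ : Boundary b 0) σ = weight lam (∅ : Boundary b 0) σ := by
  rw [weight₀]
  split_ifs with h1
  · rw [weight, if_neg]
    intro hc
    exact (hc.2 ⟨root b 0, trivial⟩).1 h1
  · rfl

theorem weight₀_univ (lam : ℝ) (σ : Finset (Vertex b 0)) :
    weight₀ lam (Set.univ : Boundary b 0) σ = 0 := by
  rw [weight₀]
  split_ifs with h1
  · rfl
  · rw [weight, if_neg]
    intro hc
    exact h1 ((hc.2 ⟨root b 0, trivial⟩).2 trivial)

/-- Two boundary conditions on trees of the same height whose occupation ratios enclose `ω`. -/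
structure Encloses (ω lam : ℝ) (Γ Δ : Boundary b h) : Prop where
  nonneg : 0 ≤ occRatio lam Γ
  le : occRatio lam Γ ≤ ω
  ge : ω ≤ occRatio lam Δ

theorem encloses_base {ω : ℝ} (hω : 0 < ω) (hb : 1 ≤ b) :
    ∃ Γ Δ : Boundary b 1, Encloses ω (activity b ω) Γ Δ ∧ occRatio (activity b ω) Γ = 0 ∧
      occRatio (activity b ω) Δ = activity b ω := by
  have hlam := activity_pos b hω
  have h1 : occRatio (activity b ω) (glueBoundary fun _ : Fin b => (Set.univ : Boundary b 0)) =
      0 := by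
    rw [occRatio_succ hlam, Finset.prod_eq_zero (Finset.mem_univ (⟨0, hb⟩ : Fin b)), mul_zero]
    simp [weight₀_univ]
  have h2 : occRatio (activity b ω) (glueBoundary fun _ : Fin b => (∅ : Boundary b 0)) =
      activity b ω := by
    rw [occRatio_succ hlam, Finset.prod_eq_one, mul_one]
    intro i _
    rw [childBoundary_glueBoundary]
    simp only [weight₀_empty]
    exact div_self (sum_weight_pos hlam 0 _).ne'
  refine ⟨_, _, ⟨h1.ge, h1.le.trans hω.le, ?_⟩, h1, h2⟩
  rw [h2, activity]
  exact le_mul_of_one_le_right hω.le (one_le_pow₀ (by linarith))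

theorem prod_mix (m : ℕ) (hm : m ≤ b) (x y : ℝ) :
    ∏ i : Fin b, (if (i : ℕ) < m then x else y) = x ^ m * y ^ (b - m) := by
  rw [Fin.prod_univ_eq_prod_range (fun i => if i < m then x else y),
    ← Finset.prod_range_mul_prod_Ico _ hm]
  congr 1
  · rw [Finset.prod_congr rfl fun i hi => if_pos (Finset.mem_range.1 hi)]
    simp
  · rw [Finset.prod_congr rfl fun i hi => if_neg (not_lt.2 (Finset.mem_Ico.1 hi).1)]
    simp

/-- A discrete intermediate value argument: attaching `m` copies of `Δ` and `b - m` copies of `Γ`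
below a new root, the occupation ratio decreases with `m` and passes `ω`. Neighbouring values of `m`
give ratios whose quotient is `(1 + occRatio Δ) / (1 + occRatio Γ)`. -/
theorem encloses_step {ω : ℝ} (hω : 0 < ω) (hb : 1 ≤ b) (hh : 1 ≤ h) {Γ Δ : Boundary b h}
    (hΓΔ : Encloses ω (activity b ω) Γ Δ) :
    ∃ Γ' Δ' : Boundary b (h + 1), Encloses ω (activity b ω) Γ' Δ' ∧
      0 < occRatio (activity b ω) Γ' ∧
      occRatio (activity b ω) Δ' * (1 + occRatio (activity b ω) Γ) =
        occRatio (activity b ω) Γ' * (1 + occRatio (activity b ω) Δ) ∧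
      (∀ i, childBoundary Γ' i = Γ ∨ childBoundary Γ' i = Δ) ∧
      (∀ i, childBoundary Δ' i = Γ ∨ childBoundary Δ' i = Δ) := by
  have hlam := activity_pos b hω
  set lam := activity b ω with hlamdef
  set r := occRatio lam Γ with hr
  set s := occRatio lam Δ with hs
  have hr0 : 0 ≤ r := hΓΔ.nonneg
  have hrω : r ≤ ω := hΓΔ.le
  have hsω : ω ≤ s := hΓΔ.ge
  set mix : ℕ → Boundary b (h + 1) := fun m =>
    glueBoundary fun i : Fin b => if (i : ℕ) < m then Δ else Γ with hmix
  set a : ℕ → ℝ := fun m => lam * ((1 + s)⁻¹ ^ m * (1 + r)⁻¹ ^ (b - m)) with ha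
  have hratio : ∀ m ≤ b, occRatio lam (mix m) = a m := by
    intro m hm
    rw [occRatio_succ_eq hlam hh, ha]
    congr 1
    rw [← prod_mix m hm]
    refine Finset.prod_congr rfl fun i _ => ?_
    rw [childBoundary_glueBoundary]
    split_ifs <;> rfl
  have hchild : ∀ m i, childBoundary (mix m) i = Γ ∨ childBoundary (mix m) i = Δ := by
    intro m i
    rw [childBoundary_glueBoundary]
    split_ifs
    · exact Or.inr rfl
    · exact Or.inl rfl
  have ha0 : ω ≤ a 0 := by
    rw [ha]
    simp only [pow_zero, one_mul, Nat.sub_zero]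
    rw [inv_pow, ← div_eq_mul_inv, le_div_iff₀ (by positivity), hlamdef, activity]
    gcongr
  have hab : a b ≤ ω := by
    rw [ha]
    simp only [Nat.sub_self, pow_zero, mul_one]
    have : (0 : ℝ) < 1 + s := by linarith
    rw [inv_pow, ← div_eq_mul_inv, div_le_iff₀ (by positivity), hlamdef, activity]
    gcongr
  obtain ⟨m, hm, hm1, hm2⟩ : ∃ m < b, a (m + 1) ≤ ω ∧ ω ≤ a m := by
    by_contra hcon
    push Not at hcon
    have hall : ∀ m ≤ b, ω ≤ a m := by
      intro m
      induction m with
      | zero => exact fun _ => ha0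
      | succ m ih =>
        intro hm
        by_contra hlt
        exact absurd (ih (by omega)) (not_le.2 (hcon m (by omega) (not_le.1 hlt).le))
    have hlast := hcon (b - 1) (by omega)
    rw [Nat.sub_add_cancel hb] at hlast
    exact absurd (hall (b - 1) (by omega)) (not_le.2 (hlast hab))
  have hs0 : (0 : ℝ) < 1 + s := by linarith
  have hr1 : (0 : ℝ) < 1 + r := by linarith
  have hapos : 0 < a (m + 1) := by
    rw [ha]
    positivity
  refine ⟨mix (m + 1), mix m, ⟨?_, ?_, ?_⟩, ?_, ?_, hchild _, hchild _⟩
  · rw [hratio _ (by omega)]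
    exact hapos.le
  · rwa [hratio _ (by omega)]
  · rwa [hratio _ (by omega)]
  · rwa [hratio _ (by omega)]
  · rw [hratio _ (by omega), hratio _ (by omega), ha]
    have hbm : b - m = (b - (m + 1)) + 1 := by omega
    simp only [hbm, pow_succ]
    field_simp

/-- All occupation ratios at the vertices of height at least `h₀` lie between `lo` and `hi`. -/
def Balanced (lam lo hi : ℝ) (h₀ : ℕ) : (k : ℕ) → Boundary b (h₀ + k) → Prop
  | 0, Γ => lo ≤ occRatio lam Γ ∧ occRatio lam Γ ≤ hi
  | k + 1, Γ => (lo ≤ occRatio lam Γ ∧ occRatio lam Γ ≤ hi) ∧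
      ∀ i, Balanced lam lo hi h₀ k (childBoundary (h := h₀ + k) Γ i)

theorem Balanced.ratio {lam lo hi : ℝ} {h₀ : ℕ} : ∀ {k : ℕ} {Γ : Boundary b (h₀ + k)},
    Balanced lam lo hi h₀ k Γ → lo ≤ occRatio lam Γ ∧ occRatio lam Γ ≤ hi
  | 0, _, hΓ => hΓ
  | _ + 1, _, hΓ => hΓ.1

/-- The quotient of the two ratios approaches `1` under `encloses_step`: its excess over `1` is
multiplied by at most `ω / (1 + ω)`. -/
theorem encloses_step_ratio {ω x : ℝ} (hω : 0 < ω) (hb : 1 ≤ b) (hh : 1 ≤ h)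
    {Γ Δ : Boundary b h} (hΓΔ : Encloses ω (activity b ω) Γ Δ) (hx : 0 ≤ x)
    (hq : occRatio (activity b ω) Δ ≤ (1 + x) * occRatio (activity b ω) Γ) :
    ∃ Γ' Δ' : Boundary b (h + 1), Encloses ω (activity b ω) Γ' Δ' ∧
      occRatio (activity b ω) Δ' ≤ (1 + x * (ω / (1 + ω))) * occRatio (activity b ω) Γ' ∧
      (∀ i, childBoundary Γ' i = Γ ∨ childBoundary Γ' i = Δ) ∧
      (∀ i, childBoundary Δ' i = Γ ∨ childBoundary Δ' i = Δ) := by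
  obtain ⟨Γ', Δ', h1, h2, h3, h4, h5⟩ := encloses_step hω hb hh hΓΔ
  refine ⟨Γ', Δ', h1, ?_, h4, h5⟩
  set r := occRatio (activity b ω) Γ
  set s := occRatio (activity b ω) Δ
  have hr0 : 0 ≤ r := hΓΔ.nonneg
  have hrω : r ≤ ω := hΓΔ.le
  have hkey : 1 + s ≤ (1 + x * (ω / (1 + ω))) * (1 + r) := by
    have h6 : r ≤ ω / (1 + ω) * (1 + r) := by
      rw [div_mul_eq_mul_div, le_div_iff₀ (by linarith)]
      linarith
    have h7 := mul_le_mul_of_nonneg_left h6 hx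
    linarith
  have h8 : occRatio (activity b ω) Δ' * (1 + r) ≤
      (1 + x * (ω / (1 + ω))) * occRatio (activity b ω) Γ' * (1 + r) := by
    rw [h3]
    calc occRatio (activity b ω) Γ' * (1 + s)
        ≤ occRatio (activity b ω) Γ' * ((1 + x * (ω / (1 + ω))) * (1 + r)) := by gcongr
      _ = _ := by ring
  exact le_of_mul_le_mul_right h8 (by linarith)

theorem exists_encloses_ratio {ω : ℝ} (hω : 0 < ω) (hb : 1 ≤ b) : ∀ m : ℕ,
    ∃ Γ Δ : Boundary b (m + 2), Encloses ω (activity b ω) Γ Δ ∧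
      occRatio (activity b ω) Δ ≤
        (1 + activity b ω * (ω / (1 + ω)) ^ m) * occRatio (activity b ω) Γ := by
  have hlam := activity_pos b hω
  intro m
  induction m with
  | zero =>
    obtain ⟨Γ, Δ, h1, h2, h3⟩ := encloses_base hω hb
    obtain ⟨Γ', Δ', h4, h5, h6, -, -⟩ := encloses_step hω hb le_rfl h1
    refine ⟨Γ', Δ', h4, ?_⟩
    rw [h2, h3] at h6
    rw [pow_zero]
    linarith
  | succ m ih =>
    obtain ⟨Γ, Δ, h1, h2⟩ := ih
    obtain ⟨Γ', Δ', h4, h5, -, -⟩ := encloses_step_ratio hω hb (by omega) h1 (by positivity) h2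
    refine ⟨Γ', Δ', h4, ?_⟩
    rw [pow_succ, ← mul_assoc]
    exact h5

/-- Boundary conditions under which the occupation ratios at all vertices of large height are
close to `ω`, as in the broadcasting process. -/
theorem exists_balanced {ω x : ℝ} (hω : 0 < ω) (hb : 1 ≤ b) (hx : 0 < x) :
    ∃ h₀ : ℕ, 1 ≤ h₀ ∧ ∀ k, ∃ Γ : Boundary b (h₀ + k),
      Balanced (activity b ω) (ω / (1 + x)) ((1 + x) * ω) h₀ k Γ := by
  have hlam := activity_pos b hω
  have hq0 : 0 ≤ ω / (1 + ω) := by positivity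
  have hq1 : ω / (1 + ω) < 1 := by
    rw [div_lt_one (by linarith)]
    linarith
  obtain ⟨m, hm⟩ := exists_pow_lt_of_lt_one (div_pos hx hlam) hq1
  have hm' : activity b ω * (ω / (1 + ω)) ^ m ≤ x := by
    rw [lt_div_iff₀ hlam] at hm
    linarith
  have hbounds : ∀ {h : ℕ} {Γ Δ : Boundary b h}, Encloses ω (activity b ω) Γ Δ →
      occRatio (activity b ω) Δ ≤ (1 + x) * occRatio (activity b ω) Γ →
      (ω / (1 + x) ≤ occRatio (activity b ω) Γ ∧ occRatio (activity b ω) Γ ≤ (1 + x) * ω) ∧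
      (ω / (1 + x) ≤ occRatio (activity b ω) Δ ∧ occRatio (activity b ω) Δ ≤ (1 + x) * ω) := by
    intro h Γ Δ h1 h2
    have h3 := h1.le
    have h4 := h1.ge
    have h5 : ω / (1 + x) ≤ ω := div_le_self hω.le (by linarith)
    have h6 : (1 + x) * occRatio (activity b ω) Γ ≤ (1 + x) * ω := by gcongr
    have h7 : ω ≤ (1 + x) * ω := le_mul_of_one_le_left hω.le (by linarith)
    refine ⟨⟨?_, by linarith⟩, by linarith, by linarith⟩
    rw [div_le_iff₀ (by linarith)]
    linarith
  refine ⟨m + 2, by omega, ?_⟩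
  suffices hs : ∀ k, ∃ Γ Δ : Boundary b (m + 2 + k), Encloses ω (activity b ω) Γ Δ ∧
      occRatio (activity b ω) Δ ≤ (1 + x) * occRatio (activity b ω) Γ ∧
      Balanced (activity b ω) (ω / (1 + x)) ((1 + x) * ω) (m + 2) k Γ ∧
      Balanced (activity b ω) (ω / (1 + x)) ((1 + x) * ω) (m + 2) k Δ by
    intro k
    obtain ⟨Γ, -, -, -, hΓ, -⟩ := hs k
    exact ⟨Γ, hΓ⟩
  intro k
  induction k with
  | zero =>
    obtain ⟨Γ, Δ, h1, h2⟩ := exists_encloses_ratio hω hb m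
    have h3 : occRatio (activity b ω) Δ ≤ (1 + x) * occRatio (activity b ω) Γ :=
      h2.trans (mul_le_mul_of_nonneg_right (by linarith) h1.nonneg)
    exact ⟨Γ, Δ, h1, h3, (hbounds h1 h3).1, (hbounds h1 h3).2⟩
  | succ k ih =>
    obtain ⟨Γ, Δ, h1, h2, hΓ, hΔ⟩ := ih
    obtain ⟨Γ', Δ', h3, h4, h5, h6⟩ := encloses_step_ratio hω hb (by omega) h1 hx.le h2
    have h7 : occRatio (activity b ω) Δ' ≤ (1 + x) * occRatio (activity b ω) Γ' := by
      refine h4.trans (mul_le_mul_of_nonneg_right ?_ h3.nonneg)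
      have := mul_le_of_le_one_right hx.le hq1.le
      linarith
    have hchild : ∀ Θ : Boundary b (m + 2 + k), Θ = Γ ∨ Θ = Δ →
        Balanced (activity b ω) (ω / (1 + x)) ((1 + x) * ω) (m + 2) k Θ := by
      rintro Θ (rfl | rfl)
      · exact hΓ
      · exact hΔ
    exact ⟨Γ', Δ', h3, h7, ⟨(hbounds h3 h7).1, fun i => hchild _ (h5 i)⟩,
      ⟨(hbounds h3 h7).2, fun i => hchild _ (h6 i)⟩⟩

theorem nontrivial_config {lam : ℝ} (hlam : 0 < lam) (hh : 1 ≤ h) (Γ : Boundary b h)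
    (hΓ : 0 < occRatio lam Γ) : Nontrivial (Config Γ) := by
  have h0 := sum_weight₀_pos hlam hh Γ
  have h1 : ∑ σ, weight₀ lam Γ σ < ∑ σ, weight lam Γ σ := by
    rw [sum_weight_eq_ratio h0]
    nlinarith
  obtain ⟨σ, -, hσ⟩ := Finset.exists_ne_zero_of_sum_ne_zero h0.ne'
  obtain ⟨τ, -, hτ⟩ := Finset.exists_lt_of_sum_lt h1
  have hσr : root b h ∉ σ := by
    intro hr
    rw [weight₀, if_pos hr] at hσ
    exact hσ rfl
  have hτr : root b h ∈ τ := by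
    by_contra hr
    rw [weight₀, if_neg hr] at hτ
    exact lt_irrefl _ hτ
  have hτw : weight lam Γ τ ≠ 0 := ((weight₀_nonneg hlam Γ τ).trans_lt hτ).ne'
  refine ⟨⟨⟨σ, isConfig_of_weight_ne_zero (weight_ne_zero_of_weight₀ hσ)⟩,
    ⟨τ, isConfig_of_weight_ne_zero hτw⟩, fun e => hσr ?_⟩⟩
  have e' : σ = τ := congrArg Subtype.val e
  rw [e']
  exact hτr

theorem exists_occRatio_pos {lam : ℝ} (hlam : 0 < lam) (hh : 1 ≤ h) :
    ∃ Γ : Boundary b h, 0 < occRatio lam Γ := by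
  obtain ⟨k, rfl⟩ : ∃ k, h = k + 1 := ⟨h - 1, by omega⟩
  obtain ⟨Γ, hΓ⟩ : ∃ Γ : Boundary b k, 0 < ∑ σ, weight₀ lam Γ σ := by
    rcases Nat.eq_zero_or_pos k with rfl | hk
    · refine ⟨∅, ?_⟩
      simp only [weight₀_empty]
      exact sum_weight_pos hlam 0 _
    · exact ⟨∅, sum_weight₀_pos hlam hk _⟩
  refine ⟨glueBoundary fun _ => Γ, ?_⟩
  rw [occRatio_succ hlam]
  exact mul_pos hlam (Finset.prod_pos fun i _ => div_pos hΓ (sum_weight_pos hlam k _))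

end Boundaries

/-! ### The reconstruction function as a test function -/

section Reconstruction

variable {b h : ℕ}

/-- The reconstruction of the root from the configuration at the vertices of height `h₀`: such a
vertex is declared occupied if it is occupied, and a vertex above is declared occupied if none of
its children is. The value is the indicator of the root being declared occupied. -/
noncomputable def declared (h₀ : ℕ) : (k : ℕ) → Finset (Vertex b (h₀ + k)) → ℝ
  | 0, σ => if root b h₀ ∈ σ then 1 else 0
  | k + 1, σ => ∏ i : Fin b, (1 - declared h₀ k (branch (h := h₀ + k) σ i))

theorem declared_succ_glue (h₀ k : ℕ) (x : Bool) (s : Fin b → Finset (Vertex b (h₀ + k))) :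
    declared h₀ (k + 1) (glue x s) = ∏ i, (1 - declared h₀ k (s i)) := by
  have h1 : declared h₀ (k + 1) (glue x s) =
      ∏ i : Fin b, (1 - declared h₀ k (branch (h := h₀ + k) (glue x s) i)) := rfl
  rw [h1, branch_glue]

theorem declared_eq (h₀ : ℕ) : ∀ (k : ℕ) (σ : Finset (Vertex b (h₀ + k))),
    declared h₀ k σ = 0 ∨ declared h₀ k σ = 1
  | 0, σ => by
    rw [declared]
    split_ifs <;> simp
  | k + 1, σ => by
    rw [declared]
    by_cases hc : ∃ i : Fin b, declared h₀ k (branch (h := h₀ + k) σ i) = 1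
    · obtain ⟨i, hi⟩ := hc
      left
      exact Finset.prod_eq_zero (Finset.mem_univ i) (by rw [hi, sub_self])
    · right
      push Not at hc
      refine Finset.prod_eq_one fun i _ => ?_
      rw [(declared_eq h₀ k _).resolve_right (hc i), sub_zero]

theorem declared_sq (h₀ k : ℕ) (σ : Finset (Vertex b (h₀ + k))) :
    declared h₀ k σ ^ 2 = declared h₀ k σ := by
  rcases declared_eq h₀ k σ with h1 | h1 <;> rw [h1] <;> norm_num

theorem declared_nonneg (h₀ k : ℕ) (σ : Finset (Vertex b (h₀ + k))) : 0 ≤ declared h₀ k σ := by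
  rcases declared_eq h₀ k σ with h1 | h1 <;> rw [h1]
  norm_num

theorem declared_le_one (h₀ k : ℕ) (σ : Finset (Vertex b (h₀ + k))) : declared h₀ k σ ≤ 1 := by
  rcases declared_eq h₀ k σ with h1 | h1 <;> rw [h1]
  norm_num

theorem energyDensity_const_mul_one_sub (lam c : ℝ) (σ : Finset (Vertex b h))
    (g : Finset (Vertex b h) → ℝ) :
    energyDensity lam σ (fun t => c * (1 - g t)) = c ^ 2 * energyDensity lam σ g := by
  classical
  rw [energyDensity, energyDensity, mul_left_comm (c ^ 2), Finset.mul_sum (a := c ^ 2)]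
  congr 1
  refine Finset.sum_congr rfl fun v _ => ?_
  split_ifs
  · ring
  · ring

/-- An update in one subtree changes the reconstruction only if no child in the other subtrees is
declared occupied. -/
theorem energyDensity_declared_glue (lam : ℝ) (h₀ k : ℕ) (x : Bool)
    (s : Fin b → Finset (Vertex b (h₀ + k))) :
    energyDensity lam (glue x s) (declared h₀ (k + 1)) =
      ∑ i, (∏ j ∈ Finset.univ.erase i, (1 - declared h₀ k (s j))) *
        energyDensity lam (s i) (declared h₀ k) := by
  have h1 := energyDensity_glue lam x s (declared h₀ (k + 1))
  simp only [declared_succ_glue] at h1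
  have h2 : (if x = true then 1 / (1 + lam) * (∏ i, (1 - declared h₀ k (s i)) -
      ∏ i, (1 - declared h₀ k (s i))) ^ 2 else 0) = 0 := by simp
  rw [h2, zero_add] at h1
  refine h1.trans (Finset.sum_congr rfl fun i _ => ?_)
  set c := ∏ j ∈ Finset.univ.erase i, (1 - declared h₀ k (s j)) with hc
  have hc2 : c ^ 2 = c := by
    rw [hc, ← Finset.prod_pow]
    refine Finset.prod_congr rfl fun j _ => ?_
    have := declared_sq h₀ k (s j)
    linear_combination this
  have h3 : ∀ t, ∏ j, (1 - declared h₀ k (Function.update s i t j)) =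
      c * (1 - declared h₀ k t) := by
    intro t
    rw [← Finset.mul_prod_erase _ _ (Finset.mem_univ i), Function.update_self, mul_comm, hc]
    congr 1
    refine Finset.prod_congr rfl fun j hj => ?_
    rw [Function.update_of_ne (Finset.ne_of_mem_erase hj)]
  simp only [h3]
  rw [energyDensity_const_mul_one_sub, hc2]

theorem sum_pi_prod_erase {X : Type*} [Fintype X] {n : ℕ} (w : Fin n → X → ℝ) (g e : X → ℝ)
    (i : Fin n) :
    ∑ s : Fin n → X, (∏ j, w j (s j)) * ((∏ j ∈ Finset.univ.erase i, g (s j)) * e (s i)) =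
      (∑ x, w i x * e x) * ∏ j ∈ Finset.univ.erase i, ∑ x, w j x * g x := by
  have h1 : ∀ s : Fin n → X,
      (∏ j, w j (s j)) * ((∏ j ∈ Finset.univ.erase i, g (s j)) * e (s i)) =
      ∏ j, w j (s j) * (if j = i then e (s j) else g (s j)) := by
    intro s
    rw [Finset.prod_mul_distrib, ← Finset.mul_prod_erase _ (fun j => if j = i then e (s j)
      else g (s j)) (Finset.mem_univ i), if_pos rfl, mul_comm (e (s i))]
    congr 2
    exact Finset.prod_congr rfl fun j hj => by rw [if_neg (Finset.ne_of_mem_erase hj)]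
  simp only [h1]
  rw [sum_pi_prod fun j x => w j x * (if j = i then e x else g x),
    ← Finset.mul_prod_erase _ _ (Finset.mem_univ i)]
  simp only [if_true]
  congr 1
  exact Finset.prod_congr rfl fun j hj => by simp only [if_neg (Finset.ne_of_mem_erase hj)]

/-- Bounds for the reconstruction: `ε` and `η` bound the probabilities of a wrong declaration given
that the root is unoccupied, respectively occupied; `A` and `B` bound the conditional energies of
the declared value in these two cases. -/
structure ReconstructionBounds (lam ε η A B : ℝ) (h₀ k : ℕ) (Γ : Boundary b (h₀ + k)) : Prop where
  wrong_unocc : ∑ σ, weight₀ lam Γ σ * declared h₀ k σ ≤ ε * ∑ σ, weight₀ lam Γ σ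
  wrong_occ : ∑ σ, weight lam Γ σ * (1 - declared h₀ k σ) -
      ∑ σ, weight₀ lam Γ σ * (1 - declared h₀ k σ) ≤
    η * (∑ σ, weight lam Γ σ - ∑ σ, weight₀ lam Γ σ)
  energy_unocc : ∑ σ, weight₀ lam Γ σ * energyDensity lam σ (declared h₀ k) ≤
    A * ∑ σ, weight₀ lam Γ σ
  energy_occ : ∑ σ, weight lam Γ σ * energyDensity lam σ (declared h₀ k) -
      ∑ σ, weight₀ lam Γ σ * energyDensity lam σ (declared h₀ k) ≤
    B * (∑ σ, weight lam Γ σ - ∑ σ, weight₀ lam Γ σ)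

theorem reconstructionBounds_zero {lam ε η A : ℝ} (hlam : 0 < lam) (hε : 0 ≤ ε) (hη : 0 ≤ η)
    (hA : 0 ≤ A) (h₀ : ℕ) (Γ : Boundary b (h₀ + 0)) :
    ReconstructionBounds lam ε η A 1 h₀ 0 Γ := by
  classical
  have hd : ∀ σ : Finset (Vertex b h₀),
      declared h₀ 0 σ = if root b h₀ ∈ σ then (1 : ℝ) else 0 := fun _ => rfl
  have hZ := sum_weight₀_nonneg hlam Γ
  have hZZ := sum_weight₀_le hlam Γ
  -- only the update of the root changes the declared value
  have hen : ∀ σ : Finset (Vertex b h₀),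
      energyDensity lam σ (declared h₀ 0) ≤ if root b h₀ ∈ σ then 1 else 0 := by
    intro σ
    rw [energyDensity, Finset.sum_eq_single (root b h₀)]
    · simp only [hd, Finset.notMem_erase, if_false, sub_zero]
      by_cases hr : root b h₀ ∈ σ
      · have h1 : 1 / (1 + lam) ≤ 1 := by
          rw [div_le_one (by linarith)]
          linarith
        have h2 : 0 ≤ 1 / (1 + lam) := by positivity
        simp only [hr, if_true]
        split_ifs
        · linarith
        · linarith
      · simp [hr]
    · intro v _ hv
      have : (root b h₀ ∈ σ.erase v) ↔ root b h₀ ∈ σ := by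
        rw [Finset.mem_erase]
        exact and_iff_right hv.symm
      simp [hd, this]
    · simp
  have h₀d : ∀ σ, weight₀ lam Γ σ * (if root b h₀ ∈ σ then (1 : ℝ) else 0) = 0 := by
    intro σ
    by_cases hr : root b h₀ ∈ σ
    · have : weight₀ lam Γ σ = 0 := if_pos hr
      rw [this, zero_mul]
    · rw [if_neg hr, mul_zero]
  have hsub : ∀ σ, weight lam Γ σ - weight₀ lam Γ σ =
      weight lam Γ σ * (if root b h₀ ∈ σ then (1 : ℝ) else 0) := by
    intro σ
    by_cases hr : root b h₀ ∈ σ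
    · have : weight₀ lam Γ σ = 0 := if_pos hr
      rw [this, if_pos hr, sub_zero, mul_one]
    · have : weight₀ lam Γ σ = weight lam Γ σ := if_neg hr
      rw [this, if_neg hr, mul_zero, sub_self]
  refine ⟨?_, ?_, ?_, ?_⟩
  · have h1 : ∀ σ, weight₀ lam Γ σ * declared h₀ 0 σ = 0 := h₀d
    rw [Finset.sum_eq_zero fun σ _ => h1 σ]
    positivity
  · rw [← Finset.sum_sub_distrib, Finset.sum_eq_zero]
    · exact mul_nonneg hη (by linarith)
    · intro σ _
      rw [← sub_mul, hsub, hd]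
      split_ifs <;> simp
  · refine (Finset.sum_nonpos fun σ _ => ?_).trans (mul_nonneg hA hZ)
    calc weight₀ lam Γ σ * energyDensity lam σ (declared h₀ 0)
        ≤ weight₀ lam Γ σ * (if root b h₀ ∈ σ then (1 : ℝ) else 0) :=
          mul_le_mul_of_nonneg_left (hen σ) (weight₀_nonneg hlam Γ σ)
      _ ≤ 0 := (h₀d σ).le
  · rw [one_mul, ← Finset.sum_sub_distrib, ← Finset.sum_sub_distrib]
    refine Finset.sum_le_sum fun σ _ => ?_
    rw [← sub_mul]
    have h1 : energyDensity lam σ (declared h₀ 0) ≤ 1 := (hen σ).trans (by split_ifs <;> norm_num)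
    exact mul_le_of_le_one_right (sub_nonneg.2 (weight₀_le hlam Γ σ)) h1

/-- One level of the reconstruction. A vertex that is unoccupied given its parent stays undeclared
with probability at most `t = (1 + η lo) / (1 + lo)`. -/
theorem ReconstructionBounds.succ {lam ε η A B lo hi t : ℝ} (hlam : 0 < lam) (hε : ε ≤ 1)
    (hη0 : 0 ≤ η) (hη : η ≤ 1) (hA : 0 ≤ A) (hB : 0 ≤ B) (hlo : 0 ≤ lo) {h₀ k : ℕ} (hh₀ : 1 ≤ h₀)
    (ht : t = (1 + η * lo) / (1 + lo)) (Γ : Boundary b (h₀ + (k + 1)))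
    (hb : ∀ i, ReconstructionBounds lam ε η A B h₀ k (childBoundary (h := h₀ + k) Γ i))
    (hr : ∀ i, lo ≤ occRatio lam (childBoundary (h := h₀ + k) Γ i) ∧
      occRatio lam (childBoundary (h := h₀ + k) Γ i) ≤ hi) :
    ReconstructionBounds lam (t ^ b) (b * ε) (b * t ^ (b - 1) * (A + B * hi)) (b * A)
      h₀ (k + 1) Γ := by
  set Z : Fin b → ℝ := fun i => ∑ σ, weight lam (childBoundary (h := h₀ + k) Γ i) σ with hZ
  set Z₀ : Fin b → ℝ := fun i => ∑ σ, weight₀ lam (childBoundary (h := h₀ + k) Γ i) σ with hZ₀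
  set N : Fin b → ℝ := fun i => ∑ σ, weight lam (childBoundary (h := h₀ + k) Γ i) σ *
    (1 - declared h₀ k σ) with hN
  set N₀ : Fin b → ℝ := fun i => ∑ σ, weight₀ lam (childBoundary (h := h₀ + k) Γ i) σ *
    (1 - declared h₀ k σ) with hN₀
  set Q : Fin b → ℝ := fun i => ∑ σ, weight lam (childBoundary (h := h₀ + k) Γ i) σ *
    energyDensity lam σ (declared h₀ k) with hQ
  set Q₀ : Fin b → ℝ := fun i => ∑ σ, weight₀ lam (childBoundary (h := h₀ + k) Γ i) σ *
    energyDensity lam σ (declared h₀ k) with hQ₀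
  have hZ₀pos : ∀ i, 0 < Z₀ i := fun i => sum_weight₀_pos hlam (by omega) _
  have hZr : ∀ i, Z i = Z₀ i * (1 + occRatio lam (childBoundary (h := h₀ + k) Γ i)) := fun i =>
    sum_weight_eq_ratio (hZ₀pos i)
  have ht0 : 0 ≤ t := by
    rw [ht]
    positivity
  have h1d : ∀ σ : Finset (Vertex b (h₀ + k)), 0 ≤ 1 - declared h₀ k σ := fun σ =>
    sub_nonneg.2 (declared_le_one h₀ k σ)
  have hN0 : ∀ i, 0 ≤ N i := fun i => Finset.sum_nonneg fun σ _ =>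
    mul_nonneg (weight_nonneg hlam _ σ) (h1d σ)
  have hN₀0 : ∀ i, 0 ≤ N₀ i := fun i => Finset.sum_nonneg fun σ _ =>
    mul_nonneg (weight₀_nonneg hlam _ σ) (h1d σ)
  have hQ0 : ∀ i, 0 ≤ Q i := fun i => Finset.sum_nonneg fun σ _ =>
    mul_nonneg (weight_nonneg hlam _ σ) (energyDensity_nonneg hlam σ _)
  have hN₀Z : ∀ i, N₀ i ≤ Z₀ i := fun i => Finset.sum_le_sum fun σ _ =>
    mul_le_of_le_one_right (weight₀_nonneg hlam _ σ) (by linarith [declared_nonneg h₀ k σ])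
  have hN₀ge : ∀ i, (1 - ε) * Z₀ i ≤ N₀ i := by
    intro i
    have h1 := (hb i).wrong_unocc
    have h2 : N₀ i = Z₀ i - ∑ σ, weight₀ lam (childBoundary (h := h₀ + k) Γ i) σ *
        declared h₀ k σ := by
      rw [hN₀, hZ₀, ← Finset.sum_sub_distrib]
      exact Finset.sum_congr rfl fun σ _ => by ring
    rw [h2]
    linarith
  have hNle : ∀ i, N i ≤ t * Z i := by
    intro i
    have h1 : N i - N₀ i ≤ η * (Z i - Z₀ i) := (hb i).wrong_occ
    have h2 := hN₀Z i
    have h3 := (hr i).1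
    set r := occRatio lam (childBoundary (h := h₀ + k) Γ i)
    have h4 : N i ≤ Z₀ i * (1 + η * r) := by
      rw [hZr i] at h1
      linarith
    have h5 : 1 + η * r ≤ t * (1 + r) := by
      rw [ht, div_mul_eq_mul_div, le_div_iff₀ (by linarith)]
      nlinarith [mul_nonneg (sub_nonneg.2 hη) (sub_nonneg.2 h3)]
    calc N i ≤ Z₀ i * (1 + η * r) := h4
      _ ≤ Z₀ i * (t * (1 + r)) := mul_le_mul_of_nonneg_left h5 (hZ₀pos i).le
      _ = t * Z i := by rw [hZr i]; ring
  have hQle : ∀ i, Q i ≤ (A + B * hi) * Z i := by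
    intro i
    have h1 : Q₀ i ≤ A * Z₀ i := (hb i).energy_unocc
    have h2 : Q i - Q₀ i ≤ B * (Z i - Z₀ i) := (hb i).energy_occ
    have h3 := hr i
    set r := occRatio lam (childBoundary (h := h₀ + k) Γ i) with hrdef
    have hzi := hZ₀pos i
    have hle : Z₀ i ≤ Z i := sum_weight₀_le hlam _
    have h4 : Z i - Z₀ i ≤ hi * Z i := by
      have : Z i - Z₀ i = r * Z₀ i := by rw [hZr i]; ring
      rw [this]
      exact mul_le_mul h3.2 hle hzi.le ((hlo.trans h3.1).trans h3.2)
    have h5 := mul_le_mul_of_nonneg_left h4 hB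
    have h6 := mul_le_mul_of_nonneg_left hle hA
    linarith
  -- the sums at the new root in terms of those at its children
  have eZ₀ : ∑ σ, weight₀ lam Γ σ = ∏ i, Z i := sum_weight₀_eq_prod (h := h₀ + k) lam Γ
  have eZ : ∑ σ, weight lam Γ σ = ∏ i, Z i + lam * ∏ i, Z₀ i :=
    sum_weight_eq_prod (h := h₀ + k) lam Γ
  have eprod : ∀ w : Fin b → Finset (Vertex b (h₀ + k)) → ℝ,
      ∑ s : Fin b → Finset (Vertex b (h₀ + k)), (∏ i, w i (s i)) *
        ∏ i, (1 - declared h₀ k (s i)) = ∏ i, ∑ σ, w i σ * (1 - declared h₀ k σ) := by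
    intro w
    rw [← sum_pi_prod]
    simp only [Finset.prod_mul_distrib]
  have eF₀ : ∑ σ, weight₀ lam Γ σ * declared h₀ (k + 1) σ = ∏ i, N i := by
    refine (sum_weight₀_mul (h := h₀ + k) lam Γ _).trans ?_
    simp only [declared_succ_glue]
    exact eprod _
  have eF : ∑ σ, weight lam Γ σ * declared h₀ (k + 1) σ = ∏ i, N i + lam * ∏ i, N₀ i := by
    refine (sum_weight_mul (h := h₀ + k) lam Γ _).trans ?_
    simp only [declared_succ_glue]
    rw [eprod, eprod]
  have eQprod : ∀ w : Fin b → Finset (Vertex b (h₀ + k)) → ℝ,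
      ∑ s : Fin b → Finset (Vertex b (h₀ + k)), (∏ i, w i (s i)) *
        ∑ i, (∏ j ∈ Finset.univ.erase i, (1 - declared h₀ k (s j))) *
          energyDensity lam (s i) (declared h₀ k) =
      ∑ i, (∑ σ, w i σ * energyDensity lam σ (declared h₀ k)) *
        ∏ j ∈ Finset.univ.erase i, ∑ σ, w j σ * (1 - declared h₀ k σ) := by
    intro w
    simp only [Finset.mul_sum (s := (Finset.univ : Finset (Fin b)))]
    rw [Finset.sum_comm]
    exact Finset.sum_congr rfl fun i _ => sum_pi_prod_erase w (fun σ => 1 - declared h₀ k σ)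
      (fun σ => energyDensity lam σ (declared h₀ k)) i
  have eQ₀ : ∑ σ, weight₀ lam Γ σ * energyDensity lam σ (declared h₀ (k + 1)) =
      ∑ i, Q i * ∏ j ∈ Finset.univ.erase i, N j := by
    refine (sum_weight₀_mul (h := h₀ + k) lam Γ _).trans ?_
    simp only [energyDensity_declared_glue]
    exact eQprod _
  have eQ : ∑ σ, weight lam Γ σ * energyDensity lam σ (declared h₀ (k + 1)) =
      ∑ i, Q i * ∏ j ∈ Finset.univ.erase i, N j +
        lam * ∑ i, Q₀ i * ∏ j ∈ Finset.univ.erase i, N₀ j := by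
    refine (sum_weight_mul (h := h₀ + k) lam Γ _).trans ?_
    simp only [energyDensity_declared_glue]
    rw [eQprod, eQprod]
  refine ⟨?_, ?_, ?_, ?_⟩
  · rw [eF₀, eZ₀]
    calc ∏ i, N i ≤ ∏ i, t * Z i := Finset.prod_le_prod (fun i _ => hN0 i) fun i _ => hNle i
      _ = t ^ b * ∏ i, Z i := by simp [Finset.prod_mul_distrib]
  · have h1 : ∑ σ, weight lam Γ σ * (1 - declared h₀ (k + 1) σ) -
        ∑ σ, weight₀ lam Γ σ * (1 - declared h₀ (k + 1) σ) = lam * ∏ i, Z₀ i - lam * ∏ i, N₀ i := by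
      simp only [mul_sub, mul_one, Finset.sum_sub_distrib]
      rw [eF, eF₀, eZ, eZ₀]
      ring
    rw [h1, eZ, eZ₀]
    have h2 : (1 - ε) ^ b * ∏ i, Z₀ i ≤ ∏ i, N₀ i := by
      calc (1 - ε) ^ b * ∏ i, Z₀ i = ∏ i, (1 - ε) * Z₀ i := by simp [Finset.prod_mul_distrib]
        _ ≤ ∏ i, N₀ i := Finset.prod_le_prod
            (fun i _ => mul_nonneg (by linarith) (hZ₀pos i).le) fun i _ => hN₀ge i
    have h3 : 1 - b * ε ≤ (1 - ε) ^ b := by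
      have := one_add_mul_le_pow (show (-2 : ℝ) ≤ -ε by linarith) b
      rw [← sub_eq_add_neg] at this
      linarith
    have h4 : 0 ≤ ∏ i, Z₀ i := Finset.prod_nonneg fun i _ => (hZ₀pos i).le
    have h5 : (1 - b * ε) * ∏ i, Z₀ i ≤ ∏ i, N₀ i :=
      (mul_le_mul_of_nonneg_right h3 h4).trans h2
    have h6 := mul_le_mul_of_nonneg_left h5 hlam.le
    linarith
  · rw [eQ₀, eZ₀]
    have h1 : ∀ i ∈ (Finset.univ : Finset (Fin b)), Q i * ∏ j ∈ Finset.univ.erase i, N j ≤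
        t ^ (b - 1) * (A + B * hi) * ∏ i, Z i := by
      intro i _
      have h2 : ∏ j ∈ Finset.univ.erase i, N j ≤
          t ^ (b - 1) * ∏ j ∈ Finset.univ.erase i, Z j := by
        calc ∏ j ∈ Finset.univ.erase i, N j ≤ ∏ j ∈ Finset.univ.erase i, t * Z j :=
              Finset.prod_le_prod (fun j _ => hN0 j) fun j _ => hNle j
          _ = _ := by simp [Finset.prod_mul_distrib]
      have h3 : 0 ≤ ∏ j ∈ Finset.univ.erase i, N j := Finset.prod_nonneg fun j _ => hN0 j
      calc Q i * ∏ j ∈ Finset.univ.erase i, N j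
          ≤ ((A + B * hi) * Z i) * (t ^ (b - 1) * ∏ j ∈ Finset.univ.erase i, Z j) :=
            mul_le_mul (hQle i) h2 h3 ((hQ0 i).trans (hQle i))
        _ = t ^ (b - 1) * (A + B * hi) * (Z i * ∏ j ∈ Finset.univ.erase i, Z j) := by ring
        _ = _ := by rw [Finset.mul_prod_erase _ Z (Finset.mem_univ i)]
    refine (Finset.sum_le_sum h1).trans (le_of_eq ?_)
    simp only [Finset.sum_const, Finset.card_univ, Fintype.card_fin, nsmul_eq_mul]
    ring
  · rw [eQ, eQ₀, eZ, eZ₀, add_sub_cancel_left, add_sub_cancel_left]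
    have h1 : ∀ i ∈ (Finset.univ : Finset (Fin b)), Q₀ i * ∏ j ∈ Finset.univ.erase i, N₀ j ≤
        A * ∏ i, Z₀ i := by
      intro i _
      have h2 : ∏ j ∈ Finset.univ.erase i, N₀ j ≤ ∏ j ∈ Finset.univ.erase i, Z₀ j :=
        Finset.prod_le_prod (fun j _ => hN₀0 j) fun j _ => hN₀Z j
      have h3 : 0 ≤ ∏ j ∈ Finset.univ.erase i, N₀ j := Finset.prod_nonneg fun j _ => hN₀0 j
      calc Q₀ i * ∏ j ∈ Finset.univ.erase i, N₀ j
          ≤ (A * Z₀ i) * ∏ j ∈ Finset.univ.erase i, Z₀ j :=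
            mul_le_mul (hb i).energy_unocc h2 h3 (mul_nonneg hA (hZ₀pos i).le)
        _ = A * (Z₀ i * ∏ j ∈ Finset.univ.erase i, Z₀ j) := by ring
        _ = _ := by rw [Finset.mul_prod_erase _ Z₀ (Finset.mem_univ i)]
    have h4 := mul_le_mul_of_nonneg_left (Finset.sum_le_sum h1) hlam.le
    refine h4.trans (le_of_eq ?_)
    simp only [Finset.sum_const, Finset.card_univ, Fintype.card_fin, nsmul_eq_mul]
    ring

theorem ReconstructionBounds.mono {lam ε η A B ε' η' A' B' : ℝ} (hlam : 0 < lam) {h₀ k : ℕ}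
    {Γ : Boundary b (h₀ + k)} (hΓ : ReconstructionBounds lam ε η A B h₀ k Γ) (hε : ε ≤ ε')
    (hη : η ≤ η') (hA : A ≤ A') (hB : B ≤ B') : ReconstructionBounds lam ε' η' A' B' h₀ k Γ := by
  have h0 := sum_weight₀_nonneg hlam Γ
  have h1 := sub_nonneg.2 (sum_weight₀_le hlam Γ)
  exact ⟨hΓ.wrong_unocc.trans (mul_le_mul_of_nonneg_right hε h0),
    hΓ.wrong_occ.trans (mul_le_mul_of_nonneg_right hη h1),
    hΓ.energy_unocc.trans (mul_le_mul_of_nonneg_right hA h0),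
    hΓ.energy_occ.trans (mul_le_mul_of_nonneg_right hB h1)⟩

/-- Under a balanced boundary condition the errors of the reconstruction stay bounded, and its
energy decays by a factor `θ` per level. -/
theorem reconstructionBounds_of_balanced {lam ε η lo hi t θ : ℝ} (hlam : 0 < lam) (hε0 : 0 ≤ ε)
    (hε : ε ≤ 1) (hη0 : 0 ≤ η) (hη : η ≤ 1) (hlo : 0 ≤ lo) (hθ : 0 < θ) (hb : 1 ≤ b)
    (ht : t = (1 + η * lo) / (1 + lo)) (htε : t ^ b ≤ ε) (hεη : b * ε ≤ η)
    (hstep : b * t ^ (b - 1) * (θ + b * hi) ≤ θ ^ 2) {h₀ : ℕ} (hh₀ : 1 ≤ h₀) :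
    ∀ (k : ℕ) (Γ : Boundary b (h₀ + k)), Balanced lam lo hi h₀ k Γ →
      ReconstructionBounds lam ε η (θ / b * θ ^ k) (θ ^ k) h₀ k Γ := by
  have hb0 : (0 : ℝ) < b := by exact_mod_cast hb
  intro k
  induction k with
  | zero =>
    intro Γ _
    rw [pow_zero]
    exact reconstructionBounds_zero hlam hε0 hη0 (by positivity) h₀ Γ
  | succ k ih =>
    intro Γ hΓ
    have h1 := ReconstructionBounds.succ hlam hε hη0 hη (by positivity) (by positivity) hlo hh₀ ht Γ
      (fun i => ih _ (hΓ.2 i)) (fun i => (hΓ.2 i).ratio)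
    refine h1.mono hlam htε hεη ?_ (le_of_eq ?_)
    · calc b * t ^ (b - 1) * (θ / b * θ ^ k + θ ^ k * hi)
          = (b * t ^ (b - 1) * (θ + b * hi)) * (θ ^ k / b) := by field_simp
        _ ≤ θ ^ 2 * (θ ^ k / b) := by gcongr
        _ = θ / b * θ ^ (k + 1) := by ring
    · field_simp
      ring

/-- The upper bound for the spectral gap that the reconstruction function gives. -/
theorem gap_le_of_balanced {lam ε η lo hi t θ : ℝ} (hlam : 0 < lam) (hε0 : 0 ≤ ε)
    (hε : ε ≤ 1 / 2) (hη0 : 0 ≤ η) (hη : η ≤ 1 / 2) (hlo : 0 < lo) (hhi : 0 ≤ hi) (hθ : 0 < θ)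
    (hb : 1 ≤ b)
    (ht : t = (1 + η * lo) / (1 + lo)) (htε : t ^ b ≤ ε) (hεη : b * ε ≤ η)
    (hstep : b * t ^ (b - 1) * (θ + b * hi) ≤ θ ^ 2) {h₀ : ℕ} (hh₀ : 1 ≤ h₀)
    (k : ℕ) (Γ : Boundary b (h₀ + k)) (hΓ : Balanced lam lo hi h₀ k Γ) [Nonempty (Config Γ)] :
    spectralGap (glauber lam Γ) ≤
      4 * (1 + hi) * (θ / b + hi) / lo * θ ^ k / (numVertices b (h₀ + k) : ℝ) := by
  have hb0 : (0 : ℝ) < b := by exact_mod_cast hb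
  have hn : (0 : ℝ) < numVertices b (h₀ + k) := by exact_mod_cast numVertices_pos b (h₀ + k)
  have hR := reconstructionBounds_of_balanced hlam hε0 (by linarith) hη0 (by linarith) hlo.le hθ hb
    ht htε hεη hstep hh₀ k Γ hΓ
  have hr := hΓ.ratio
  have hgap := glauber_gap_mul_wVar_le lam hlam Γ (declared h₀ k)
  have hZ₀ := sum_weight₀_pos hlam (by omega) Γ
  have hZr := sum_weight_eq_ratio hZ₀
  obtain ⟨h1, h2, h3, h4⟩ := hR
  simp only [mul_sub, mul_one, Finset.sum_sub_distrib] at h2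
  have hF₀ : 0 ≤ ∑ σ, weight₀ lam Γ σ * declared h₀ k σ :=
    Finset.sum_nonneg fun σ _ => mul_nonneg (weight₀_nonneg hlam Γ σ) (declared_nonneg h₀ k σ)
  rw [wVar] at hgap
  simp only [declared_sq] at hgap
  set Z := ∑ σ, weight lam Γ σ with hZdef
  set Z₀ := ∑ σ, weight₀ lam Γ σ with hZ₀def
  set F := ∑ σ, weight lam Γ σ * declared h₀ k σ with hF
  set F₀ := ∑ σ, weight₀ lam Γ σ * declared h₀ k σ with hF₀def
  set Q := ∑ σ, weight lam Γ σ * energyDensity lam σ (declared h₀ k) with hQ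
  set r := occRatio lam Γ with hrdef
  have hFle : Z₀ - F₀ ≤ Z - F := by
    rw [hZ₀def, hF₀def, hZdef, hF, ← Finset.sum_sub_distrib, ← Finset.sum_sub_distrib]
    refine Finset.sum_le_sum fun σ _ => ?_
    have := mul_le_mul_of_nonneg_right (weight₀_le hlam Γ σ)
      (sub_nonneg.2 (declared_le_one h₀ k σ))
    linarith
  have hrZ : Z - Z₀ = r * Z₀ := by rw [hZr]; ring
  rw [← mul_sub, hrZ] at h2
  rw [hrZ] at h4
  have hloZ : lo * Z₀ ≤ r * Z₀ := mul_le_mul_of_nonneg_right hr.1 hZ₀.le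
  have hhiZ : r * Z₀ ≤ hi * Z₀ := mul_le_mul_of_nonneg_right hr.2 hZ₀.le
  have hlZ : 0 < lo * Z₀ := mul_pos hlo hZ₀
  have hFge : lo * Z₀ / 2 ≤ F := by
    have : η * (r * Z₀) ≤ 1 / 2 * (r * Z₀) := mul_le_mul_of_nonneg_right hη (by linarith)
    linarith
  have hNge : Z₀ / 2 ≤ Z - F := by
    have : ε * Z₀ ≤ 1 / 2 * Z₀ := mul_le_mul_of_nonneg_right hε hZ₀.le
    linarith
  have hVge : lo * Z₀ / 2 * (Z₀ / 2) ≤ Z * F - F ^ 2 := by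
    calc lo * Z₀ / 2 * (Z₀ / 2) ≤ F * (Z - F) := mul_le_mul hFge hNge (by linarith) (by linarith)
      _ = _ := by ring
  have hQle : Q ≤ (θ / b + hi) * θ ^ k * Z₀ := by
    have : θ ^ k * (r * Z₀) ≤ θ ^ k * (hi * Z₀) := by gcongr
    linarith
  have hZle : Z ≤ (1 + hi) * Z₀ := by linarith
  have hQ0 : 0 ≤ Q := Finset.sum_nonneg fun σ _ =>
    mul_nonneg (weight_nonneg hlam Γ σ) (energyDensity_nonneg hlam σ _)
  have hgap0 : 0 ≤ spectralGap (glauber lam Γ) := by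
    have := glauber_gap_ge lam hlam Γ
    exact le_trans (by positivity) this
  have hfin : spectralGap (glauber lam Γ) * (lo * Z₀ / 2 * (Z₀ / 2)) ≤
      (4 * (1 + hi) * (θ / b + hi) / lo * θ ^ k / (numVertices b (h₀ + k) : ℝ)) *
        (lo * Z₀ / 2 * (Z₀ / 2)) := by
    calc spectralGap (glauber lam Γ) * (lo * Z₀ / 2 * (Z₀ / 2))
        ≤ spectralGap (glauber lam Γ) * (Z * F - F ^ 2) := mul_le_mul_of_nonneg_left hVge hgap0
      _ ≤ Z * (Q / (numVertices b (h₀ + k) : ℝ)) := hgap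
      _ ≤ ((1 + hi) * Z₀) * (((θ / b + hi) * θ ^ k * Z₀) / (numVertices b (h₀ + k) : ℝ)) := by
          gcongr
      _ = _ := by
          field_simp
          ring
  exact le_of_mul_le_mul_right hfin (by positivity)

end Reconstruction

/-! ### Slow mixing above the threshold -/

section Slow

variable {b : ℕ}

/-- The constant in the bound for the probability that a vertex with unoccupied parent is wrongly
declared occupied by the reconstruction. -/
noncomputable def errorConst (D : ℝ) : ℝ := Real.exp (2 + 2 * (1 + D) ^ 2)

theorem one_le_errorConst {D : ℝ} (hD : 0 < D) : 1 ≤ errorConst D :=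
  Real.one_le_exp (by positivity)

theorem log_sq_le (hb : 2 ≤ b) : Real.log b ^ 2 ≤ 4 * b := by
  have hb0 : (0 : ℝ) ≤ b := Nat.cast_nonneg b
  have hb' : (1 : ℝ) < b := by exact_mod_cast hb
  have hl : 0 < Real.log b := Real.log_pos hb'
  have h1 := Real.log_le_rpow_div hb0 (show (0 : ℝ) < 1 / 2 by norm_num)
  rw [← Real.sqrt_eq_rpow] at h1
  have h2 : Real.log b ≤ 2 * √b := by linarith
  calc Real.log b ^ 2 ≤ (2 * √b) ^ 2 := pow_le_pow_left₀ hl.le h2 2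
    _ = 4 * b := by rw [mul_pow, Real.sq_sqrt hb0]; norm_num

/-- If the occupation ratios of the children are at least `ω / (1 + x)` with `x = 1 / (b * ω)`, and
an occupied child is missed with probability at most `η ≤ 1 / (b * ω)`, then no child of an
unoccupied vertex is declared occupied with probability of order at most `b ^ (-(1 + δ))`. -/
theorem error_pow_le {D δ ω η : ℝ} (hδ : 0 < δ) (hδD : δ ≤ D) (hb : 2 ≤ b)
    (hω : ω = (1 + δ) * Real.log b / b) (hη0 : 0 ≤ η) (hη : η * (b * ω) ≤ 1) :
    ((1 + η * (ω / (1 + 1 / (b * ω)))) / (1 + ω / (1 + 1 / (b * ω)))) ^ b ≤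
      errorConst D * (b : ℝ) ^ (-(1 + δ)) := by
  have hb' : (1 : ℝ) < b := by exact_mod_cast hb
  have hb0 : (0 : ℝ) < b := by linarith
  have hl : 0 < Real.log b := Real.log_pos hb'
  have hω0 : 0 < ω := by rw [hω]; positivity
  have hbω : b * ω = (1 + δ) * Real.log b := by rw [hω]; field_simp
  have hx : 0 < 1 / (b * ω) := by positivity
  set x := 1 / (b * ω) with hxdef
  set lo := ω / (1 + x) with hlo
  have hlo0 : 0 < lo := by positivity
  have hloω : lo ≤ ω := div_le_self hω0.le (by linarith)
  have hgap : ω - lo ≤ 1 / b := by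
    have h1 : ω * x = 1 / b := by rw [hxdef]; field_simp
    have h2 : lo * (1 + x) = ω := by rw [hlo]; field_simp
    have h3 : lo * x ≤ ω * x := by gcongr
    linarith
  have hnum : (1 + η * lo) ^ b ≤ Real.exp 1 := by
    calc (1 + η * lo) ^ b ≤ Real.exp (η * lo) ^ b :=
          pow_le_pow_left₀ (by positivity) (by linarith [Real.add_one_le_exp (η * lo)]) b
      _ = Real.exp (b * (η * lo)) := by rw [← Real.exp_nat_mul]
      _ ≤ Real.exp 1 := by
          refine Real.exp_le_exp.2 (le_trans ?_ hη)
          have : η * lo ≤ η * ω := by gcongr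
          calc b * (η * lo) ≤ b * (η * ω) := by gcongr
            _ = η * (b * ω) := by ring
  have hden : (1 + ω) ^ b ≤ Real.exp 1 * (1 + lo) ^ b := by
    have h1 : 1 + ω ≤ Real.exp (1 / b) * (1 + lo) := by
      have h2 := Real.add_one_le_exp (1 / b : ℝ)
      have h3 : (1 / b + 1) * (1 + lo) ≤ Real.exp (1 / b) * (1 + lo) := by gcongr
      have h4 : 0 ≤ 1 / b * lo := by positivity
      linarith
    calc (1 + ω) ^ b ≤ (Real.exp (1 / b) * (1 + lo)) ^ b :=
          pow_le_pow_left₀ (by positivity) h1 b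
      _ = Real.exp 1 * (1 + lo) ^ b := by
          rw [mul_pow, ← Real.exp_nat_mul, mul_one_div_cancel hb0.ne']
  have hmain : (b : ℝ) ^ (1 + δ) ≤ Real.exp (2 * (1 + D) ^ 2) * (1 + ω) ^ b := by
    have h1 : ω - ω ^ 2 / 2 ≤ Real.log (1 + ω) := by
      refine le_trans ?_ (Real.le_log_one_add_of_nonneg hω0.le)
      rw [le_div_iff₀ (by linarith)]
      nlinarith [pow_pos hω0 3]
    have h2 : b * (ω ^ 2 / 2) ≤ 2 * (1 + D) ^ 2 := by
      have h3 := log_sq_le hb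
      have h4 : b * (ω ^ 2 / 2) = (1 + δ) ^ 2 / 2 * (Real.log b ^ 2 / b) := by
        rw [hω]
        field_simp
      rw [h4]
      have h5 : Real.log b ^ 2 / b ≤ 4 := by rwa [div_le_iff₀ hb0]
      calc (1 + δ) ^ 2 / 2 * (Real.log b ^ 2 / b) ≤ (1 + D) ^ 2 / 2 * 4 := by gcongr
        _ = 2 * (1 + D) ^ 2 := by ring
    calc (b : ℝ) ^ (1 + δ) = Real.exp (b * ω) := by rw [Real.rpow_def_of_pos hb0, hbω, mul_comm]
      _ ≤ Real.exp (2 * (1 + D) ^ 2 + b * Real.log (1 + ω)) := by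
          refine Real.exp_le_exp.2 ?_
          have := mul_le_mul_of_nonneg_left h1 hb0.le
          linarith
      _ = Real.exp (2 * (1 + D) ^ 2) * (1 + ω) ^ b := by
          rw [Real.exp_add, Real.exp_nat_mul, Real.exp_log (by linarith)]
  have hpow : (0 : ℝ) < (b : ℝ) ^ (1 + δ) := Real.rpow_pos_of_pos hb0 _
  rw [div_pow, div_le_iff₀ (by positivity), Real.rpow_neg hb0.le]
  have h6 : (b : ℝ) ^ (1 + δ) ≤ Real.exp (2 * (1 + D) ^ 2) * (Real.exp 1 * (1 + lo) ^ b) :=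
    hmain.trans (mul_le_mul_of_nonneg_left hden (Real.exp_pos _).le)
  have h7 : errorConst D = Real.exp 1 * (Real.exp (2 * (1 + D) ^ 2) * Real.exp 1) := by
    rw [errorConst, ← Real.exp_add, ← Real.exp_add]
    congr 1
    ring
  calc (1 + η * lo) ^ b ≤ Real.exp 1 * 1 := by linarith
    _ ≤ Real.exp 1 * ((Real.exp (2 * (1 + D) ^ 2) * (Real.exp 1 * (1 + lo) ^ b)) *
          ((b : ℝ) ^ (1 + δ))⁻¹) := by
        gcongr
        rw [← div_eq_mul_inv, le_div_iff₀ hpow]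
        linarith
    _ = errorConst D * ((b : ℝ) ^ (1 + δ))⁻¹ * (1 + lo) ^ b := by
        rw [h7]
        ring

/-- The constant in the exponent lost in the lower bound for the relaxation time. -/
noncomputable def slowConst (D : ℝ) : ℝ := 2 * errorConst D * (2 + D) ^ 2

theorem one_le_slowConst {D : ℝ} (hD : 0 < D) : 1 ≤ slowConst D := by
  have h1 := one_le_errorConst hD
  rw [slowConst]
  nlinarith

/-- Above the threshold there are boundary conditions, on all trees of height at least `h₀`, for
which the gap decays by a factor `b ^ (-(δ / 2 - g))` per level, beyond the trivial factor `1 / n`;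
here `g` is of order `log log b / log b`. -/
theorem exists_gap_le {D δ : ℝ} (hδ : 0 < δ) (hδD : δ ≤ D) (hb : 2 ≤ b)
    (hg : logExponent (slowConst D) b < δ / 2) :
    ∃ (h₀ : ℕ) (C : ℝ), 1 ≤ h₀ ∧ 0 < C ∧ ∀ k, ∃ Γ : Boundary b (h₀ + k),
      Nontrivial (Config Γ) ∧
      spectralGap (glauber (activity b ((1 + δ) * Real.log b / b)) Γ) ≤
        C * ((b : ℝ) ^ (logExponent (slowConst D) b - δ / 2)) ^ k /
          (numVertices b (h₀ + k) : ℝ) := by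
  have hD : 0 < D := hδ.trans_le hδD
  have hb' : (1 : ℝ) < b := by exact_mod_cast hb
  have hb0 : (0 : ℝ) < b := by linarith
  have hl : 0 < Real.log b := Real.log_pos hb'
  have hK := one_le_slowConst hD
  set ω := (1 + δ) * Real.log b / b with hω
  have hω0 : 0 < ω := by positivity
  have hbω : b * ω = (1 + δ) * Real.log b := by rw [hω]; field_simp
  set L := 1 + Real.log b with hL
  have hL1 : 1 ≤ L := by linarith
  set K := slowConst D with hKdef
  set g := logExponent K b with hgdef
  set θ := (b : ℝ) ^ (g - δ / 2) with hθ
  -- with this `x` the ratios stay within `1 / b` of `ω`, which costs only a constant in `b`-th powers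
  set x := 1 / (b * ω) with hx
  have hx0 : 0 < x := by positivity
  -- errors of this size change the expected number of occupied children, which is about `b * ω`,
  -- by at most `1`
  set η := 1 / (2 * (1 + D) * L) with hη
  have hη0 : 0 < η := by positivity
  have hη2 : η ≤ 1 / 2 := by
    rw [hη]
    refine one_div_le_one_div_of_le (by norm_num) ?_
    nlinarith
  set lo := ω / (1 + x) with hlo
  have hlo0 : 0 < lo := by positivity
  have hloω : lo ≤ ω := div_le_self hω0.le (by linarith)
  set t := (1 + η * lo) / (1 + lo) with ht
  have ht0 : 0 < t := by positivity
  have hωD : ω ≤ 1 + D := by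
    rw [hω, div_le_iff₀ hb0]
    have := Real.log_le_sub_one_of_pos hb0
    calc (1 + δ) * Real.log b ≤ (1 + D) * b := by gcongr; linarith
      _ = _ := rfl
  have hηω : η * (b * ω) ≤ 1 := by
    rw [hη, hbω, one_div_mul_eq_div, div_le_one (by positivity)]
    have h1 : (1 + δ) * Real.log b ≤ (1 + D) * L := by gcongr; linarith
    have h2 : 0 ≤ (1 + D) * L := by positivity
    linarith
  have hδpow : (0 : ℝ) < (b : ℝ) ^ δ := Real.rpow_pos_of_pos hb0 _
  have htb : b * t ^ b ≤ errorConst D / (b : ℝ) ^ δ := by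
    have h1 := error_pow_le hδ hδD hb hω hη0.le hηω
    rw [← hx, ← hlo, ← ht] at h1
    calc b * t ^ b ≤ b * (errorConst D * (b : ℝ) ^ (-(1 + δ))) := by gcongr
      _ = errorConst D / (b : ℝ) ^ δ := by
          rw [Real.rpow_neg hb0.le, Real.rpow_add hb0, Real.rpow_one]
          field_simp
  -- in this regime `b ^ (δ / 2)` dominates `K * L`
  have hKL : K * L ≤ (b : ℝ) ^ (δ / 2) := by
    rw [← rpow_logExponent (by linarith) hb]
    exact Real.rpow_le_rpow_of_exponent_le hb'.le hg.le
  have hKLδ : K * L ≤ (b : ℝ) ^ δ :=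
    hKL.trans (Real.rpow_le_rpow_of_exponent_le hb'.le (by linarith))
  have hθ0 : 0 < θ := Real.rpow_pos_of_pos hb0 _
  have hθ1 : θ ≤ 1 := Real.rpow_le_one_of_one_le_of_nonpos hb'.le (by linarith)
  have hθsq : θ ^ 2 = (K * L) ^ 2 / (b : ℝ) ^ δ := by
    have h1 : θ = K * L / (b : ℝ) ^ (δ / 2) := by
      rw [hθ, Real.rpow_sub hb0, hgdef, rpow_logExponent (by linarith) hb]
    rw [h1, div_pow, ← Real.rpow_natCast ((b : ℝ) ^ (δ / 2)), ← Real.rpow_mul hb0.le]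
    congr 2
    push_cast
    ring
  have hE := one_le_errorConst hD
  have hKE : 2 * (1 + D) * errorConst D ≤ K := by
    rw [hKdef, slowConst]
    have : 0 ≤ errorConst D * (1 + D + (2 + D) * (1 + D)) := by positivity
    nlinarith
  have htε : t ^ b ≤ η / b := by
    rw [le_div_iff₀ hb0, mul_comm]
    refine htb.trans ?_
    rw [hη, div_le_div_iff₀ hδpow (by positivity)]
    have h1 : 2 * (1 + D) * errorConst D * L ≤ K * L := by gcongr
    linarith
  have hεη : b * (η / b) ≤ η := le_of_eq (by field_simp)
  have hε2 : η / b ≤ 1 / 2 := (div_le_self hη0.le hb'.le).trans hη2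
  have hhi : b * ((1 + x) * ω) ≤ (1 + D) * L := by
    have h1 : b * ((1 + x) * ω) = b * ω + 1 := by
      rw [hx]
      field_simp
    rw [h1, hbω]
    have : (1 + δ) * Real.log b ≤ (1 + D) * Real.log b := by gcongr
    rw [hL]
    linarith
  have hpred : b * t ^ (b - 1) ≤ (2 + D) * (errorConst D / (b : ℝ) ^ δ) := by
    have h1 : 1 ≤ (2 + D) * t := by
      rw [ht, mul_div_assoc', le_div_iff₀ (by linarith)]
      have : 0 ≤ (2 + D) * (η * lo) := by positivity
      linarith
    have h2 : t ^ b = t * t ^ (b - 1) := by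
      rw [← pow_succ']
      congr 1
      omega
    have h3 : 0 ≤ b * t ^ (b - 1) := by positivity
    calc b * t ^ (b - 1) ≤ (2 + D) * t * (b * t ^ (b - 1)) := le_mul_of_one_le_left h3 h1
      _ = (2 + D) * (b * t ^ b) := by rw [h2]; ring
      _ ≤ _ := by gcongr
  have hstep : b * t ^ (b - 1) * (θ + b * ((1 + x) * ω)) ≤ θ ^ 2 := by
    have h1 : θ + b * ((1 + x) * ω) ≤ (2 + D) * L := by linarith
    calc b * t ^ (b - 1) * (θ + b * ((1 + x) * ω))
        ≤ (2 + D) * (errorConst D / (b : ℝ) ^ δ) * ((2 + D) * L) := by gcongr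
      _ = (errorConst D * (2 + D) ^ 2 * L) / (b : ℝ) ^ δ := by ring
      _ ≤ (K * L) ^ 2 / (b : ℝ) ^ δ := by
          gcongr
          have h2 : errorConst D * (2 + D) ^ 2 ≤ K := by
            rw [hKdef, slowConst]
            have : 0 ≤ errorConst D * (2 + D) ^ 2 := by positivity
            linarith
          have h3 : errorConst D * (2 + D) ^ 2 * L ≤ K * L := by gcongr
          have h4 : 1 ≤ K * L := one_le_mul_of_one_le_of_one_le hK hL1
          nlinarith
      _ = θ ^ 2 := hθsq.symm
  obtain ⟨h₀, hh₀, hbal⟩ := exists_balanced hω0 (by omega : 1 ≤ b) hx0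
  refine ⟨h₀, 4 * (1 + (1 + x) * ω) * (θ / b + (1 + x) * ω) / lo, hh₀, by positivity, fun k => ?_⟩
  obtain ⟨Γ, hΓ⟩ := hbal k
  have hlam := activity_pos b hω0
  have hnt : Nontrivial (Config Γ) :=
    nontrivial_config hlam (by omega) Γ (hlo0.trans_le hΓ.ratio.1)
  exact ⟨Γ, hnt, gap_le_of_balanced hlam (by positivity) hε2 hη0.le hη2 hlo0 (by positivity) hθ0
    (by omega) ht htε hεη hstep hh₀ k Γ hΓ⟩

/-- For `δ / 2 ≤ g` the claim is weaker than `T_rel ≥ n`, which also covers the heights below `h₀`. -/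
theorem exists_slow_boundary {D δ : ℝ} (hδ : 0 < δ) (hδD : δ ≤ D) (hb : 2 ≤ b) :
    ∃ c : ℝ, 0 < c ∧ ∀ h : ℕ, 1 ≤ h → ∃ Γ : Boundary b h, Nontrivial (Config Γ) ∧
      c * (numVertices b h : ℝ) ^ (1 + δ / 2 - logExponent (slowConst D) b) ≤
        relaxationTime ((1 + δ) * Real.log b / b) Γ := by
  have hb' : (1 : ℝ) < b := by exact_mod_cast hb
  have hb0 : (0 : ℝ) < b := by linarith
  have hl : 0 < Real.log b := Real.log_pos hb'
  have hω0 : 0 < (1 + δ) * Real.log b / b := by positivity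
  have hlam := activity_pos b hω0
  set g := logExponent (slowConst D) b with hgdef
  have hn0 : ∀ h, (0 : ℝ) < numVertices b h := fun h => by exact_mod_cast numVertices_pos b h
  have hn1 : ∀ h, (1 : ℝ) ≤ numVertices b h := fun h => by exact_mod_cast numVertices_pos b h
  have hsplit : ∀ h, (numVertices b h : ℝ) ^ (1 + δ / 2 - g) =
      numVertices b h * (numVertices b h : ℝ) ^ (δ / 2 - g) := by
    intro h
    rw [add_sub_assoc, Real.rpow_add (hn0 h), Real.rpow_one]
  rcases le_or_gt (δ / 2) g with hg | hg
  · refine ⟨1, one_pos, fun h hh => ?_⟩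
    obtain ⟨Γ, hΓ⟩ := exists_occRatio_pos (b := b) hlam hh
    have hnt := nontrivial_config hlam hh Γ hΓ
    refine ⟨Γ, hnt, le_trans ?_ (le_relaxationTime hω0 Γ)⟩
    rw [one_mul, hsplit]
    exact mul_le_of_le_one_right (hn0 h).le
      (Real.rpow_le_one_of_one_le_of_nonpos (hn1 h) (by linarith))
  · obtain ⟨h₀, C, hh₀, hC, hgap⟩ := exists_gap_le hδ hδD hb hg
    set a := δ / 2 - g with ha
    have ha0 : 0 < a := by linarith
    have hN0 : (0 : ℝ) < (2 * (b : ℝ) ^ h₀) ^ a := Real.rpow_pos_of_pos (by positivity) _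
    set N := (2 * (b : ℝ) ^ h₀) ^ a with hN
    refine ⟨min (1 / N) (1 / (C * N)), by positivity, fun h hh => ?_⟩
    rcases lt_or_ge h h₀ with hlt | hge
    · obtain ⟨Γ, hΓ⟩ := exists_occRatio_pos (b := b) hlam hh
      have hnt := nontrivial_config hlam hh Γ hΓ
      refine ⟨Γ, hnt, le_trans ?_ (le_relaxationTime hω0 Γ)⟩
      have h1 : (numVertices b h : ℝ) ≤ 2 * (b : ℝ) ^ h₀ := by
        have h2 : (numVertices b h : ℝ) ≤ 2 * (b : ℝ) ^ h := by exact_mod_cast numVertices_le hb h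
        have h3 : (b : ℝ) ^ h ≤ (b : ℝ) ^ h₀ := pow_le_pow_right₀ hb'.le hlt.le
        linarith
      have h2 : (numVertices b h : ℝ) ^ a ≤ N := Real.rpow_le_rpow (hn0 h).le h1 ha0.le
      calc min (1 / N) (1 / (C * N)) * (numVertices b h : ℝ) ^ (1 + δ / 2 - g)
          ≤ 1 / N * (numVertices b h * N) := by
            rw [hsplit]
            have := hn0 h
            gcongr
            exact min_le_left _ _
        _ = numVertices b h := by field_simp
    · obtain ⟨k, rfl⟩ := Nat.exists_eq_add_of_le hge
      obtain ⟨Γ, hnt, hle⟩ := hgap k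
      refine ⟨Γ, hnt, ?_⟩
      have hpos := glauber_gap_pos hω0 Γ
      set n := (numVertices b (h₀ + k) : ℝ) with hn
      have hnpos : 0 < n := hn0 _
      have h1 : n ^ a ≤ N * (((b : ℝ) ^ (g - δ / 2)) ^ k)⁻¹ := by
        have h2 : n ≤ (2 * (b : ℝ) ^ h₀) * (b : ℝ) ^ k := by
          have h2' : (numVertices b (h₀ + k) : ℝ) ≤ 2 * (b : ℝ) ^ (h₀ + k) := by
            exact_mod_cast numVertices_le hb (h₀ + k)
          rw [mul_assoc, ← pow_add]
          exact h2'
        calc n ^ a ≤ ((2 * (b : ℝ) ^ h₀) * (b : ℝ) ^ k) ^ a :=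
              Real.rpow_le_rpow hnpos.le h2 ha0.le
          _ = N * ((b : ℝ) ^ k) ^ a := Real.mul_rpow (by positivity) (by positivity)
          _ = N * (((b : ℝ) ^ (g - δ / 2)) ^ k)⁻¹ := by
              congr 1
              rw [← inv_pow, ← Real.rpow_neg hb0.le, neg_sub, ← ha, ← Real.rpow_natCast,
                ← Real.rpow_natCast, ← Real.rpow_mul hb0.le, ← Real.rpow_mul hb0.le, mul_comm]
      have h3 : (C * ((b : ℝ) ^ (g - δ / 2)) ^ k / n)⁻¹ ≤
          relaxationTime ((1 + δ) * Real.log b / b) Γ := inv_anti₀ hpos hle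
      refine le_trans ?_ h3
      calc min (1 / N) (1 / (C * N)) * n ^ (1 + δ / 2 - g)
          ≤ 1 / (C * N) * (n * (N * (((b : ℝ) ^ (g - δ / 2)) ^ k)⁻¹)) := by
            rw [hn, hsplit, ← hn]
            gcongr
            exact min_le_right _ _
        _ = (C * ((b : ℝ) ^ (g - δ / 2)) ^ k / n)⁻¹ := by
            field_simp

end Slow

end HardCoreTree

theorem theorem1 :
    -- for all `ω ≤ ln b / b` and every boundary condition
    (∃ c : ℝ, 0 < c ∧ ∃ C : ℝ, 0 < C ∧ ∃ f : ℕ → ℝ,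
      f =O[atTop] (fun b : ℕ => Real.log (Real.log (b : ℝ)) ^ 2 / Real.log (b : ℝ)) ∧
      ∀ b : ℕ, 2 ≤ b → ∀ ω : ℝ, 0 < ω → ω ≤ Real.log (b : ℝ) / (b : ℝ) →
        ∀ (h : ℕ) (Γ : HardCoreTree.Boundary b h), Nontrivial (HardCoreTree.Config Γ) →
          c * (HardCoreTree.numVertices b h : ℝ) ≤ HardCoreTree.relaxationTime ω Γ ∧
          HardCoreTree.relaxationTime ω Γ ≤
            C * (HardCoreTree.numVertices b h : ℝ) ^ (1 + f b)) ∧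
    -- for all `δ > 0` and `ω = (1 + δ) ln b / b`; the error terms depend only on `b` and on an
    -- upper bound `D` for `δ`
    (∀ D : ℝ, 0 < D →
      (∃ C : ℝ, 0 < C ∧ ∃ f : ℕ → ℝ,
        f =O[atTop] (fun b : ℕ => Real.log (Real.log (b : ℝ)) ^ 2 / Real.log (b : ℝ)) ∧
        ∀ b : ℕ, 2 ≤ b → ∀ δ : ℝ, 0 < δ → δ ≤ D →
          ∀ (h : ℕ) (Γ : HardCoreTree.Boundary b h), Nontrivial (HardCoreTree.Config Γ) →
            HardCoreTree.relaxationTime ((1 + δ) * Real.log (b : ℝ) / (b : ℝ)) Γ ≤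
              C * (HardCoreTree.numVertices b h : ℝ) ^ (1 + δ + f b)) ∧
      (∃ g : ℕ → ℝ,
        g =O[atTop] (fun b : ℕ => Real.log (Real.log (b : ℝ)) / Real.log (b : ℝ)) ∧
        ∀ b : ℕ, 2 ≤ b → ∀ δ : ℝ, 0 < δ → δ ≤ D →
          ∃ Γ : (h : ℕ) → HardCoreTree.Boundary b h, ∃ c : ℝ, 0 < c ∧
            ∀ h : ℕ, 1 ≤ h → Nontrivial (HardCoreTree.Config (Γ h)) ∧
              c * (HardCoreTree.numVertices b h : ℝ) ^ (1 + δ / 2 - g b) ≤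
                HardCoreTree.relaxationTime ((1 + δ) * Real.log (b : ℝ) / (b : ℝ)) (Γ h))) := by
  refine ⟨⟨1, one_pos, 1, one_pos, HardCoreTree.logExponent (2 * (1 + 0)),
    HardCoreTree.logExponent_isBigO_sq (by norm_num), fun b hb ω hω hωb h Γ hΓ => ⟨?_, ?_⟩⟩,
    fun D hD => ⟨⟨1, one_pos, HardCoreTree.logExponent (2 * (1 + D)),
      HardCoreTree.logExponent_isBigO_sq (by linarith), fun b hb δ hδ hδD h Γ hΓ => ?_⟩,
      HardCoreTree.logExponent (HardCoreTree.slowConst D),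
      HardCoreTree.logExponent_isBigO (HardCoreTree.one_le_slowConst hD),
      fun b hb δ hδ hδD => ?_⟩⟩
  · rw [one_mul]
    exact HardCoreTree.le_relaxationTime hω Γ
  · have h1 := HardCoreTree.relaxationTime_le_rpow (D := 0) (δ := 0) le_rfl le_rfl hb hω
      (by simpa using hωb) Γ
    rw [one_mul]
    simpa using h1
  · have hb' : (1 : ℝ) < b := by exact_mod_cast hb
    have hl : 0 < Real.log b := Real.log_pos hb'
    rw [one_mul]
    exact HardCoreTree.relaxationTime_le_rpow hδ.le hδD hb (by positivity) le_rfl Γ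
  · obtain ⟨c, hc, hslow⟩ := HardCoreTree.exists_slow_boundary hδ hδD hb
    choose! Γ hΓ using hslow
    exact ⟨Γ, c, hc, hΓ⟩
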